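/- Let $\mathcal T\subset\mathbb R^d$ be compact, let $\|x\|^2=\int_{\mathcal T}|x(t)|^2dt$ on $L^2(\mathcal T;\mathbb R^r)$ ($d,r\ge 1$), and let $X_i(t)=\mu(t)+\epsilon_i(t)$, $t\in\mathcal T$, $i\ge 1$, be observations with a common mean function $\mu\in L^2(\mathcal T;\mathbb R^r)$ (the null hypothesis of no change). Assume the following. (Weak dependence) $\epsilon_\ell=g(\eta_\ell,\eta_{\ell-1},\dots)$, $\ell\in\mathbb Z$, where the $\eta_\ell$ are i.i.d. random elements of a measurable space $\mathcal S$, $g:\mathcal S^\infty\to L^2(\mathcal T;\mathbb R^r)$ is measurable, and $\epsilon_\ell(t)$ is jointly measurable in $(\omega,t)$; $E\epsilon_1(t)=0$ for almost every $t$; and for some $\delta>0$ and some $\kappa>4+\delta$, $E\|\epsilon_1\|^{4+\delta}<\infty$ and $\sum_{m\ge 1}\big(E\|\epsilon_1-\epsilon_1^{(m)}\|^{4+\delta}\big)^{1/\kappa}<\infty$, where $\epsilon_1^{(m)}=g(\eta_1,\dots,\eta_{2-m},\eta'_{1-m},\eta'_{-m},\dots)$ with $\{\eta'_\ell\}$ an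 independent copy of $\{\eta_\ell\}$. (Kernel) $\mathcal K:\mathbb R\to[0,\infty)$ is even, $\mathcal K(0)=1$, and for some $c>0$, $\mathcal K(u)=0$ for $|u|>c$, $\mathcal K$ is Lipschitz on $[-c,c]$ and $\sup_{-c<u<c}\mathcal K(u)<\infty$. (Bandwidth) $h=h(N)\to\infty$ and $h(N)/N\to 0$ as $N\to\infty$. Put $\mathbf D(t,s)=\sum_{\ell=-\infty}^{\infty}E\,\epsilon_0(t)\epsilon_\ell^\top(s)$, $\overline X_j=X_j-N^{-1}\sum_{i=1}^N X_i$, $\widehat{\boldsymbol\gamma}_\ell(t,s)=\frac1{N-\ell}\sum_{j=1}^{N-\ell}\overline X_j(t)\overline X_{j+\ell}^\top(s)$ for $0\le\ell<N$, $\widehat{\boldsymbol\gamma}_\ell=0$ for $\ell\ge N$, and $$\widehat{\mathbf D}_N(t,s)=\widehat{\boldsymbol\gamma}_0(t,s)+\sum_{\ell=1}^\infty\mathcal K(\ell/h)\big(\widehat{\boldsymbol\gamma}_\ell(t,s)+[\widehat{\boldsymbol\gamma}_\ell(s,t)]^\top\big).$$ Then for almost every $(t,s)\in\mathcal T\times\mathcal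 T$ the series defining $\mathbf D(t,s)$ converges absolutely, entry by entry, $\mathbf D$ is square integrable on $\mathcal T\times\mathcal T$, and, with $|\cdot|$ the Frobenius norm, $$\iint_{\mathcal T\times\mathcal T}\big|\widehat{\mathbf D}_N(t,s)-\mathbf D(t,s)\big|^2\,dt\,ds=o_P(1)\qquad(N\to\infty).$$ Consequently, for every fixed $\ell\ge 1$, $|\widehat\lambda_\ell-\lambda_\ell|=o_P(1)$, where $\lambda_1\ge\lambda_2\ge\cdots$ and $\widehat\lambda_1\ge\widehat\lambda_2\ge\cdots$ are the eigenvalues, counted with multiplicity (the value being $0$ if fewer than $\ell$ of them are positive), of the operators $\phi\mapsto\int_{\mathcal T}\mathbf D(\cdot,s)\phi(s)ds$ and $\phi\mapsto\int_{\mathcal T}\widehat{\mathbf D}_N(\cdot,s)\phi(s)ds$ on $L^2(\mathcal T;\mathbb R^r)$. -/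

import Mathlib

open MeasureTheory ProbabilityTheory Filter Topology
open scoped ENNReal NNReal Matrix

noncomputable section

/-- The space `ℝ^n` with its Euclidean norm. -/
abbrev Vec (n : ℕ) : Type := EuclideanSpace ℝ (Fin n)

/-- The Hilbert space `L²(T; ℝ^r)`, with inner product `⟨x, y⟩ = ∫_T x(t)ᵀ y(t) dt`. -/
abbrev L2Fun {d : ℕ} (T : Set (Vec d)) (r : ℕ) : Type :=
  Lp (Vec r) 2 ((volume : Measure (Vec d)).restrict T)

/-! ### The weak dependence assumption -/

/-- The one-sided past `(η_ℓ, η_{ℓ-1}, η_{ℓ-2}, …)`, at the outcome `ω`. -/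
def pastFrom {Ω S : Type*} (η : ℤ → Ω → S) (ℓ : ℤ) (ω : Ω) : ℕ → S :=
  fun k => η (ℓ - (k : ℤ)) ω

/-- Keep the first `m` entries of `x` and take all later entries from `y`. -/
def splice {S : Type*} (m : ℕ) (x y : ℕ → S) : ℕ → S :=
  fun k => if k < m then x k else y k

/-- `E ‖ε₁ - ε₁^{(m)}‖^p`, where `ε₁ = g(η₁, η₀, …)` and
`ε₁^{(m)} = g(η₁, …, η_{2-m}, η'_{1-m}, η'_{-m}, …)` for an independent copy `η'` of `η`.
The independent copy is realised on the product space: for `(ω, ω')` with law `P ⊗ P`,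
`η` is read at `ω` and `η'` is `η` read at `ω'`. -/
def couplingMoment {Ω S : Type*} [MeasurableSpace Ω] (P : Measure Ω) {d r : ℕ}
    {T : Set (Vec d)} (g : (ℕ → S) → L2Fun T r) (η : ℤ → Ω → S) (p : ℝ) (m : ℕ) : ℝ≥0∞ :=
  ∫⁻ z : Ω × Ω, ‖g (pastFrom η 1 z.1)
      - g (splice m (pastFrom η 1 z.1) (pastFrom η 1 z.2))‖ₑ ^ p ∂(P.prod P)

/-- The weak dependence assumption on the errors `ε_ℓ(t) = ε ℓ ω t`, with shift function `g` and
innovations `η`. -/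
structure WeaklyDependent {Ω S : Type*} [MeasurableSpace Ω] [MeasurableSpace S] (P : Measure Ω)
    {d r : ℕ} (T : Set (Vec d)) (g : (ℕ → S) → L2Fun T r) (η : ℤ → Ω → S)
    (ε : ℤ → Ω → Vec d → Vec r) : Prop where
  /-- `g` is measurable for the product σ-algebra and the Borel σ-algebra of `L²`. -/
  measurable_g : Measurable[MeasurableSpace.pi, borel (L2Fun T r)] g
  measurable_innov : ∀ ℓ, Measurable (η ℓ)
  indep_innov : iIndepFun η P
  ident_innov : ∀ ℓ, IdentDistrib (η ℓ) (η 0) P P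
  /-- the errors are jointly measurable in `(ω, t)` -/
  measurable_err : ∀ ℓ, Measurable (fun q : Ω × Vec d => ε ℓ q.1 q.2)
  /-- `ε_ℓ = g(η_ℓ, η_{ℓ-1}, …)` as elements of `L²(T; ℝ^r)`, almost surely -/
  shift : ∀ ℓ, ∀ᵐ ω ∂P, ∀ᵐ t ∂(volume.restrict T), ε ℓ ω t = g (pastFrom η ℓ ω) t
  /-- the errors are centred -/
  centred : ∀ᵐ t ∂(volume.restrict T), ∫ ω, ε 1 ω t ∂P = 0
  /-- `4 + δ` moments and summable coupling coefficients -/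
  moments : ∃ δ : ℝ, 0 < δ ∧
    ∫⁻ ω, eLpNorm (ε 1 ω) 2 (volume.restrict T) ^ (4 + δ) ∂P < ∞ ∧
    ∃ κ : ℝ, 4 + δ < κ ∧
      ∑' m : ℕ, couplingMoment P g η (4 + δ) (m + 1) ^ (1 / κ) < ∞

/-! ### Kernel and bandwidth -/

/-- The assumption on the weight function `K`. -/
structure KernelAssumption (K : ℝ → ℝ) : Prop where
  nonneg : ∀ u, 0 ≤ K u
  zero : K 0 = 1
  even : ∀ u, K u = K (-u)
  support_lipschitz : ∃ c : ℝ, 0 < c ∧ (∀ u, c < |u| → K u = 0) ∧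
    (∃ C : ℝ≥0, LipschitzOnWith C K (Set.Icc (-c) c)) ∧ BddAbove (K '' Set.Ioo (-c) c)

/-- The assumption on the bandwidth `h = h(N)`. -/
structure BandwidthAssumption (h : ℕ → ℝ) : Prop where
  tendsto_infty : Tendsto h atTop atTop
  ratio : Tendsto (fun N : ℕ => h N / (N : ℝ)) atTop (𝓝 0)

/-! ### The long-run covariance kernel and its estimator -/

/-- The long-run covariance kernel `D(t, s) = ∑_{ℓ ∈ ℤ} E ε_0(t) ε_ℓ(s)ᵀ`, entry by entry. -/
def longRunCov {Ω : Type*} [MeasurableSpace Ω] (P : Measure Ω) {d r : ℕ}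
    (ε : ℤ → Ω → Vec d → Vec r) (t s : Vec d) : Matrix (Fin r) (Fin r) ℝ :=
  Matrix.of fun a b => ∑' ℓ : ℤ, ∫ ω, ε 0 ω t a * ε ℓ ω s b ∂P

/-- The sample mean `N⁻¹ ∑_{j=1}^N X_j(t)`. -/
def sampleMean {d r : ℕ} (N : ℕ) (X : ℕ → Vec d → Vec r) (t : Vec d) : Vec r :=
  (N : ℝ)⁻¹ • ∑ j ∈ Finset.Icc 1 N, X j t

/-- The demeaned observation `X_j(t) - N⁻¹ ∑_{i=1}^N X_i(t)`. -/
def demeaned {d r : ℕ} (N : ℕ) (X : ℕ → Vec d → Vec r) (j : ℕ) (t : Vec d) : Vec r :=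
  X j t - sampleMean N X t

/-- The sample autocovariance kernel of lag `ℓ ≥ 0`; it is `0` for `ℓ ≥ N`. -/
def sampleAutocov {d r : ℕ} (N : ℕ) (X : ℕ → Vec d → Vec r) (ℓ : ℕ) (t s : Vec d) :
    Matrix (Fin r) (Fin r) ℝ :=
  Matrix.of fun a b =>
    if ℓ < N then
      ((N : ℝ) - (ℓ : ℝ))⁻¹ *
        ∑ j ∈ Finset.Icc 1 (N - ℓ), demeaned N X j t a * demeaned N X (j + ℓ) s b
    else 0

/-- The kernel-weighted estimator of the long-run covariance kernel,
`γ̂_0(t,s) + ∑_{ℓ ≥ 1} K(ℓ/h) (γ̂_ℓ(t,s) + γ̂_ℓ(s,t)ᵀ)`; the terms with `ℓ ≥ N` vanish.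
The second summand is the transposed (adjoint) kernel, that is, the autocovariance of lag `-ℓ`. -/
def longRunCovEst {d r : ℕ} (K : ℝ → ℝ) (h : ℝ) (N : ℕ) (X : ℕ → Vec d → Vec r)
    (t s : Vec d) : Matrix (Fin r) (Fin r) ℝ :=
  sampleAutocov N X 0 t s +
    ∑ ℓ ∈ Finset.Ico 1 N,
      K ((ℓ : ℝ) / h) • (sampleAutocov N X ℓ t s + (sampleAutocov N X ℓ s t)ᵀ)

/-- The squared Frobenius norm of a matrix. -/
def frobSq {r : ℕ} (M : Matrix (Fin r) (Fin r) ℝ) : ℝ := ∑ a, ∑ b, M a b ^ 2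

/-- The integrated squared Frobenius distance `∬_{T × T} |A(t,s) - B(t,s)|² dt ds`. -/
def intSqDist {d r : ℕ} (T : Set (Vec d)) (A B : Vec d → Vec d → Matrix (Fin r) (Fin r) ℝ) :
    ℝ≥0∞ :=
  ∫⁻ t in T, ∫⁻ s in T, ENNReal.ofReal (frobSq (A t s - B t s))

/-! ### Ordered eigenvalues of integral operators -/

/-- `μ φ(t) = ∫_T A(t,s) φ(s) ds` for almost every `t ∈ T`. -/
def EigenEq {d r : ℕ} (T : Set (Vec d)) (A : Vec d → Vec d → Matrix (Fin r) (Fin r) ℝ)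
    (μ : ℝ) (φ : L2Fun T r) : Prop :=
  ∀ᵐ t ∂(volume.restrict T), ∀ a, μ * φ t a = ∫ s in T, ∑ b, A t s a b * φ s b

/-- The `ℓ`-th largest eigenvalue (`ℓ = 1, 2, …`), counted with multiplicity, of the operator
`φ ↦ ∫_T A(·,s) φ(s) ds` on `L²(T; ℝ^r)`, for a symmetric square integrable kernel `A`:
the largest `x` for which there are `ℓ` orthonormal eigenfunctions whose eigenvalues are all at
least `x`, and `0` when there are fewer than `ℓ` positive eigenvalues. (The operator is compact and
self-adjoint, so that, `L²(T; ℝ^r)` being infinite dimensional, `0` is then an eigenvalue of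
infinite multiplicity or the limit of the negative eigenvalues; no eigenvalue that has only
finitely many eigenvalues above it is lost.) -/
def orderedEigenvalue {d r : ℕ} (T : Set (Vec d))
    (A : Vec d → Vec d → Matrix (Fin r) (Fin r) ℝ) (ℓ : ℕ) : ℝ :=
  sSup ({0} ∪ {x : ℝ | ∃ (φ : Fin ℓ → L2Fun T r) (μ : Fin ℓ → ℝ),
    Orthonormal ℝ φ ∧ ∀ i, EigenEq T A (μ i) (φ i) ∧ x ≤ μ i})

end

/-!
Consistency of the kernel estimator of the long-run covariance of a causal Bernoulli shift
`ε_i = g(η_i, η_{i-1}, …)` with values in a Hilbert space `H`, here `L²(T; ℝ^r)`.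

Let `T_m i` be the conditional expectation of `ε_i` given `η_i, …, η_{i+1-m}`, and put
`U_k i = T_{k+1} i - T_k i`. By Jensen's inequality `‖ε_i - T_m i‖₄` is at most the `L⁴` norm of the
effect of replacing the innovations of lag `≥ m` by independent copies, and these norms are summable
in `m`. So `ε_i = ∑_k U_k i` in `L⁴`, with `‖U_k i‖₄ ≤ A k` and `∑ A k < ∞`
(`exists_reversedMartingaleArray`). For fixed `k` the entries `U_k i` are reversed martingale
differences: they are determined by the innovations at the times `i - k, …, i`, and centred given
those after the time `i - k` (`ReversedMartingaleArray`). A fourth moment inequality for martingales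
bounds `‖∑ c_i U_k i‖₄` by `2 A k (∑ c_i²)^{1/2}` (`norm_sum_smul_le_of_reversed_martingale`).

Up to the demeaning, the estimator is a quadratic form `∑_{i,j ≤ N} W_N(i - j) ε_i ⊗ ε_j`, with
weights of order `1 / N` carried by a band of width `o(N)` (`longRunCovEst_apply`,
`exists_bandWeights`). For each pair `(k, l)` of rows, the part of `∑ W_N(i - j) U_k i ⊗ U_l j`
with `i - k ≠ j - l` consists of two sums of orthogonal terms, and is `O((h / N)^{1/2}) A k A l`
in `L²`. The part with `i - k = j - l` is a normalized sum of a stationary finitely dependent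
sequence, and converges to the mean `E (U_k 0 ⊗ U_l (l - k))`. Tannery's theorem sums over all
pairs (`ReversedMartingaleArray.tendsto_quadraticForm`), and the limit is the sum of all
autocovariances, since `E (U_k 0 ⊗ U_l n)` vanishes for `n ≠ l - k`
(`ReversedMartingaleArray.hasSum_autocovariance`).
The demeaning changes the quadratic form by `O(h / N)`, as the sample mean has norm `O(N^{-1/2})`.

With `H = L²(T; ℝ^r)` and `⊗` the tensor product into `L²(T × T; ℝ^{r × r})`, the autocovariances
are represented by the pointwise expectations `E ε_0(t) ε_n(s)ᵀ` (`integral_Lp_ae_eq`), and their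
series converges absolutely at almost every `(t, s)` because it converges absolutely in `L²`. The
ordered eigenvalues inherit the convergence by Weyl's inequality
(`abs_sSup_eigenvalueLowerBounds_sub_le`), since the operator norm is at most the `L²` norm of the
kernel. The operator of the limit is compact and symmetric as a limit of operators of finite rank.
-/

noncomputable section

/-! ### Ordered eigenvalues of compact self-adjoint operators -/

section Weyl

variable {H : Type*} [NormedAddCommGroup H] [InnerProductSpace ℝ H]

/-- The set whose supremum is the `ℓ`-th ordered eigenvalue of the operator `A`: `0`, together with
all `x` that are dominated by the eigenvalues of `ℓ` orthonormal eigenvectors. -/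
def eigenvalueLowerBounds (A : H →L[ℝ] H) (ℓ : ℕ) : Set ℝ :=
  {0} ∪ {x : ℝ | ∃ (φ : Fin ℓ → H) (μ : Fin ℓ → ℝ),
    Orthonormal ℝ φ ∧ ∀ i, A (φ i) = μ i • φ i ∧ x ≤ μ i}

/-- The spectral theorem, in the form used below: a vector `v` on which the quadratic form of `A` is
at least `y ‖v‖²` has a nonzero component `w` in some eigenspace with eigenvalue at least `y`. Being
a spectral component of `v`, `w` is orthogonal to every eigenvector that is orthogonal to `v`. -/
lemma exists_eigenvector_of_le_quadratic [CompleteSpace H] {A : H →L[ℝ] H}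
    (hA : IsCompactOperator A)
    (hs : (A : H →ₗ[ℝ] H).IsSymmetric) {y : ℝ} {v : H} (hv : v ≠ 0)
    (hq : y * ‖v‖ ^ 2 ≤ inner ℝ (A v) v) :
    ∃ (μ : ℝ) (w : H), y ≤ μ ∧ w ≠ 0 ∧ A w = μ • w ∧
      ∀ (ν : ℝ) (u : H), A u = ν • u → inner ℝ v u = 0 → inner ℝ w u = 0 := by
  set V : ℝ → Submodule ℝ H := fun μ => Module.End.eigenspace (A : H →ₗ[ℝ] H) μ with hV
  have hVmem : ∀ μ x, x ∈ V μ ↔ A x = μ • x := fun μ x => by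
    simp [hV]
  have hVc : ∀ μ, CompleteSpace (V μ) := by
    intro μ
    have hcl : IsClosed (V μ : Set H) := by
      have : (V μ : Set H) = {x | A x = μ • x} := by ext x; simp [hVmem]
      rw [this]
      exact isClosed_eq A.continuous (continuous_const_smul μ)
    exact hcl.completeSpace_coe
  have hfam : OrthogonalFamily ℝ (fun μ => V μ) fun μ => (V μ).subtypeₗᵢ :=
    hs.orthogonalFamily_eigenspaces
  have hbot : (⨆ μ, V μ)ᗮ = ⊥ :=
    ContinuousLinearMap.orthogonalComplement_iSup_eigenspaces_eq_bot hA hs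
  have hsum : IsHilbertSum ℝ (fun μ => V μ) fun μ => (V μ).subtypeₗᵢ := by
    refine IsHilbertSum.mkInternal V hfam ?_
    rw [Submodule.topologicalClosure_eq_top_iff.2 hbot]
  set w := hsum.linearIsometryEquiv v with hw
  have hsv : HasSum (fun μ => ((w μ : V μ) : H)) v := by
    have := hsum.hasSum_linearIsometryEquiv_symm w
    simpa [hw] using this
  have hwA : ∀ μ, A (w μ : H) = μ • (w μ : H) := fun μ => (hVmem μ _).1 (w μ).2
  have horth : ∀ μ ν : ℝ, μ ≠ ν → ∀ u, A u = ν • u → inner ℝ (w μ : H) u = 0 := by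
    intro μ ν hne u hu
    exact hfam hne (w μ) ⟨u, (hVmem ν u).2 hu⟩
  have hproj : ∀ (ν : ℝ) (u : H), A u = ν • u → inner ℝ v u = inner ℝ (w ν : H) u := by
    intro ν u hu
    have h1 : HasSum (fun μ => inner ℝ (w μ : H) u) (inner ℝ v u) := by
      have := (innerSL ℝ u).hasSum hsv
      simpa [real_inner_comm] using this
    refine h1.unique ?_
    exact hasSum_single ν (fun μ hμ => horth μ ν hμ u hu)
  have hvw : ∀ μ, inner ℝ v (w μ : H) = ‖(w μ : H)‖ ^ 2 := fun μ => by
    rw [hproj μ _ (hwA μ), real_inner_self_eq_norm_sq]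
  have hsq : HasSum (fun μ => ‖(w μ : H)‖ ^ 2) (‖v‖ ^ 2) := by
    have := (innerSL ℝ v).hasSum hsv
    simpa only [innerSL_apply_apply, hvw, real_inner_self_eq_norm_sq] using this
  have hqd : HasSum (fun μ => μ * ‖(w μ : H)‖ ^ 2) (inner ℝ (A v) v) := by
    have := (innerSL ℝ v).hasSum (A.hasSum hsv)
    simpa only [innerSL_apply_apply, hwA, inner_smul_right, hvw, real_inner_comm] using this
  -- if no component with eigenvalue at least `y` survived, the form would be less than `y ‖v‖²`
  by_contra! hcon
  have hzero : ∀ μ, y ≤ μ → (w μ : H) = 0 := by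
    intro μ hμ
    by_contra hne
    obtain ⟨ν, u, hu, hvu, hwu⟩ := hcon μ (w μ) hμ hne (hwA μ)
    by_cases hμν : μ = ν
    · subst hμν
      exact hwu (by rw [← hproj μ u hu, hvu])
    · exact hwu (horth μ ν hμν u hu)
  have hdiff : HasSum (fun μ => (y - μ) * ‖(w μ : H)‖ ^ 2) (y * ‖v‖ ^ 2 - inner ℝ (A v) v) := by
    have := (hsq.mul_left y).sub hqd
    simpa only [sub_mul] using this
  have hnn : ∀ μ, 0 ≤ (y - μ) * ‖(w μ : H)‖ ^ 2 := by
    intro μ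
    rcases le_or_gt y μ with h | h
    · simp [hzero μ h]
    · exact mul_nonneg (sub_nonneg.2 h.le) (sq_nonneg _)
  have hle : ∀ μ, (y - μ) * ‖(w μ : H)‖ ^ 2 ≤ 0 := fun μ =>
    (le_hasSum hdiff μ fun j _ => hnn j).trans (by linarith)
  have hall : ∀ μ, (w μ : H) = 0 := by
    intro μ
    rcases le_or_gt y μ with h | h
    · exact hzero μ h
    · have h1 := hle μ
      have h2 : ‖(w μ : H)‖ ^ 2 ≤ 0 := by
        by_contra! h3
        exact absurd h1 (not_le.2 (mul_pos (sub_pos.2 h) h3))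
      simpa using h2
  apply hv
  refine hsv.unique ?_
  simp [hall]

/-- If the quadratic form of `A` is at least `y ‖·‖²` on an `ℓ`-dimensional space, then `A` has `ℓ`
orthonormal eigenvectors with eigenvalues at least `y`. -/
lemma exists_orthonormal_eigenvectors_of_le_quadratic [CompleteSpace H] {A : H →L[ℝ] H}
    (hA : IsCompactOperator A) (hs : (A : H →ₗ[ℝ] H).IsSymmetric) {y : ℝ} {ℓ : ℕ}
    (φ : Fin ℓ → H) (hφ : LinearIndependent ℝ φ)
    (hq : ∀ v ∈ Submodule.span ℝ (Set.range φ), y * ‖v‖ ^ 2 ≤ inner ℝ (A v) v) (k : ℕ)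
    (hk : k ≤ ℓ) :
    ∃ (ψ : Fin k → H) (μ : Fin k → ℝ), Orthonormal ℝ ψ ∧ ∀ i, A (ψ i) = μ i • ψ i ∧ y ≤ μ i := by
  induction k with
  | zero => exact ⟨Fin.elim0, Fin.elim0, ⟨fun i => i.elim0, fun i => i.elim0⟩, fun i => i.elim0⟩
  | succ k ih =>
    obtain ⟨ψ, μ, hψ, hμ⟩ := ih (Nat.le_of_succ_le hk)
    -- by dimension, some nonzero vector of the span is orthogonal to the eigenvectors found so far
    obtain ⟨v, hv, hv0, hvψ⟩ : ∃ v ∈ Submodule.span ℝ (Set.range φ), v ≠ 0 ∧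
        ∀ i, inner ℝ v (ψ i) = 0 := by
      set W := Submodule.span ℝ (Set.range φ)
      have hW : Module.finrank ℝ W = ℓ := by
        simpa using finrank_span_eq_card hφ
      have hfin : FiniteDimensional ℝ W := FiniteDimensional.span_of_finite ℝ (Set.finite_range φ)
      let L : W →ₗ[ℝ] (Fin k → ℝ) :=
        LinearMap.pi fun i => (innerSL ℝ (ψ i)).toLinearMap.comp W.subtype
      have hker : LinearMap.ker L ≠ ⊥ := by
        apply LinearMap.ker_ne_bot_of_finrank_lt
        rw [hW, Module.finrank_fin_fun]
        exact hk
      obtain ⟨x, hx, hx0⟩ := Submodule.exists_mem_ne_zero_of_ne_bot hker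
      refine ⟨x, x.2, by simpa using hx0, fun i => ?_⟩
      have := congrFun (LinearMap.mem_ker.1 hx) i
      rw [real_inner_comm]
      simpa [L] using this
    obtain ⟨ν, w, hν, hw0, hAw, hw⟩ := exists_eigenvector_of_le_quadratic hA hs hv0 (hq v hv)
    have hwψ : ∀ i, inner ℝ w (ψ i) = 0 := fun i => hw (μ i) (ψ i) (hμ i).1 (hvψ i)
    refine ⟨Fin.cons (‖w‖⁻¹ • w) ψ, Fin.cons ν μ, ⟨?_, ?_⟩, ?_⟩
    · intro i
      refine Fin.cases ?_ (fun j => ?_) i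
      · simpa using norm_smul_inv_norm (𝕜 := ℝ) hw0
      · simpa using hψ.1 j
    · intro i j
      refine Fin.cases ?_ (fun i => ?_) i <;> refine Fin.cases ?_ (fun j => ?_) j
      · simp
      · intro _
        simp [inner_smul_left, hwψ]
      · intro _
        simp [inner_smul_right, real_inner_comm, hwψ]
      · intro hij
        simpa using hψ.2 (fun h => hij (by rw [h]))
    · intro i
      refine Fin.cases ?_ (fun j => ?_) i
      · refine ⟨?_, by simpa using hν⟩
        simp [hAw, smul_smul, mul_comm]
      · simpa using hμ j

lemma quadratic_ge_on_span {A : H →L[ℝ] H} {ℓ : ℕ} {φ : Fin ℓ → H} {μ : Fin ℓ → ℝ} {x : ℝ}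
    (hφ : Orthonormal ℝ φ) (hA : ∀ i, A (φ i) = μ i • φ i ∧ x ≤ μ i) :
    ∀ v ∈ Submodule.span ℝ (Set.range φ), x * ‖v‖ ^ 2 ≤ inner ℝ (A v) v := by
  intro v hv
  obtain ⟨c, rfl⟩ := (Submodule.mem_span_range_iff_exists_fun ℝ).1 hv
  rw [← real_inner_self_eq_norm_sq, hφ.inner_sum, map_sum]
  have : ∑ i, A (c i • φ i) = ∑ i, (c i * μ i) • φ i := by
    simp [(hA _).1, smul_smul]
  rw [this, hφ.inner_sum, Finset.mul_sum]
  refine Finset.sum_le_sum fun i _ => ?_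
  have := mul_le_mul_of_nonneg_right (hA i).2 (mul_self_nonneg (c i))
  simp only [conj_trivial]
  linarith

lemma bddAbove_eigenvalueLowerBounds (A : H →L[ℝ] H) {ℓ : ℕ} (hℓ : 1 ≤ ℓ) :
    BddAbove (eigenvalueLowerBounds A ℓ) := by
  refine ⟨‖A‖, ?_⟩
  rintro x (rfl | ⟨φ, μ, hφ, h⟩)
  · exact norm_nonneg _
  · have h0 := h ⟨0, hℓ⟩
    have h1 := hφ.1 ⟨0, hℓ⟩
    have h2 := A.le_opNorm (φ ⟨0, hℓ⟩)
    rw [h0.1, norm_smul, h1, mul_one, mul_one] at h2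
    exact h0.2.trans ((le_abs_self _).trans h2)

lemma sSup_eigenvalueLowerBounds_le [CompleteSpace H] {A B : H →L[ℝ] H}
    (hB : IsCompactOperator B) (hBs : (B : H →ₗ[ℝ] H).IsSymmetric) {ℓ : ℕ} (hℓ : 1 ≤ ℓ) :
    sSup (eigenvalueLowerBounds A ℓ) ≤ sSup (eigenvalueLowerBounds B ℓ) + ‖A - B‖ := by
  have hbdd := bddAbove_eigenvalueLowerBounds B hℓ
  have h0 : 0 ≤ sSup (eigenvalueLowerBounds B ℓ) := le_csSup hbdd (Or.inl rfl)
  refine csSup_le ⟨0, Or.inl rfl⟩ ?_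
  rintro x (rfl | ⟨φ, μ, hφ, h⟩)
  · exact add_nonneg h0 (norm_nonneg _)
  · have hq : ∀ v ∈ Submodule.span ℝ (Set.range φ),
        (x - ‖A - B‖) * ‖v‖ ^ 2 ≤ inner ℝ (B v) v := by
      intro v hv
      have h1 := quadratic_ge_on_span hφ h v hv
      have h2 : inner ℝ ((A - B) v) v ≤ ‖A - B‖ * ‖v‖ ^ 2 := by
        refine (real_inner_le_norm _ _).trans ?_
        rw [pow_two, ← mul_assoc]
        exact mul_le_mul_of_nonneg_right ((A - B).le_opNorm v) (norm_nonneg _)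
      rw [sub_apply, inner_sub_left] at h2
      linarith
    obtain ⟨ψ, ν, hψ, hν⟩ := exists_orthonormal_eigenvectors_of_le_quadratic hB hBs φ
      hφ.linearIndependent hq ℓ le_rfl
    have := le_csSup hbdd (Or.inr ⟨ψ, ν, hψ, hν⟩ : x - ‖A - B‖ ∈ eigenvalueLowerBounds B ℓ)
    linarith

/-- Weyl's inequality: the ordered eigenvalues of compact self-adjoint operators are `1`-Lipschitz
in the operator norm. -/
lemma abs_sSup_eigenvalueLowerBounds_sub_le [CompleteSpace H] {A B : H →L[ℝ] H}
    (hA : IsCompactOperator A) (hAs : (A : H →ₗ[ℝ] H).IsSymmetric)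
    (hB : IsCompactOperator B) (hBs : (B : H →ₗ[ℝ] H).IsSymmetric) {ℓ : ℕ} (hℓ : 1 ≤ ℓ) :
    |sSup (eigenvalueLowerBounds A ℓ) - sSup (eigenvalueLowerBounds B ℓ)| ≤ ‖A - B‖ := by
  have h1 := sSup_eigenvalueLowerBounds_le (A := A) hB hBs hℓ
  have h2 := sSup_eigenvalueLowerBounds_le (A := B) hA hAs hℓ
  rw [norm_sub_rev] at h2
  rw [abs_sub_le_iff]
  constructor <;> linarith

end Weyl

/-! ### Fourth moments of sums of martingale differences -/

section Moments

variable {Ω : Type*} {m m₀ : MeasurableSpace Ω} {P : Measure Ω}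
  {H : Type*} [NormedAddCommGroup H] [InnerProductSpace ℝ H] [CompleteSpace H]
  {E : Type*} [NormedAddCommGroup E] [InnerProductSpace ℝ E]

instance : ENNReal.HolderTriple 4 4 2 where
  inv_add_inv_eq_inv := by
    have h : (4 : ℝ≥0∞) = 2 * 2 := by norm_num
    rw [h, ENNReal.mul_inv (by simp) (by simp), ← add_mul, ENNReal.inv_two_add_inv_two, one_mul]

instance : Fact ((1 : ℝ≥0∞) ≤ 4) := ⟨by norm_num⟩

lemma condExp_bilin_eq_zero {F₁ F₂ F₃ : Type*} [NormedAddCommGroup F₁] [NormedSpace ℝ F₁]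
    [CompleteSpace F₁] [NormedAddCommGroup F₂] [NormedSpace ℝ F₂] [NormedAddCommGroup F₃]
    [NormedSpace ℝ F₃] [CompleteSpace F₃] (B : F₁ →L[ℝ] F₂ →L[ℝ] F₃) {D : Ω → F₁} {φ : Ω → F₂}
    (hφ : AEStronglyMeasurable[m] φ P) (hDφ : Integrable (fun ω => B (D ω) (φ ω)) P)
    (hD : Integrable D P) (h0 : P[D | m] =ᵐ[P] 0) :
    P[fun ω => B (D ω) (φ ω) | m] =ᵐ[P] 0 := by
  filter_upwards [condExp_bilin_of_aestronglyMeasurable_right B hφ hDφ hD, h0] with ω h1 h2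
  rw [h1, h2]
  simp

lemma integral_eq_zero_of_condExp {F : Type*} [NormedAddCommGroup F] [NormedSpace ℝ F]
    [CompleteSpace F] [IsProbabilityMeasure P] (hm : m ≤ m₀) {D : Ω → F}
    (h0 : P[D | m] =ᵐ[P] 0) : ∫ ω, D ω ∂P = 0 := by
  rw [← integral_condExp hm, integral_congr_ae h0]
  simp

lemma memLp_two_norm_sq {F : Type*} [NormedAddCommGroup F] {f : Ω → F} (hf : MemLp f 4 P) :
    MemLp (fun ω => ‖f ω‖ ^ 2) 2 P := by
  have h := hf.norm.mul (r := 2) hf.norm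
  refine h.ae_eq ?_
  filter_upwards with ω
  simp [pow_two]

lemma integrable_norm_sq_mul_norm_sq {F F' : Type*} [NormedAddCommGroup F] [NormedAddCommGroup F']
    {f : Ω → F} {g : Ω → F'} (hf : MemLp f 4 P)
    (hg : MemLp g 4 P) : Integrable (fun ω => ‖f ω‖ ^ 2 * ‖g ω‖ ^ 2) P :=
  (memLp_two_norm_sq hf).integrable_mul (memLp_two_norm_sq hg)

lemma integrable_norm_pow_four {F : Type*} [NormedAddCommGroup F] {f : Ω → F} (hf : MemLp f 4 P) :
    Integrable (fun ω => ‖f ω‖ ^ 4) P := by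
  refine (integrable_norm_sq_mul_norm_sq hf hf).congr ?_
  filter_upwards with ω
  ring

lemma integral_norm_sq_mul_norm_sq_le {F F' : Type*} [NormedAddCommGroup F]
    [NormedAddCommGroup F'] {f : Ω → F} {g : Ω → F'} (hf : MemLp f 4 P)
    (hg : MemLp g 4 P) {s t : ℝ} (hs : 0 ≤ s) (ht : 0 ≤ t) (hfs : ∫ ω, ‖f ω‖ ^ 4 ∂P ≤ s ^ 2)
    (hgt : ∫ ω, ‖g ω‖ ^ 4 ∂P ≤ t ^ 2) : ∫ ω, ‖f ω‖ ^ 2 * ‖g ω‖ ^ 2 ∂P ≤ s * t := by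
  have h := integral_mul_le_Lp_mul_Lq_of_nonneg (μ := P) (p := 2) (q := 2)
    Real.HolderConjugate.two_two
    (f := fun ω => ‖f ω‖ ^ 2) (g := fun ω => ‖g ω‖ ^ 2)
    (ae_of_all _ fun ω => sq_nonneg _) (ae_of_all _ fun ω => sq_nonneg _)
    (by simpa using memLp_two_norm_sq hf) (by simpa using memLp_two_norm_sq hg)
  refine h.trans ?_
  have e : ∀ x : ℝ, (x ^ 2) ^ (2 : ℝ) = x ^ 4 := fun x => by
    rw [Real.rpow_two]; ring
  simp only [e, ← Real.sqrt_eq_rpow]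
  exact mul_le_mul (Real.sqrt_le_iff.2 ⟨hs, hfs⟩) (Real.sqrt_le_iff.2 ⟨ht, hgt⟩)
    (Real.sqrt_nonneg _) hs

/-- One step of the fourth moment bound for martingales: adding a difference `D` to the martingale
`S` increases the square root of the fourth moment by at most `4 ‖D‖₄²`, because the term that is
linear in `D` has mean zero. -/
lemma integral_norm_add_pow_four_le [IsProbabilityMeasure P] (hm : m ≤ m₀) {S D : Ω → H}
    (hS : MemLp S 4 P) (hD : MemLp D 4 P)
    (hSm : AEStronglyMeasurable[m] S P) (h0 : P[D | m] =ᵐ[P] 0) {s t : ℝ} (hs : 0 ≤ s) (ht : 0 ≤ t)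
    (hSs : ∫ ω, ‖S ω‖ ^ 4 ∂P ≤ s ^ 2) (hDt : ∫ ω, ‖D ω‖ ^ 4 ∂P ≤ t ^ 2) :
    ∫ ω, ‖S ω + D ω‖ ^ 4 ∂P ≤ (s + 4 * t) ^ 2 := by
  have hpt : ∀ ω, ‖S ω + D ω‖ ^ 4 ≤ ‖S ω‖ ^ 4 + 4 * inner ℝ (D ω) (‖S ω‖ ^ 2 • S ω)
      + 8 * (‖S ω‖ ^ 2 * ‖D ω‖ ^ 2) + 3 * ‖D ω‖ ^ 4 := by
    intro ω
    have h1 := norm_add_sq_real (S ω) (D ω)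
    have h2 : inner ℝ (D ω) (‖S ω‖ ^ 2 • S ω) = ‖S ω‖ ^ 2 * inner ℝ (S ω) (D ω) := by
      rw [inner_smul_right, real_inner_comm]
    have h3 := abs_le.1 (abs_real_inner_le_norm (S ω) (D ω))
    have h4 : ‖S ω + D ω‖ ^ 4 = (‖S ω + D ω‖ ^ 2) ^ 2 := by ring
    rw [h4, h1, h2]
    set a := ‖S ω‖
    set b := ‖D ω‖
    set x : ℝ := inner ℝ (S ω) (D ω)
    have ha : 0 ≤ a := norm_nonneg _
    have hb : 0 ≤ b := norm_nonneg _
    have h5 : x ^ 2 ≤ (a * b) ^ 2 := sq_le_sq' h3.1 h3.2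
    have h6 : x * b ^ 2 ≤ (a * b) * b ^ 2 := mul_le_mul_of_nonneg_right h3.2 (sq_nonneg _)
    nlinarith [sq_nonneg (a * b - b ^ 2)]
  have hDint : Integrable D P := hD.integrable (by norm_num)
  have hI1 : Integrable (fun ω => inner ℝ (D ω) (‖S ω‖ ^ 2 • S ω)) P := by
    refine Integrable.mono' (((integrable_norm_pow_four hS).const_mul (1 / 2)).add
      ((integrable_norm_sq_mul_norm_sq hS hD).const_mul (1 / 2)))
      (hD.1.inner ((hS.1.norm.pow 2).smul hS.1)) (ae_of_all _ fun ω => ?_)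
    refine (norm_inner_le_norm _ _).trans ?_
    rw [norm_smul, norm_pow, norm_norm]
    simp only [Pi.add_apply]
    nlinarith [sq_nonneg (‖S ω‖ ^ 2 - ‖S ω‖ * ‖D ω‖)]
  have hz : ∫ ω, inner ℝ (D ω) (‖S ω‖ ^ 2 • S ω) ∂P = 0 := by
    have hφ : AEStronglyMeasurable[m] (fun ω => ‖S ω‖ ^ 2 • S ω) P :=
      ((continuous_norm.pow 2).smul continuous_id).comp_aestronglyMeasurable hSm
    exact integral_eq_zero_of_condExp hm (condExp_bilin_eq_zero (innerSL ℝ) hφ hI1 hDint h0)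
  have hI2 := integrable_norm_sq_mul_norm_sq hS hD
  calc ∫ ω, ‖S ω + D ω‖ ^ 4 ∂P
      ≤ ∫ ω, (‖S ω‖ ^ 4 + 4 * inner ℝ (D ω) (‖S ω‖ ^ 2 • S ω)
        + 8 * (‖S ω‖ ^ 2 * ‖D ω‖ ^ 2) + 3 * ‖D ω‖ ^ 4) ∂P := by
        refine integral_mono (integrable_norm_pow_four (hS.add hD)) ?_ hpt
        exact (((integrable_norm_pow_four hS).add (hI1.const_mul 4)).add (hI2.const_mul 8)).add
          ((integrable_norm_pow_four hD).const_mul 3)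
    _ = ∫ ω, ‖S ω‖ ^ 4 ∂P + 4 * 0 + 8 * ∫ ω, ‖S ω‖ ^ 2 * ‖D ω‖ ^ 2 ∂P
        + 3 * ∫ ω, ‖D ω‖ ^ 4 ∂P := by
        have i1 : Integrable (fun ω => ‖S ω‖ ^ 4 + 4 * inner ℝ (D ω) (‖S ω‖ ^ 2 • S ω)) P :=
          (integrable_norm_pow_four hS).add (hI1.const_mul 4)
        have i2 : Integrable (fun ω => ‖S ω‖ ^ 4 + 4 * inner ℝ (D ω) (‖S ω‖ ^ 2 • S ω)
            + 8 * (‖S ω‖ ^ 2 * ‖D ω‖ ^ 2)) P := i1.add (hI2.const_mul 8)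
        rw [integral_add i2 ((integrable_norm_pow_four hD).const_mul 3),
          integral_add i1 (hI2.const_mul 8),
          integral_add (integrable_norm_pow_four hS) (hI1.const_mul 4), integral_const_mul,
          integral_const_mul, integral_const_mul, hz]
    _ ≤ s ^ 2 + 4 * 0 + 8 * (s * t) + 3 * t ^ 2 := by
        have := integral_norm_sq_mul_norm_sq_le hS hD hs ht hSs hDt
        linarith
    _ ≤ (s + 4 * t) ^ 2 := by nlinarith [sq_nonneg t]

lemma norm_Lp_four_pow {F : Type*} [NormedAddCommGroup F] (f : Lp F 4 P) :
    ‖f‖ ^ 4 = ∫ ω, ‖f ω‖ ^ 4 ∂P := by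
  have h := (Lp.memLp f).eLpNorm_eq_integral_rpow_norm (by norm_num) (by norm_num)
  have e : (4 : ℝ≥0∞).toReal = ((4 : ℕ) : ℝ) := by norm_num
  rw [e] at h
  simp only [Real.rpow_natCast] at h
  have hn : 0 ≤ ∫ ω, ‖f ω‖ ^ 4 ∂P := integral_nonneg fun ω => by positivity
  rw [Lp.norm_def, h, ENNReal.toReal_ofReal (Real.rpow_nonneg hn _),
    Real.rpow_inv_natCast_pow hn (by norm_num)]

/-- The fourth moment bound for weighted sums of reversed martingale differences: if `D i` is
measurable for `𝒢 i` and centred given `𝒢 (i + 1)`, then `‖∑ c i D i‖₄ ≤ 2 A (∑ c i ²)^{1/2}`. -/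
lemma norm_sum_smul_le_of_reversed_martingale [IsProbabilityMeasure P]
    {𝒢 : ℤ → MeasurableSpace Ω} (h𝒢 : Antitone 𝒢) (hle : ∀ k, 𝒢 k ≤ m₀) {D : ℤ → Lp H 4 P}
    (hDm : ∀ i, D i ∈ lpMeas H ℝ (𝒢 i) 4 P)
    (h0 : ∀ i, P[D i | 𝒢 (i + 1)] =ᵐ[P] 0) {A : ℝ} (hA : ∀ i, ‖D i‖ ≤ A) (c : ℤ → ℝ)
    (I : Finset ℤ) : ‖∑ i ∈ I, c i • D i‖ ≤ 2 * A * √(∑ i ∈ I, c i ^ 2) := by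
  have hA0 : 0 ≤ A := (norm_nonneg _).trans (hA 0)
  have key : ‖∑ i ∈ I, c i • D i‖ ^ 4 ≤ (4 * (A ^ 2 * ∑ i ∈ I, c i ^ 2)) ^ 2 := by
    -- remove the smallest index: the other terms are measurable for the σ-algebra of its successor
    induction I using Finset.induction_on_min with
    | empty => simp
    | insert a I ha ih =>
      have hnot : a ∉ I := fun h => (ha a h).ne rfl
      set S := ∑ i ∈ I, c i • D i with hS
      have hSm : S ∈ lpMeas H ℝ (𝒢 (a + 1)) 4 P := by
        refine Submodule.sum_mem _ fun i hi => Submodule.smul_mem _ _ ?_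
        rw [mem_lpMeas_iff_aestronglyMeasurable]
        exact ((mem_lpMeas_iff_aestronglyMeasurable.1 (hDm i))).mono
          (h𝒢 (Int.add_one_le_iff.2 (ha i hi)))
      have h0' : P[(c a • D a : Lp H 4 P) | 𝒢 (a + 1)] =ᵐ[P] 0 := by
        refine (condExp_congr_ae (Lp.coeFn_smul (c a) (D a))).trans
          ((condExp_smul (c a) _ _).trans ?_)
        filter_upwards [h0 a] with ω h
        simp [h]
      have h4 : ‖c a • D a‖ ^ 4 ≤ (A ^ 2 * c a ^ 2) ^ 2 := by
        have h1 : ‖c a • D a‖ ≤ |c a| * A := by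
          rw [norm_smul, Real.norm_eq_abs]
          exact mul_le_mul_of_nonneg_left (hA a) (abs_nonneg _)
        calc _ ≤ (|c a| * A) ^ 4 := pow_le_pow_left₀ (norm_nonneg _) h1 4
          _ = (A ^ 2 * |c a| ^ 2) ^ 2 := by ring
          _ = _ := by rw [sq_abs]
      have hstep := integral_norm_add_pow_four_le (hle (a + 1)) (Lp.memLp S)
        (Lp.memLp (c a • D a))
        (mem_lpMeas_iff_aestronglyMeasurable.1 hSm) h0' (s := 4 * (A ^ 2 * ∑ i ∈ I, c i ^ 2))
        (t := A ^ 2 * c a ^ 2) (by positivity) (by positivity)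
        (by rw [← norm_Lp_four_pow]; exact ih) (by rw [← norm_Lp_four_pow]; exact h4)
      rw [Finset.sum_insert hnot, Finset.sum_insert hnot, ← hS, add_comm, norm_Lp_four_pow]
      refine (le_of_eq ?_).trans (hstep.trans (le_of_eq (by ring)))
      refine integral_congr_ae ?_
      filter_upwards [Lp.coeFn_add S (c a • D a)] with ω h
      rw [h, Pi.add_apply]
  have hs : 0 ≤ ∑ i ∈ I, c i ^ 2 := Finset.sum_nonneg fun i _ => sq_nonneg _
  refine le_of_pow_le_pow_left₀ (n := 4) (by norm_num) (by positivity) (key.trans (le_of_eq ?_))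
  have := Real.sq_sqrt hs
  calc _ = 16 * A ^ 4 * (∑ i ∈ I, c i ^ 2) ^ 2 := by ring
    _ = 16 * A ^ 4 * ((√(∑ i ∈ I, c i ^ 2)) ^ 2) ^ 2 := by rw [this]
    _ = _ := by ring

/-- The variance bound for `L`-dependent sequences: only the `2 L` pairs near the diagonal count. -/
lemma norm_sum_sq_le_of_inner_eq_zero {T : ℤ → E} {I : Finset ℤ} {L : ℕ} {M : ℝ}
    (hT : ∀ i ∈ I, ‖T i‖ ≤ M)
    (h0 : ∀ i ∈ I, ∀ j ∈ I, i + L ≤ j → inner ℝ (T i) (T j) = 0) :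
    ‖∑ i ∈ I, T i‖ ^ 2 ≤ I.card * (2 * L * M ^ 2) := by
  rw [← real_inner_self_eq_norm_sq, sum_inner]
  rw [← nsmul_eq_mul]
  refine Finset.sum_le_card_nsmul _ _ _ fun i hi => ?_
  rw [inner_sum]
  have hz : ∀ j ∈ I, j ∉ Finset.Ioo (i - L) (i + L) → inner ℝ (T i) (T j) = 0 := by
    intro j hj hn
    rw [Finset.mem_Ioo, not_and_or, not_lt, not_lt] at hn
    rcases hn with h | h
    · rw [real_inner_comm]; exact h0 j hj i hi (by omega)
    · exact h0 i hi j hj h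
  have hM : 0 ≤ M := (norm_nonneg _).trans (hT i hi)
  calc ∑ j ∈ I, inner ℝ (T i) (T j)
      = ∑ j ∈ I with j ∈ Finset.Ioo (i - L : ℤ) (i + L), inner ℝ (T i) (T j) := by
        rw [Finset.sum_filter]
        refine Finset.sum_congr rfl fun j hj => ?_
        split_ifs with h
        · rfl
        · exact hz j hj h
    _ ≤ (I.filter fun j => j ∈ Finset.Ioo (i - L : ℤ) (i + L)).card • M ^ 2 := by
        refine Finset.sum_le_card_nsmul _ _ _ fun j hj => ?_
        refine (real_inner_le_norm _ _).trans ?_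
        rw [pow_two]
        exact mul_le_mul (hT i hi) (hT j (Finset.mem_filter.1 hj).1) (norm_nonneg _) hM
    _ ≤ (2 * L) * M ^ 2 := by
        rw [nsmul_eq_mul]
        refine mul_le_mul_of_nonneg_right ?_ (sq_nonneg _)
        have h1 : (I.filter fun j => j ∈ Finset.Ioo (i - L : ℤ) (i + L)).card
            ≤ (Finset.Ioo (i - L : ℤ) (i + L)).card :=
          Finset.card_le_card fun j hj => (Finset.mem_filter.1 hj).2
        have h2 : (Finset.Ioo (i - L : ℤ) (i + L)).card ≤ 2 * L := by
          rw [Int.card_Ioo]; omega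
        exact_mod_cast h1.trans h2

end Moments

/-! ### Reversed martingale arrays and their quadratic forms -/

section Arrays

set_option linter.unusedSectionVars false

variable {Ω : Type*} {m m₁ m₂ m₀ : MeasurableSpace Ω} {P : Measure Ω}
  {H : Type*} [NormedAddCommGroup H] [InnerProductSpace ℝ H]
  {E : Type*} [NormedAddCommGroup E] [InnerProductSpace ℝ E]

/-- The bilinear map `L⁴ × L⁴ → L²` obtained by applying `B` pointwise. -/
abbrev bilinLp (P : Measure Ω) (B : H →L[ℝ] H →L[ℝ] E) : Lp H 4 P →L[ℝ] Lp H 4 P →L[ℝ] Lp E 2 P :=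
  B.holderL P 4 4 2

lemma coeFn_bilinLp (B : H →L[ℝ] H →L[ℝ] E) (f g : Lp H 4 P) :
    bilinLp P B f g =ᵐ[P] fun ω => B (f ω) (g ω) :=
  B.coeFn_holder f g

lemma norm_bilinLp_le {B : H →L[ℝ] H →L[ℝ] E} (hB : ‖B‖ ≤ 1) (f g : Lp H 4 P) :
    ‖bilinLp P B f g‖ ≤ ‖f‖ * ‖g‖ := by
  refine (B.norm_holder_apply_apply_le (r := 2) f g).trans ?_
  rw [mul_assoc]
  exact mul_le_of_le_one_left (by positivity) hB

lemma bilinLp_flip (B : H →L[ℝ] H →L[ℝ] E) (f g : Lp H 4 P) :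
    bilinLp P B.flip f g = bilinLp P B g f := by
  refine Lp.ext ?_
  filter_upwards [coeFn_bilinLp B.flip f g, coeFn_bilinLp B g f] with ω h1 h2
  rw [h1, h2, ContinuousLinearMap.flip_apply]

lemma bilinLp_mem_lpMeas {B : H →L[ℝ] H →L[ℝ] E} {f g : Lp H 4 P}
    (hf : f ∈ lpMeas H ℝ m 4 P) (hg : g ∈ lpMeas H ℝ m 4 P) :
    bilinLp P B f g ∈ lpMeas E ℝ m 2 P := by
  rw [mem_lpMeas_iff_aestronglyMeasurable] at *
  have h : AEStronglyMeasurable[m] (fun ω => B (f ω) (g ω)) P :=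
    B.continuous₂.comp_aestronglyMeasurable (hf.prodMk hg)
  exact h.congr (coeFn_bilinLp B f g).symm

lemma lpMeas_mono {F : Type*} [NormedAddCommGroup F] [NormedSpace ℝ F] (h : m₁ ≤ m₂)
    {p : ℝ≥0∞} {f : Lp F p P} (hf : f ∈ lpMeas F ℝ m₁ p P) : f ∈ lpMeas F ℝ m₂ p P := by
  rw [mem_lpMeas_iff_aestronglyMeasurable] at *
  exact hf.mono h

variable [IsProbabilityMeasure P] [CompleteSpace H] [CompleteSpace E]

/-- Expectation, as a continuous linear map on `L²(Ω; E)`. -/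
def expectationL (P : Measure Ω) [IsProbabilityMeasure P] (E : Type*) [NormedAddCommGroup E]
    [InnerProductSpace ℝ E] [CompleteSpace E] : Lp E 2 P →L[ℝ] E :=
  LinearMap.mkContinuous
    { toFun := fun f => ∫ ω, f ω ∂P
      map_add' := fun f g => by
        rw [← integral_add ((Lp.memLp f).integrable (by norm_num))
          ((Lp.memLp g).integrable (by norm_num))]
        exact integral_congr_ae (Lp.coeFn_add f g)
      map_smul' := fun c f => by
        rw [RingHom.id_apply, ← integral_smul]
        exact integral_congr_ae (Lp.coeFn_smul c f) } 1 fun f => by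
    rw [one_mul]
    change ‖∫ ω, f ω ∂P‖ ≤ _
    rw [Lp.norm_def, ← toReal_enorm]
    refine ENNReal.toReal_mono (Lp.eLpNorm_ne_top f) ?_
    refine (enorm_integral_le_lintegral_enorm _).trans ?_
    rw [← eLpNorm_one_eq_lintegral_enorm]
    exact eLpNorm_le_eLpNorm_of_exponent_le (by norm_num) (Lp.aestronglyMeasurable f)

lemma expectationL_apply (f : Lp E 2 P) : expectationL P E f = ∫ ω, f ω ∂P := rfl

lemma norm_expectationL_le (f : Lp E 2 P) : ‖expectationL P E f‖ ≤ ‖f‖ := by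
  simpa using (expectationL P E).le_of_opNorm_le (LinearMap.mkContinuous_norm_le _ zero_le_one _) f

lemma norm_const_Lp_two (e : E) : ‖Lp.const 2 P e‖ = ‖e‖ := by
  rw [Lp.norm_const _ _ _ two_ne_zero]
  simp

lemma condExp_bilinLp_eq_zero {B : H →L[ℝ] H →L[ℝ] E} {D Z : Lp H 4 P}
    (hZ : Z ∈ lpMeas H ℝ m 4 P) (h0 : P[D | m] =ᵐ[P] 0) :
    P[bilinLp P B D Z | m] =ᵐ[P] 0 := by
  refine (condExp_congr_ae (coeFn_bilinLp B D Z)).trans ?_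
  refine condExp_bilin_eq_zero B (mem_lpMeas_iff_aestronglyMeasurable.1 hZ) ?_
    ((Lp.memLp D).integrable (by norm_num)) h0
  exact ((Lp.memLp (bilinLp P B D Z)).integrable (by norm_num)).congr (coeFn_bilinLp B D Z)

lemma inner_eq_zero_of_condExp (hm : m ≤ m₀) {C w : Lp E 2 P}
    (hw : w ∈ lpMeas E ℝ m 2 P) (h0 : P[C | m] =ᵐ[P] 0) : inner ℝ C w = 0 := by
  rw [L2.inner_def]
  exact integral_eq_zero_of_condExp hm (condExp_bilin_eq_zero (innerSL ℝ)
    (mem_lpMeas_iff_aestronglyMeasurable.1 hw) (L2.integrable_inner C w)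
    ((Lp.memLp C).integrable (by norm_num)) h0)

lemma sum_sq_le_of_band {W : ℤ → ℝ} {w : ℝ} {R : ℕ} (hw : ∀ x, |W x| ≤ w)
    (hR : ∀ x, (R : ℤ) < |x| → W x = 0) (i : ℤ) (J : Finset ℤ) :
    ∑ j ∈ J, W (i - j) ^ 2 ≤ (2 * R + 1) * w ^ 2 := by
  calc ∑ j ∈ J, W (i - j) ^ 2
      ≤ ∑ j ∈ J with j ∈ Finset.Icc (i - R : ℤ) (i + R), W (i - j) ^ 2 := by
        rw [Finset.sum_filter]
        refine Finset.sum_le_sum fun j _ => ?_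
        split_ifs with h
        · exact le_rfl
        · rw [hR (i - j)]
          · simp
          · rw [Finset.mem_Icc, not_and_or] at h
            rw [lt_abs]
            omega
    _ ≤ (J.filter fun j => j ∈ Finset.Icc (i - R : ℤ) (i + R)).card • w ^ 2 := by
        refine Finset.sum_le_card_nsmul _ _ _ fun j _ => ?_
        exact sq_le_sq' (abs_le.1 (hw _)).1 (abs_le.1 (hw _)).2
    _ ≤ (2 * R + 1) * w ^ 2 := by
        rw [nsmul_eq_mul]
        refine mul_le_mul_of_nonneg_right ?_ (sq_nonneg _)
        have h1 : (J.filter fun j => j ∈ Finset.Icc (i - R : ℤ) (i + R)).card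
            ≤ (Finset.Icc (i - R : ℤ) (i + R)).card :=
          Finset.card_le_card fun j hj => (Finset.mem_filter.1 hj).2
        have h2 : (Finset.Icc (i - R : ℤ) (i + R)).card ≤ 2 * R + 1 := by
          rw [Int.card_Icc]; omega
        exact_mod_cast h1.trans h2

lemma sum_abs_le_of_band {W : ℤ → ℝ} {w : ℝ} {R : ℕ} (hw : ∀ x, |W x| ≤ w)
    (hR : ∀ x, (R : ℤ) < |x| → W x = 0) (i : ℤ) (J : Finset ℤ) :
    |∑ j ∈ J, W (i - j)| ≤ (2 * R + 1) * w := by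
  refine (Finset.abs_sum_le_sum_abs _ _).trans ?_
  -- the square-sum bound, applied to the square root of `|W|`
  have hw0 : 0 ≤ w := (abs_nonneg _).trans (hw 0)
  have h := sum_sq_le_of_band (W := fun x => √|W x|) (w := √w) (R := R)
    (fun x => by
      rw [abs_of_nonneg (Real.sqrt_nonneg _)]
      exact Real.sqrt_le_sqrt (hw x))
    (fun x hx => by simp [hR x hx]) i J
  simpa [Real.sq_sqrt, abs_nonneg, hw0] using h

/-- Arrays `U k i` (`i` is time, `k` is the depth) such that `U k i` is determined by the
innovations at the times `i - k, …, i`, and is centred given the innovations after time `i - k`. The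
σ-algebra of the innovations at times `≥ n` is `𝒢 n`, the one of those at times `≤ n` is `𝓕 n`. -/
structure ReversedMartingaleArray (P : Measure Ω) (𝒢 𝓕 : ℤ → MeasurableSpace Ω)
    (U : ℕ → ℤ → Lp H 4 P) (A : ℕ → ℝ) : Prop where
  anti : Antitone 𝒢
  future_le : ∀ n, 𝒢 n ≤ m₀
  mono : Monotone 𝓕
  past_le : ∀ n, 𝓕 n ≤ m₀
  indep : ∀ n, Indep (𝓕 (n - 1)) (𝒢 n) P
  mem_future : ∀ (k : ℕ) (i : ℤ), U k i ∈ lpMeas H ℝ (𝒢 (i - k)) 4 P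
  mem_past : ∀ k i, U k i ∈ lpMeas H ℝ (𝓕 i) 4 P
  condExp_eq_zero : ∀ (k : ℕ) (i : ℤ), P[U k i | 𝒢 (i + 1 - k)] =ᵐ[P] 0
  norm_le : ∀ k i, ‖U k i‖ ≤ A k
  summable : Summable A

namespace ReversedMartingaleArray

variable {𝒢 𝓕 : ℤ → MeasurableSpace Ω} {U : ℕ → ℤ → Lp H 4 P} {A : ℕ → ℝ}

lemma nonneg (hU : ReversedMartingaleArray P 𝒢 𝓕 U A) (k : ℕ) : 0 ≤ A k :=
  (norm_nonneg _).trans (hU.norm_le k 0)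

lemma norm_sum_smul_le (hU : ReversedMartingaleArray P 𝒢 𝓕 U A) (k : ℕ) (c : ℤ → ℝ)
    (I : Finset ℤ) : ‖∑ i ∈ I, c i • U k i‖ ≤ 2 * A k * √(∑ i ∈ I, c i ^ 2) :=
  norm_sum_smul_le_of_reversed_martingale (𝒢 := fun n => 𝒢 (n - k))
    (fun a b hab => hU.anti (by omega)) (fun n => hU.future_le _) (hU.mem_future k)
    (hU.condExp_eq_zero k) (hU.norm_le k) c I

/-- The part of a quadratic form in which the left factor reaches further into the past is a sum of
reversed martingale differences, hence small. -/
lemma norm_sum_left_deeper_sq_le (hU : ReversedMartingaleArray P 𝒢 𝓕 U A)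
    {B : H →L[ℝ] H →L[ℝ] E} (hB : ‖B‖ ≤ 1) {W : ℤ → ℝ} {w : ℝ} {R : ℕ} (hw : ∀ x, |W x| ≤ w)
    (hR : ∀ x, (R : ℤ) < |x| → W x = 0) (k l : ℕ) (I : Finset ℤ) :
    ‖∑ i ∈ I, ∑ j ∈ I with i - k < j - l, W (i - j) • bilinLp P B (U k i) (U l j)‖ ^ 2
      ≤ 8 * I.card * (2 * R + 1) * (w * (A k * A l)) ^ 2 := by
  have hw0 : 0 ≤ w := (abs_nonneg _).trans (hw 0)
  -- `Z i` collects the right factors that meet `U k i`; it is determined by the innovations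
  -- after the time `i - k`
  set Z : ℤ → Lp H 4 P := fun i => ∑ j ∈ I with i - k < j - l, W (i - j) • U l j with hZ
  have hZmem : ∀ i, Z i ∈ lpMeas H ℝ (𝒢 (i + 1 - k)) 4 P := fun i =>
    Submodule.sum_mem _ fun j hj => Submodule.smul_mem _ _ <|
      lpMeas_mono (hU.anti (by have := (Finset.mem_filter.1 hj).2; omega)) (hU.mem_future l j)
  have hZn : ∀ i, ‖Z i‖ ≤ 2 * A l * √((2 * R + 1) * w ^ 2) := fun i =>
    (hU.norm_sum_smul_le l (fun j => W (i - j)) _).trans <|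
      mul_le_mul_of_nonneg_left (Real.sqrt_le_sqrt (sum_sq_le_of_band hw hR i _))
        (mul_nonneg zero_le_two (hU.nonneg l))
  have hsum : ∀ i ∈ I, ∑ j ∈ I with i - k < j - l, W (i - j) • bilinLp P B (U k i) (U l j)
      = bilinLp P B (U k i) (Z i) := fun i _ => by
    simp only [hZ, map_sum, map_smul]
  rw [Finset.sum_congr rfl hsum]
  refine (norm_sum_sq_le_of_inner_eq_zero (L := 1)
    (M := A k * (2 * A l * √((2 * R + 1) * w ^ 2))) ?_ ?_).trans (le_of_eq ?_)
  · intro i _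
    exact (norm_bilinLp_le hB _ _).trans
      (mul_le_mul (hU.norm_le k i) (hZn i) (norm_nonneg _) (hU.nonneg k))
  · intro i _ j _ hij
    refine inner_eq_zero_of_condExp (hU.future_le (i + 1 - k)) ?_
      (condExp_bilinLp_eq_zero (hZmem i) (hU.condExp_eq_zero k i))
    push_cast at hij
    refine lpMeas_mono (hU.anti (a := i + 1 - k) (b := j - k) (by omega)) ?_
    exact bilinLp_mem_lpMeas (hU.mem_future k j)
      (lpMeas_mono (hU.anti (by omega)) (hZmem j))
  · have h : √((2 * R + 1) * w ^ 2) ^ 2 = (2 * R + 1) * w ^ 2 := Real.sq_sqrt (by positivity)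
    calc _ = I.card * (2 * (A k * (2 * A l)) ^ 2 * √((2 * R + 1) * w ^ 2) ^ 2) := by
          push_cast; ring
      _ = _ := by rw [h]; ring

end ReversedMartingaleArray
end Arrays

section Arrays

set_option linter.unusedSectionVars false

variable {Ω : Type*} {m m₁ m₂ m₀ : MeasurableSpace Ω} {P : Measure Ω}
  {H : Type*} [NormedAddCommGroup H] [InnerProductSpace ℝ H]
  {E : Type*} [NormedAddCommGroup E] [InnerProductSpace ℝ E]
variable [IsProbabilityMeasure P] [CompleteSpace H] [CompleteSpace E]

lemma condExp_sub_const_eq_zero_of_indep (h₁ : m₁ ≤ m₀) (h₂ : m₂ ≤ m₀) (hind : Indep m₁ m₂ P)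
    {Y : Lp E 2 P} (hY : Y ∈ lpMeas E ℝ m₁ 2 P) :
    P[(Y - Lp.const 2 P (expectationL P E Y) : Lp E 2 P) | m₂] =ᵐ[P] 0 := by
  have hm := mem_lpMeas_iff_aestronglyMeasurable.1 hY
  obtain ⟨Y', hY', hYY'⟩ := hm
  have hint : Integrable Y P := (Lp.memLp Y).integrable (by norm_num)
  have h1 : P[Y | m₂] =ᵐ[P] fun _ => ∫ ω, Y ω ∂P := by
    refine (condExp_congr_ae hYY').trans ?_
    rw [integral_congr_ae hYY']
    exact condExp_indep_eq h₁ h₂ hY' hind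
  have h2 : (Y - Lp.const 2 P (expectationL P E Y) : Lp E 2 P)
      =ᵐ[P] (Y : Ω → E) - fun _ => ∫ ω, Y ω ∂P := by
    filter_upwards [Lp.coeFn_sub Y (Lp.const 2 P (expectationL P E Y)),
      Lp.coeFn_const 2 P (expectationL P E Y)] with ω h1 h2
    rw [h1, Pi.sub_apply, h2]
    rfl
  refine (condExp_congr_ae h2).trans ((condExp_sub hint (integrable_const _) m₂).trans ?_)
  filter_upwards [h1] with ω h
  rw [Pi.sub_apply, h, condExp_const h₂]
  simp

lemma const_mem_lpMeas (e : E) : Lp.const 2 P e ∈ lpMeas E ℝ m 2 P := by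
  rw [mem_lpMeas_iff_aestronglyMeasurable]
  exact aestronglyMeasurable_const.congr (Lp.coeFn_const 2 P e).symm

namespace ReversedMartingaleArray

variable {𝒢 𝓕 : ℤ → MeasurableSpace Ω} {U : ℕ → ℤ → Lp H 4 P} {A : ℕ → ℝ}
  {B : H →L[ℝ] H →L[ℝ] E}

lemma norm_bilinLp_le (hU : ReversedMartingaleArray P 𝒢 𝓕 U A) (hB : ‖B‖ ≤ 1) (k l : ℕ) (i j : ℤ) :
    ‖bilinLp P B (U k i) (U l j)‖ ≤ A k * A l :=
  (_root_.norm_bilinLp_le hB _ _).trans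
    (mul_le_mul (hU.norm_le k i) (hU.norm_le l j) (norm_nonneg _) (hU.nonneg k))

/-- Products of two entries that reach back to different times have mean zero. -/
lemma expectationL_bilinLp_eq_zero (hU : ReversedMartingaleArray P 𝒢 𝓕 U A)
    {k l : ℕ} {i j : ℤ} (h : i - k ≠ j - l) :
    expectationL P E (bilinLp P B (U k i) (U l j)) = 0 := by
  rcases lt_or_gt_of_ne h with h | h
  · exact integral_eq_zero_of_condExp (hU.future_le (i + 1 - k)) (condExp_bilinLp_eq_zero
      (lpMeas_mono (hU.anti (by omega)) (hU.mem_future l j)) (hU.condExp_eq_zero k i))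
  · rw [← bilinLp_flip]
    exact integral_eq_zero_of_condExp (hU.future_le (j + 1 - l)) (condExp_bilinLp_eq_zero
      (lpMeas_mono (hU.anti (by omega)) (hU.mem_future k i)) (hU.condExp_eq_zero l j))

/-- The products of two entries that reach back to the same time form an `L`-dependent sequence, so
that their centred sums obey the weak law of large numbers. -/
lemma norm_sum_centred_sq_le (hU : ReversedMartingaleArray P 𝒢 𝓕 U A) (hB : ‖B‖ ≤ 1)
    (k l : ℕ) {e : E}
    (he : ∀ i, expectationL P E (bilinLp P B (U k i) (U l (i + (l - k)))) = e) (J : Finset ℤ) :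
    ‖∑ i ∈ J, (bilinLp P B (U k i) (U l (i + (l - k))) - Lp.const 2 P e)‖ ^ 2
      ≤ J.card * (2 * (max k l + 1 : ℕ) * (2 * (A k * A l)) ^ 2) := by
  refine norm_sum_sq_le_of_inner_eq_zero ?_ ?_
  · intro i _
    have h1 := hU.norm_bilinLp_le hB k l i (i + (l - k))
    refine (norm_sub_le _ _).trans ?_
    rw [norm_const_Lp_two, ← he i]
    linarith [norm_expectationL_le (bilinLp P B (U k i) (U l (i + (l - k))))]
  · intro i _ j _ hij
    push_cast at hij
    have h1 := hU.indep (j - k)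
    have hpast : bilinLp P B (U k i) (U l (i + (l - k))) ∈ lpMeas E ℝ (𝓕 (j - k - 1)) 2 P :=
      bilinLp_mem_lpMeas (lpMeas_mono (hU.mono (by omega)) (hU.mem_past k i))
        (lpMeas_mono (hU.mono (by omega)) (hU.mem_past l _))
    have h0 := condExp_sub_const_eq_zero_of_indep (hU.past_le _) (hU.future_le (j - k)) h1 hpast
    rw [he i] at h0
    refine inner_eq_zero_of_condExp (hU.future_le (j - k)) 
      (Submodule.sub_mem _ ?_ (const_mem_lpMeas e)) h0
    exact bilinLp_mem_lpMeas (hU.mem_future k j)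
      (lpMeas_mono (hU.anti (by omega)) (hU.mem_future l _))

/-- The quadratic form of two rows, split according to which of the two factors reaches further into
the past. -/
lemma sum_sum_eq_split (W : ℤ → ℝ) (k l : ℕ) (I : Finset ℤ) :
    ∑ i ∈ I, ∑ j ∈ I, W (i - j) • bilinLp P B (U k i) (U l j)
      = (∑ i ∈ I, ∑ j ∈ I with i - k < j - l, W (i - j) • bilinLp P B (U k i) (U l j))
      + (∑ j ∈ I, ∑ i ∈ I with j - l < i - k,
          W (- (j - i)) • bilinLp P B.flip (U l j) (U k i))
      + W (k - l) • ∑ i ∈ I with i + ((l : ℤ) - k) ∈ I,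
          bilinLp P B (U k i) (U l (i + (l - k))) := by
  have h3 : W (k - l) • ∑ i ∈ I with i + ((l : ℤ) - k) ∈ I,
        bilinLp P B (U k i) (U l (i + (l - k)))
      = ∑ i ∈ I, ∑ j ∈ I with i - k = j - l, W (i - j) • bilinLp P B (U k i) (U l j) := by
    rw [Finset.smul_sum, Finset.sum_filter]
    refine Finset.sum_congr rfl fun i _ => ?_
    have : (I.filter fun j => i - k = j - l) = I.filter fun j => j = i + (l - k) := by
      ext j; simp only [Finset.mem_filter]; constructor <;> rintro ⟨h, h'⟩ <;> exact ⟨h, by omega⟩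
    rw [this, Finset.sum_filter, Finset.sum_ite_eq']
    split_ifs with h
    · congr 2; ring
    · rfl
  have h2 : (∑ j ∈ I, ∑ i ∈ I with j - l < i - k,
          W (- (j - i)) • bilinLp P B.flip (U l j) (U k i))
      = ∑ i ∈ I, ∑ j ∈ I with j - l < i - k, W (i - j) • bilinLp P B (U k i) (U l j) := by
    simp only [Finset.sum_filter]
    rw [Finset.sum_comm]
    refine Finset.sum_congr rfl fun i _ => Finset.sum_congr rfl fun j _ => ?_
    rw [bilinLp_flip, neg_sub]
  rw [h2, h3, ← Finset.sum_add_distrib, ← Finset.sum_add_distrib]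
  refine Finset.sum_congr rfl fun i _ => ?_
  simp only [Finset.sum_filter]
  rw [← Finset.sum_add_distrib, ← Finset.sum_add_distrib]
  refine Finset.sum_congr rfl fun j _ => ?_
  rcases lt_trichotomy (i - (k : ℤ)) (j - l) with h | h | h
  · simp [h, h.not_gt, h.ne]
  · simp [h]
  · simp [h, h.not_gt, h.ne']

/-- The off-diagonal part of the quadratic form of two rows of the array. -/
lemma norm_sum_sum_sub_diag_le (hU : ReversedMartingaleArray P 𝒢 𝓕 U A) (hB : ‖B‖ ≤ 1)
    {W : ℤ → ℝ} {w : ℝ} {R : ℕ} (hw : ∀ x, |W x| ≤ w)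
    (hR : ∀ x, (R : ℤ) < |x| → W x = 0) (k l : ℕ) (I : Finset ℤ) :
    ‖∑ i ∈ I, ∑ j ∈ I, W (i - j) • bilinLp P B (U k i) (U l j)
      - W (k - l) • ∑ i ∈ I with i + ((l : ℤ) - k) ∈ I, bilinLp P B (U k i) (U l (i + (l - k)))‖
      ≤ 2 * √(8 * I.card * (2 * R + 1)) * w * (A k * A l) := by
  have hw0 : 0 ≤ w := (abs_nonneg _).trans (hw 0)
  have hkl : 0 ≤ w * (A k * A l) := mul_nonneg hw0 (mul_nonneg (hU.nonneg k) (hU.nonneg l))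
  rw [sum_sum_eq_split, add_sub_cancel_right]
  have hBf : ‖B.flip‖ ≤ 1 := by rwa [ContinuousLinearMap.opNorm_flip]
  have h1 := hU.norm_sum_left_deeper_sq_le hB hw hR k l I
  have h2 := hU.norm_sum_left_deeper_sq_le hBf (W := fun x => W (-x)) (fun x => hw (-x))
    (fun x hx => hR (-x) (by rwa [abs_neg])) l k I
  have key : ∀ {x : ℝ}, x ^ 2 ≤ 8 * I.card * (2 * R + 1) * (w * (A k * A l)) ^ 2 →
      x ≤ √(8 * I.card * (2 * R + 1)) * (w * (A k * A l)) := by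
    intro x hx
    refine le_of_sq_le_sq (hx.trans (le_of_eq ?_)) (by positivity)
    rw [mul_pow (√_), Real.sq_sqrt (by positivity)]
  have h3 := key h1
  rw [mul_comm (A l)] at h2
  have h4 := key h2
  refine (norm_add_le _ _).trans ((add_le_add h3 h4).trans (le_of_eq (by ring)))

/-- A bound for the quadratic form of two rows of the array, for Tannery's theorem. -/
lemma norm_sum_sum_le (hU : ReversedMartingaleArray P 𝒢 𝓕 U A) (hB : ‖B‖ ≤ 1)
    {W : ℤ → ℝ} {w : ℝ} {R : ℕ} (hw : ∀ x, |W x| ≤ w)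
    (hR : ∀ x, (R : ℤ) < |x| → W x = 0) (k l : ℕ) (I : Finset ℤ) :
    ‖∑ i ∈ I, ∑ j ∈ I, W (i - j) • bilinLp P B (U k i) (U l j)‖
      ≤ (2 * √(8 * I.card * (2 * R + 1)) * w + I.card * w) * (A k * A l) := by
  have h1 := hU.norm_sum_sum_sub_diag_le hB hw hR k l I
  have hkl : 0 ≤ A k * A l := mul_nonneg (hU.nonneg k) (hU.nonneg l)
  have hw0 : 0 ≤ w := (abs_nonneg _).trans (hw 0)
  have h2 : ‖W (k - l) • ∑ i ∈ I with i + ((l : ℤ) - k) ∈ I,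
      bilinLp P B (U k i) (U l (i + (l - k)))‖ ≤ w * (I.card * (A k * A l)) := by
    rw [norm_smul, Real.norm_eq_abs]
    refine mul_le_mul (hw _) ?_ (norm_nonneg _) hw0
    refine (norm_sum_le_of_le _ fun i _ => hU.norm_bilinLp_le hB k l i _).trans ?_
    rw [Finset.sum_const, nsmul_eq_mul]
    exact mul_le_mul_of_nonneg_right (by exact_mod_cast Finset.card_filter_le _ _) hkl
  have h3 := norm_le_norm_sub_add
    (∑ i ∈ I, ∑ j ∈ I, W (i - j) • bilinLp P B (U k i) (U l j))
    (W (k - l) • ∑ i ∈ I with i + ((l : ℤ) - k) ∈ I, bilinLp P B (U k i) (U l (i + (l - k))))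
  linarith

/-- The quadratic form of two rows of the array is close to its mean. -/
lemma norm_sum_sum_sub_const_le (hU : ReversedMartingaleArray P 𝒢 𝓕 U A) (hB : ‖B‖ ≤ 1)
    {W : ℤ → ℝ} {w : ℝ} {R : ℕ} (hw : ∀ x, |W x| ≤ w)
    (hR : ∀ x, (R : ℤ) < |x| → W x = 0) (k l : ℕ) {e : E}
    (he : ∀ i, expectationL P E (bilinLp P B (U k i) (U l (i + (l - k)))) = e) (I : Finset ℤ) :
    ‖∑ i ∈ I, ∑ j ∈ I, W (i - j) • bilinLp P B (U k i) (U l j)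
      - (W (k - l) * (I.filter fun i => i + ((l : ℤ) - k) ∈ I).card) • Lp.const 2 P e‖
      ≤ (2 * √(8 * I.card * (2 * R + 1)) * w
        + 2 * √(I.card * (2 * (max k l + 1 : ℕ))) * w) * (A k * A l) := by
  have h1 := hU.norm_sum_sum_sub_diag_le hB hw hR k l I
  have hkl : 0 ≤ A k * A l := mul_nonneg (hU.nonneg k) (hU.nonneg l)
  have hw0 : 0 ≤ w := (abs_nonneg _).trans (hw 0)
  set J := I.filter fun i => i + ((l : ℤ) - k) ∈ I with hJ
  have h2 := hU.norm_sum_centred_sq_le hB k l he J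
  have h3 : ‖∑ i ∈ J, (bilinLp P B (U k i) (U l (i + (l - k))) - Lp.const 2 P e)‖
      ≤ √(I.card * (2 * (max k l + 1 : ℕ))) * (2 * (A k * A l)) := by
    refine le_of_sq_le_sq (h2.trans ?_) (by positivity)
    rw [mul_pow (√_), Real.sq_sqrt (by positivity), ← mul_assoc]
    have : (J.card : ℝ) ≤ I.card := by exact_mod_cast Finset.card_filter_le _ _
    gcongr
  have h4 : ‖W (k - l) • ∑ i ∈ J, (bilinLp P B (U k i) (U l (i + (l - k))) - Lp.const 2 P e)‖
      ≤ w * (√(I.card * (2 * (max k l + 1 : ℕ))) * (2 * (A k * A l))) := by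
    rw [norm_smul, Real.norm_eq_abs]
    exact mul_le_mul (hw _) h3 (norm_nonneg _) hw0
  have h5 : ∑ i ∈ I, ∑ j ∈ I, W (i - j) • bilinLp P B (U k i) (U l j)
      - (W (k - l) * J.card) • Lp.const 2 P e
      = (∑ i ∈ I, ∑ j ∈ I, W (i - j) • bilinLp P B (U k i) (U l j)
        - W (k - l) • ∑ i ∈ J, bilinLp P B (U k i) (U l (i + (l - k))))
      + W (k - l) • ∑ i ∈ J, (bilinLp P B (U k i) (U l (i + (l - k))) - Lp.const 2 P e) := by
    rw [Finset.sum_sub_distrib, Finset.sum_const, smul_sub, mul_smul, ← Nat.cast_smul_eq_nsmul ℝ]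
    abel
  rw [h5]
  refine (norm_add_le _ _).trans ((add_le_add h1 h4).trans (le_of_eq (by ring)))

end ReversedMartingaleArray
end Arrays

/-! ### Convergence of weighted quadratic forms -/

/-- Weights `W N (i - j)`, of order `1 / N`, carried by a band of width `R N = o(N)`, and such that
the total weight of each fixed lag tends to `1`. -/
structure BandWeights (W : ℕ → ℤ → ℝ) (C : ℝ) (R : ℕ → ℕ) : Prop where
  bound : ∀ᶠ N in atTop, ∀ x, |W N x| ≤ C / N
  band : ∀ᶠ N in atTop, ∀ x, (R N : ℤ) < |x| → W N x = 0
  ratio : Tendsto (fun N => (R N : ℝ) / N) atTop (𝓝 0)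
  limit : ∀ x : ℤ, Tendsto (fun N : ℕ => W N x * (N - |(x : ℝ)|)) atTop (𝓝 1)

lemma BandWeights.nonneg {W : ℕ → ℤ → ℝ} {C : ℝ} {R : ℕ → ℕ} (hW : BandWeights W C R) : 0 ≤ C := by
  obtain ⟨N, h1, h2⟩ := (hW.bound.and (eventually_gt_atTop 0)).exists
  have h3 := (abs_nonneg _).trans (h1 0)
  have h4 : (0 : ℝ) < N := by exact_mod_cast h2
  by_contra! h
  exact absurd h3 (not_le.2 (div_neg_of_neg_of_pos h h4))

lemma BandWeights.tendsto_band_width {W : ℕ → ℤ → ℝ} {C : ℝ} {R : ℕ → ℕ}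
    (hW : BandWeights W C R) :
    Tendsto (fun N : ℕ => (2 * (R N : ℝ) + 1) / N) atTop (𝓝 0) := by
  have h := (hW.ratio.const_mul 2).add (tendsto_one_div_atTop_nhds_zero_nat (𝕜 := ℝ))
  simp only [mul_zero, add_zero] at h
  refine h.congr fun N => ?_
  ring

lemma tendsto_sqrt_mul_div {x : ℕ → ℝ} (hx : Tendsto (fun N : ℕ => x N / N) atTop (𝓝 0)) (C : ℝ) :
    Tendsto (fun N : ℕ => 2 * √(N * x N) * (C / N)) atTop (𝓝 0) := by
  have h := (hx.sqrt).const_mul (2 * C)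
  simp only [Real.sqrt_zero, mul_zero] at h
  refine h.congr' ?_
  filter_upwards [eventually_gt_atTop 0] with N hN
  have hN' : (0 : ℝ) < N := by exact_mod_cast hN
  have : √(N * x N) = N * √(x N / N) := by
    rw [← Real.sqrt_sq hN'.le, ← Real.sqrt_mul (sq_nonneg _), Real.sqrt_sq hN'.le]
    congr 1
    field_simp
  rw [this]
  field_simp

lemma card_filter_add_mem_Icc (N : ℕ) (δ : ℤ) (h : |δ| ≤ N) :
    (((Finset.Icc (1 : ℤ) N).filter fun i => i + δ ∈ Finset.Icc (1 : ℤ) N).card : ℝ)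
      = N - |(δ : ℝ)| := by
  have h1 : ((Finset.Icc (1 : ℤ) N).filter fun i => i + δ ∈ Finset.Icc (1 : ℤ) N)
      = Finset.Icc (max 1 (1 - δ)) (min N (N - δ)) := by
    ext i
    simp only [Finset.mem_filter, Finset.mem_Icc]
    omega
  have h2 : ((Finset.Icc (max 1 (1 - δ)) (min (N : ℤ) (N - δ))).card : ℤ) = N - |δ| := by
    rw [Int.card_Icc]
    rcases abs_cases δ with ⟨h3, h4⟩ | ⟨h3, h4⟩ <;> omega
  rw [h1]
  exact_mod_cast congrArg (Int.cast (R := ℝ)) h2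

section Arrays

set_option linter.unusedSectionVars false

variable {Ω : Type*} {m m₁ m₂ m₀ : MeasurableSpace Ω} {P : Measure Ω}
  {H : Type*} [NormedAddCommGroup H] [InnerProductSpace ℝ H]
  {E : Type*} [NormedAddCommGroup E] [InnerProductSpace ℝ E]
variable [IsProbabilityMeasure P] [CompleteSpace H] [CompleteSpace E]

namespace ReversedMartingaleArray

variable {𝒢 𝓕 : ℤ → MeasurableSpace Ω} {U : ℕ → ℤ → Lp H 4 P} {A : ℕ → ℝ}
  {B : H →L[ℝ] H →L[ℝ] E} {X : ℤ → Lp H 4 P}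

lemma summable_mul (hU : ReversedMartingaleArray P 𝒢 𝓕 U A) :
    Summable fun p : ℕ × ℕ => A p.1 * A p.2 :=
  hU.summable.mul_of_nonneg hU.summable hU.nonneg hU.nonneg

lemma hasSum_bilinLp (hU : ReversedMartingaleArray P 𝒢 𝓕 U A) (hB : ‖B‖ ≤ 1)
    (hX : ∀ i, HasSum (fun k => U k i) (X i)) (i j : ℤ) :
    HasSum (fun p : ℕ × ℕ => bilinLp P B (U p.1 i) (U p.2 j)) (bilinLp P B (X i) (X j)) := by
  have hs : Summable fun p : ℕ × ℕ => bilinLp P B (U p.1 i) (U p.2 j) :=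
    Summable.of_norm_bounded hU.summable_mul fun p => hU.norm_bilinLp_le hB p.1 p.2 i j
  have h1 := hs.hasSum.prod_fiberwise fun k => (bilinLp P B (U k i)).hasSum (hX j)
  have h2 := ((bilinLp P B).flip (X j)).hasSum (hX i)
  simp only [ContinuousLinearMap.flip_apply] at h2
  rw [← h1.unique h2]
  exact hs.hasSum

lemma norm_sum_smul_le_tsum (hU : ReversedMartingaleArray P 𝒢 𝓕 U A)
    (hX : ∀ i, HasSum (fun k => U k i) (X i)) (c : ℤ → ℝ) (I : Finset ℤ) :
    ‖∑ i ∈ I, c i • X i‖ ≤ 2 * (∑' k, A k) * √(∑ i ∈ I, c i ^ 2) := by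
  have h1 : HasSum (fun k => ∑ i ∈ I, c i • U k i) (∑ i ∈ I, c i • X i) :=
    hasSum_sum fun i _ => (hX i).const_smul (c i)
  have h2 := (hU.summable.hasSum.mul_left 2).mul_right (√(∑ i ∈ I, c i ^ 2))
  exact h1.norm_le_of_bounded h2 fun k => hU.norm_sum_smul_le k c I

/-- The quadratic form of the partial sums converges in `L²` to the long-run covariance: the
contribution of each pair of rows converges, and Tannery's theorem sums over the pairs. -/
lemma tendsto_quadraticForm (hU : ReversedMartingaleArray P 𝒢 𝓕 U A) (hB : ‖B‖ ≤ 1)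
    (hX : ∀ i, HasSum (fun k => U k i) (X i)) {D : ℕ → ℕ → E}
    (hD : ∀ (k l : ℕ) (i : ℤ),
      expectationL P E (bilinLp P B (U k i) (U l (i + (l - k)))) = D k l)
    {W : ℕ → ℤ → ℝ} {C : ℝ} {R : ℕ → ℕ} (hW : BandWeights W C R) :
    Tendsto (fun N : ℕ => ∑ i ∈ Finset.Icc (1 : ℤ) N, ∑ j ∈ Finset.Icc (1 : ℤ) N,
      W N (i - j) • bilinLp P B (X i) (X j)) atTop
      (𝓝 (Lp.const 2 P (∑' p : ℕ × ℕ, D p.1 p.2))) := by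
  have hC := hW.nonneg
  have hcard : ∀ N : ℕ, ((Finset.Icc (1 : ℤ) N).card : ℝ) = N := fun N => by simp
  have hb1 : Tendsto (fun N : ℕ => 2 * √(8 * N * (2 * R N + 1)) * (C / N)) atTop (𝓝 0) := by
    have := tendsto_sqrt_mul_div (x := fun N => 8 * (2 * (R N : ℝ) + 1))
      (by simpa [mul_div_assoc] using hW.tendsto_band_width.const_mul 8) C
    refine this.congr fun N => ?_
    congr 3
    ring
  have hDn : ∀ k l, ‖D k l‖ ≤ A k * A l := fun k l => by
    rw [← hD k l 0]
    exact (norm_expectationL_le _).trans (hU.norm_bilinLp_le hB k l _ _)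
  have hDs : Summable fun p : ℕ × ℕ => D p.1 p.2 :=
    Summable.of_norm_bounded hU.summable_mul fun p => hDn p.1 p.2
  have hconst : Lp.const 2 P (∑' p : ℕ × ℕ, D p.1 p.2)
      = ∑' p : ℕ × ℕ, Lp.const 2 P (D p.1 p.2) :=
    (Lp.constL 2 P ℝ : E →L[ℝ] Lp E 2 P).map_tsum hDs
  have hsum : ∀ N : ℕ, ∑ i ∈ Finset.Icc (1 : ℤ) N, ∑ j ∈ Finset.Icc (1 : ℤ) N,
      W N (i - j) • bilinLp P B (X i) (X j)
      = ∑' p : ℕ × ℕ, ∑ i ∈ Finset.Icc (1 : ℤ) N, ∑ j ∈ Finset.Icc (1 : ℤ) N,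
        W N (i - j) • bilinLp P B (U p.1 i) (U p.2 j) := fun N => by
    symm
    exact (hasSum_sum fun i _ => hasSum_sum fun j _ =>
      (hU.hasSum_bilinLp hB hX i j).const_smul _).tsum_eq
  simp_rw [hsum]
  rw [hconst]
  refine tendsto_tsum_of_dominated_convergence (bound := fun p => (1 + C) * (A p.1 * A p.2))
    (hU.summable_mul.mul_left _) ?_ ?_
  · rintro ⟨k, l⟩
    have hc : Tendsto (fun N : ℕ => W N (k - l) * ((Finset.Icc (1 : ℤ) N).filter
        fun i => i + ((l : ℤ) - k) ∈ Finset.Icc (1 : ℤ) N).card) atTop (𝓝 1) := by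
      refine (hW.limit (k - l)).congr' ?_
      filter_upwards [eventually_ge_atTop (k + l)] with N hN
      rw [card_filter_add_mem_Icc N (l - k) (by rw [abs_le]; omega)]
      push_cast
      rw [abs_sub_comm]
    have hb2 : Tendsto (fun N : ℕ => 2 * √(N * (2 * (max k l + 1 : ℕ))) * (C / N)) atTop (𝓝 0) :=
      tendsto_sqrt_mul_div (tendsto_const_div_atTop_nhds_zero_nat _) C
    have hdiff : Tendsto (fun N : ℕ => ∑ i ∈ Finset.Icc (1 : ℤ) N, ∑ j ∈ Finset.Icc (1 : ℤ) N,
        W N (i - j) • bilinLp P B (U k i) (U l j)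
        - (W N (k - l) * ((Finset.Icc (1 : ℤ) N).filter
        fun i => i + ((l : ℤ) - k) ∈ Finset.Icc (1 : ℤ) N).card) • Lp.const 2 P (D k l))
        atTop (𝓝 0) := by
      have hb : Tendsto (fun N : ℕ => (2 * √(8 * N * (2 * R N + 1)) * (C / N)
          + 2 * √(N * (2 * (max k l + 1 : ℕ))) * (C / N)) * (A k * A l)) atTop (𝓝 0) := by
        simpa using (hb1.add hb2).mul_const (A k * A l)
      refine squeeze_zero_norm' ?_ hb
      filter_upwards [hW.bound, hW.band] with N h1 h2
      have := hU.norm_sum_sum_sub_const_le hB h1 h2 k l (hD k l) (Finset.Icc (1 : ℤ) N)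
      rwa [hcard] at this
    have := hdiff.add (hc.smul_const (Lp.const 2 P (D k l)))
    simpa using this
  · filter_upwards [hW.bound, hW.band, hb1.eventually_le_const zero_lt_one,
      eventually_gt_atTop 0] with N h1 h2 h3 h4
    rintro ⟨k, l⟩
    refine (hU.norm_sum_sum_le hB h1 h2 k l (Finset.Icc (1 : ℤ) N)).trans ?_
    have h5 : (0 : ℝ) < N := by exact_mod_cast h4
    rw [hcard, mul_div_cancel₀ C h5.ne']
    exact mul_le_mul_of_nonneg_right (by linarith) (mul_nonneg (hU.nonneg k) (hU.nonneg l))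

/-- Subtracting the sample mean does not matter, since the sample mean is of order `N^{-1/2}`. -/
lemma norm_quadraticForm_demeaned_sub_le (hU : ReversedMartingaleArray P 𝒢 𝓕 U A) (hB : ‖B‖ ≤ 1)
    (hX : ∀ i, HasSum (fun k => U k i) (X i)) {W : ℤ → ℝ} {w : ℝ} {R : ℕ} (hw : ∀ x, |W x| ≤ w)
    (hR : ∀ x, (R : ℤ) < |x| → W x = 0) {N : ℕ} (hN : 0 < N) {Y : Lp H 4 P}
    (hY : Y = (N : ℝ)⁻¹ • ∑ i ∈ Finset.Icc (1 : ℤ) N, X i) :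
    ‖∑ i ∈ Finset.Icc (1 : ℤ) N, ∑ j ∈ Finset.Icc (1 : ℤ) N,
        W (i - j) • bilinLp P B (X i - Y) (X j - Y)
      - ∑ i ∈ Finset.Icc (1 : ℤ) N, ∑ j ∈ Finset.Icc (1 : ℤ) N,
        W (i - j) • bilinLp P B (X i) (X j)‖ ≤ 12 * (∑' k, A k) ^ 2 * ((2 * R + 1) * w) := by
  set I := Finset.Icc (1 : ℤ) N with hI
  set S := ∑' k, A k with hS
  set q : ℝ := (2 * R + 1) * w with hq
  have hN' : (0 : ℝ) < N := by exact_mod_cast hN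
  have hcard : (I.card : ℝ) = N := by simp [hI]
  have hw0 : 0 ≤ w := (abs_nonneg _).trans (hw 0)
  have hq0 : 0 ≤ q := by positivity
  have hS0 : 0 ≤ S := tsum_nonneg hU.nonneg
  have hc1 : ∀ i, |∑ j ∈ I, W (i - j)| ≤ q := fun i => sum_abs_le_of_band hw hR i I
  have hc2 : ∀ j, |∑ i ∈ I, W (i - j)| ≤ q := fun j => by
    have := sum_abs_le_of_band (W := fun x => W (-x)) (fun x => hw (-x))
      (fun x hx => hR (-x) (by rwa [abs_neg])) j I
    simpa only [neg_sub] using this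
  have hYn : ‖Y‖ ≤ 2 * S * (√N)⁻¹ := by
    have h := hU.norm_sum_smul_le_tsum hX (fun _ => (N : ℝ)⁻¹) I
    rw [← Finset.smul_sum, ← hY, Finset.sum_const, nsmul_eq_mul, hcard] at h
    refine h.trans (le_of_eq ?_)
    rw [← Real.sqrt_inv]
    congr 2
    field_simp
  have hlin : ∀ c : ℤ → ℝ, (∀ i, |c i| ≤ q) → ‖∑ i ∈ I, c i • X i‖ ≤ 2 * S * (√N * q) := by
    intro c hc
    refine (hU.norm_sum_smul_le_tsum hX c I).trans ?_
    refine mul_le_mul_of_nonneg_left ?_ (by positivity)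
    rw [← Real.sqrt_sq hq0, ← Real.sqrt_mul hN'.le]
    refine Real.sqrt_le_sqrt ?_
    refine (Finset.sum_le_card_nsmul I (fun i => c i ^ 2) (q ^ 2) fun i _ =>
      sq_le_sq' (abs_le.1 (hc i)).1 (abs_le.1 (hc i)).2).trans (le_of_eq ?_)
    rw [nsmul_eq_mul, hcard]
  have hexp : ∑ i ∈ I, ∑ j ∈ I, W (i - j) • bilinLp P B (X i - Y) (X j - Y)
      - ∑ i ∈ I, ∑ j ∈ I, W (i - j) • bilinLp P B (X i) (X j)
      = (∑ i ∈ I, ∑ j ∈ I, W (i - j)) • bilinLp P B Y Y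
      - bilinLp P B (∑ i ∈ I, (∑ j ∈ I, W (i - j)) • X i) Y
      - bilinLp P B Y (∑ j ∈ I, (∑ i ∈ I, W (i - j)) • X j) := by
    have e3 : bilinLp P B Y (∑ j ∈ I, (∑ i ∈ I, W (i - j)) • X j)
        = ∑ i ∈ I, ∑ j ∈ I, W (i - j) • bilinLp P B Y (X j) := by
      rw [Finset.sum_comm]
      simp only [map_sum, map_smul, Finset.sum_smul]
    have e2 : bilinLp P B (∑ i ∈ I, (∑ j ∈ I, W (i - j)) • X i) Y
        = ∑ i ∈ I, ∑ j ∈ I, W (i - j) • bilinLp P B (X i) Y := by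
      simp only [map_sum, map_smul, Finset.sum_smul, sum_apply, smul_apply]
    rw [e2, e3]
    simp only [Finset.sum_smul]
    simp only [← Finset.sum_sub_distrib]
    refine Finset.sum_congr rfl fun i _ => Finset.sum_congr rfl fun j _ => ?_
    simp only [map_sub, sub_apply, smul_sub]
    abel
  have hsN : √(N : ℝ) * (√N)⁻¹ = 1 := mul_inv_cancel₀ (Real.sqrt_pos.2 hN').ne'
  have hsN2 : (N : ℝ) * ((√N)⁻¹ * (√N)⁻¹) = 1 := by
    rw [← mul_inv, Real.mul_self_sqrt hN'.le, mul_inv_cancel₀ hN'.ne']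
  have hs0 : 0 ≤ (√(N : ℝ))⁻¹ := by positivity
  have b1 : ‖(∑ i ∈ I, ∑ j ∈ I, W (i - j)) • bilinLp P B Y Y‖
      ≤ (N * q) * ((2 * S * (√N)⁻¹) * (2 * S * (√N)⁻¹)) := by
    rw [norm_smul]
    refine mul_le_mul ?_ ((_root_.norm_bilinLp_le hB Y Y).trans
      (mul_le_mul hYn hYn (norm_nonneg _) (by positivity))) (norm_nonneg _) (by positivity)
    refine (norm_sum_le_of_le I fun i _ => hc1 i).trans (le_of_eq ?_)
    rw [Finset.sum_const, nsmul_eq_mul, hcard]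
  have b2 := (_root_.norm_bilinLp_le hB (∑ i ∈ I, (∑ j ∈ I, W (i - j)) • X i) Y).trans
      (mul_le_mul (hlin _ hc1) hYn (norm_nonneg _) (by positivity))
  have b3 := (_root_.norm_bilinLp_le hB Y (∑ j ∈ I, (∑ i ∈ I, W (i - j)) • X j)).trans
      (mul_le_mul hYn (hlin _ hc2) (norm_nonneg _) (by positivity))
  have v1 : (N * q) * ((2 * S * (√N)⁻¹) * (2 * S * (√N)⁻¹)) = 4 * S ^ 2 * q := by
    calc _ = 4 * S ^ 2 * q * ((N : ℝ) * ((√N)⁻¹ * (√N)⁻¹)) := by ring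
      _ = _ := by rw [hsN2, mul_one]
  have v2 : 2 * S * (√N * q) * (2 * S * (√N)⁻¹) = 4 * S ^ 2 * q := by
    calc _ = 4 * S ^ 2 * q * (√(N : ℝ) * (√N)⁻¹) := by ring
      _ = _ := by rw [hsN, mul_one]
  rw [v1] at b1
  rw [v2] at b2
  rw [mul_comm, v2] at b3
  rw [hexp]
  refine (norm_sub_le _ _).trans ((add_le_add ((norm_sub_le _ _).trans (add_le_add b1 b2))
    b3).trans (le_of_eq (by ring)))

lemma tendsto_quadraticForm_demeaned (hU : ReversedMartingaleArray P 𝒢 𝓕 U A) (hB : ‖B‖ ≤ 1)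
    (hX : ∀ i, HasSum (fun k => U k i) (X i)) {D : ℕ → ℕ → E}
    (hD : ∀ (k l : ℕ) (i : ℤ),
      expectationL P E (bilinLp P B (U k i) (U l (i + (l - k)))) = D k l)
    {W : ℕ → ℤ → ℝ} {C : ℝ} {R : ℕ → ℕ} (hW : BandWeights W C R) {Y : ℕ → Lp H 4 P}
    (hY : ∀ N, Y N = (N : ℝ)⁻¹ • ∑ i ∈ Finset.Icc (1 : ℤ) N, X i) :
    Tendsto (fun N : ℕ => ∑ i ∈ Finset.Icc (1 : ℤ) N, ∑ j ∈ Finset.Icc (1 : ℤ) N,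
      W N (i - j) • bilinLp P B (X i - Y N) (X j - Y N)) atTop
      (𝓝 (Lp.const 2 P (∑' p : ℕ × ℕ, D p.1 p.2))) := by
  have h1 := hU.tendsto_quadraticForm hB hX hD hW
  have h2 : Tendsto (fun N : ℕ => ∑ i ∈ Finset.Icc (1 : ℤ) N, ∑ j ∈ Finset.Icc (1 : ℤ) N,
        W N (i - j) • bilinLp P B (X i - Y N) (X j - Y N)
      - ∑ i ∈ Finset.Icc (1 : ℤ) N, ∑ j ∈ Finset.Icc (1 : ℤ) N,
        W N (i - j) • bilinLp P B (X i) (X j)) atTop (𝓝 0) := by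
    have h3 : Tendsto (fun N : ℕ => 12 * (∑' k, A k) ^ 2 * ((2 * R N + 1) * (C / N))) atTop
        (𝓝 0) := by
      have := hW.tendsto_band_width.const_mul (12 * (∑' k, A k) ^ 2 * C)
      rw [mul_zero] at this
      refine this.congr fun N => by ring
    refine squeeze_zero_norm' ?_ h3
    filter_upwards [hW.bound, hW.band, eventually_gt_atTop 0] with N h4 h5 h6
    exact hU.norm_quadraticForm_demeaned_sub_le hB hX h4 h5 h6 (hY N)
  simpa using h2.add h1

/-- The autocovariances are absolutely summable, and sum to the long-run covariance: the pair
`(k, l)` of rows contributes to the autocovariance of lag `l - k` only. -/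
lemma hasSum_autocovariance (hU : ReversedMartingaleArray P 𝒢 𝓕 U A) (hB : ‖B‖ ≤ 1)
    (hX : ∀ i, HasSum (fun k => U k i) (X i)) {D : ℕ → ℕ → E}
    (hD : ∀ (k l : ℕ) (i : ℤ),
      expectationL P E (bilinLp P B (U k i) (U l (i + (l - k)))) = D k l) :
    (Summable fun n : ℤ => ‖expectationL P E (bilinLp P B (X 0) (X n))‖) ∧
    HasSum (fun n : ℤ => expectationL P E (bilinLp P B (X 0) (X n)))
      (∑' p : ℕ × ℕ, D p.1 p.2) := by
  have hDn : ∀ k l, ‖D k l‖ ≤ A k * A l := fun k l => by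
    rw [← hD k l 0]
    exact (norm_expectationL_le _).trans (hU.norm_bilinLp_le hB k l _ _)
  have hDs : Summable fun p : ℕ × ℕ => ‖D p.1 p.2‖ :=
    Summable.of_nonneg_of_le (fun _ => norm_nonneg _) (fun p => hDn p.1 p.2) hU.summable_mul
  set lag : ℕ × ℕ → ℤ := fun p => p.2 - p.1
  set e := Equiv.sigmaFiberEquiv lag
  have hs1 : Summable fun x : Σ n, {p // lag p = n} => ‖D (e x).1 (e x).2‖ :=
    (e.summable_iff (f := fun p : ℕ × ℕ => ‖D p.1 p.2‖)).2 hDs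
  have hs2 : Summable fun x : Σ n, {p // lag p = n} => D (e x).1 (e x).2 := hs1.of_norm
  have hfib : ∀ n : ℤ, HasSum (fun p : {p // lag p = n} => D p.1.1 p.1.2)
      (expectationL P E (bilinLp P B (X 0) (X n))) := by
    intro n
    have h1 := (expectationL P E).hasSum (hU.hasSum_bilinLp hB hX 0 n)
    have h2 : ∀ p : ℕ × ℕ, p ∉ {p | lag p = n} →
        expectationL P E (bilinLp P B (U p.1 0) (U p.2 n)) = 0 := fun p hp =>
      hU.expectationL_bilinLp_eq_zero fun h => hp (by simp only [lag, Set.mem_ofPred_eq]; omega)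
    have h3 := (hasSum_subtype_iff_of_support_subset (s := {p | lag p = n})
      (Function.support_subset_iff'.2 h2)).2 h1
    refine h3.congr_fun fun p => ?_
    have hp : n = 0 + ((p.1.2 : ℤ) - p.1.1) := by rw [zero_add]; exact p.2.symm
    rw [← hD p.1.1 p.1.2 0, ← hp]
    rfl
  constructor
  · refine Summable.of_nonneg_of_le (fun _ => norm_nonneg _) (fun n => ?_) hs1.sigma
    rw [← (hfib n).tsum_eq]
    exact norm_tsum_le_tsum_norm (hs1.sigma_factor n)
  · have h1 := hs2.hasSum.sigma hfib
    rwa [e.tsum_eq (fun p : ℕ × ℕ => D p.1 p.2)] at h1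

end ReversedMartingaleArray
end Arrays

/-! ### Pasts and futures of an independent sequence -/

section Innovations

set_option linter.unusedSectionVars false

variable {Ω S : Type*} [MeasurableSpace Ω] [MeasurableSpace S] {P : Measure Ω}
  [IsProbabilityMeasure P] {η : ℤ → Ω → S}
  {H : Type*} [NormedAddCommGroup H] [InnerProductSpace ℝ H] [CompleteSpace H]

/-- The one-sided future `(η_n, η_{n+1}, …)`, at the outcome `ω`. -/
def futureFrom {Ω S : Type*} (η : ℤ → Ω → S) (n : ℤ) (ω : Ω) : ℕ → S :=
  fun k => η (n + (k : ℤ)) ω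

/-- The sequence whose first `m` entries are `y (m - 1), …, y 0`, followed by the sequence `z`. -/
def glue {S : Type*} (m : ℕ) (y z : ℕ → S) : ℕ → S :=
  fun k => if k < m then y (m - 1 - k) else z (k - m)

/-- The σ-algebra of the innovations at times `≤ n`. -/
abbrev pastAlgebra (η : ℤ → Ω → S) (n : ℤ) : MeasurableSpace Ω :=
  MeasurableSpace.comap (pastFrom η n) inferInstance

/-- The σ-algebra of the innovations at times `≥ n`. -/
abbrev futureAlgebra (η : ℤ → Ω → S) (n : ℤ) : MeasurableSpace Ω :=
  MeasurableSpace.comap (futureFrom η n) inferInstance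

lemma pastFrom_eq_glue (η : ℤ → Ω → S) (i : ℤ) (m : ℕ) (ω : Ω) :
    pastFrom η i ω = glue m (futureFrom η (i + 1 - m) ω) (pastFrom η (i - m) ω) := by
  funext k
  simp only [pastFrom, glue, futureFrom]
  split_ifs with h <;> congr 1 <;> omega

lemma splice_eq_glue (η : ℤ → Ω → S) (i j : ℤ) (m : ℕ) (ω ω' : Ω) :
    splice m (pastFrom η i ω) (pastFrom η j ω')
      = glue m (futureFrom η (i + 1 - m) ω) (pastFrom η (j - m) ω') := by
  funext k
  simp only [splice, pastFrom, glue, futureFrom]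
  split_ifs with h <;> congr 1 <;> omega

lemma measurable_glue (m : ℕ) : Measurable fun p : (ℕ → S) × (ℕ → S) => glue m p.1 p.2 := by
  refine measurable_pi_iff.2 fun k => ?_
  simp only [glue]
  split_ifs
  · exact (measurable_pi_apply _).comp measurable_fst
  · exact (measurable_pi_apply _).comp measurable_snd

lemma measurable_splice (m : ℕ) : Measurable fun p : (ℕ → S) × (ℕ → S) => splice m p.1 p.2 := by
  refine measurable_pi_iff.2 fun k => ?_
  simp only [splice]
  split_ifs
  · exact (measurable_pi_apply _).comp measurable_fst
  · exact (measurable_pi_apply _).comp measurable_snd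

lemma measurable_pastFrom (hη : ∀ n, Measurable (η n)) (n : ℤ) : Measurable (pastFrom η n) :=
  measurable_pi_iff.2 fun _ => hη _

lemma measurable_futureFrom (hη : ∀ n, Measurable (η n)) (n : ℤ) : Measurable (futureFrom η n) :=
  measurable_pi_iff.2 fun _ => hη _

lemma monotone_pastAlgebra (η : ℤ → Ω → S) : Monotone (pastAlgebra η) := by
  intro a b hab
  rw [← measurable_iff_comap_le]
  refine (@measurable_pi_iff _ _ _ (pastAlgebra η b) _ _).2 fun k => ?_
  have h : (fun ω => pastFrom η a ω k) = fun ω => pastFrom η b ω (k + (b - a).toNat) := by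
    funext ω
    simp only [pastFrom]
    congr 1
    omega
  rw [h]
  exact (measurable_pi_apply _).comp (comap_measurable (pastFrom η b))

lemma antitone_futureAlgebra (η : ℤ → Ω → S) : Antitone (futureAlgebra η) := by
  intro a b hab
  rw [← measurable_iff_comap_le]
  refine (@measurable_pi_iff _ _ _ (futureAlgebra η a) _ _).2 fun k => ?_
  have h : (fun ω => futureFrom η b ω k) = fun ω => futureFrom η a ω (k + (b - a).toNat) := by
    funext ω
    simp only [futureFrom]
    congr 1
    omega
  rw [h]
  exact (measurable_pi_apply _).comp (comap_measurable (futureFrom η a))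

lemma indep_past_future (hη : ∀ n, Measurable (η n)) (hind : iIndepFun η P) (n : ℤ) :
    Indep (pastAlgebra η (n - 1)) (futureAlgebra η n) P := by
  have h := indep_iSup_of_disjoint (fun n => (hη n).comap_le) hind
    (S := Set.Iio n) (T := Set.Ici n) (by
      rw [Set.disjoint_left]
      intro x hx hx'
      exact absurd (Set.mem_Iio.1 hx) (not_lt.2 (Set.mem_Ici.1 hx')))
  refine indep_of_indep_of_le_left (indep_of_indep_of_le_right h ?_) ?_
  · rw [← measurable_iff_comap_le]
    refine (@measurable_pi_iff _ _ _ (_) _ _).2 fun k => ?_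
    rw [measurable_iff_comap_le]
    exact le_iSup₂_of_le (n + k : ℤ) (Set.mem_Ici.2 (by omega)) le_rfl
  · rw [← measurable_iff_comap_le]
    refine (@measurable_pi_iff _ _ _ (_) _ _).2 fun k => ?_
    rw [measurable_iff_comap_le]
    exact le_iSup₂_of_le (n - 1 - k : ℤ) (Set.mem_Iio.2 (by omega)) le_rfl

lemma map_reindex_eq (hη : ∀ n, Measurable (η n)) (hind : iIndepFun η P)
    (hid : ∀ n, IdentDistrib (η n) (η 0) P P) {ι : Type*} {σ τ : ι → ℤ}
    (hσ : Function.Injective σ) (hτ : Function.Injective τ) :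
    P.map (fun ω k => η (σ k) ω) = P.map (fun ω k => η (τ k) ω) := by
  have h1 := (hind.precomp hσ).map_fun_eq_infinitePi_map fun _ => hη _
  have h2 := (hind.precomp hτ).map_fun_eq_infinitePi_map fun _ => hη _
  have h3 : ∀ n, P.map (η n) = P.map (η 0) := fun n => (hid n).map_eq
  simp only [h3] at h1 h2
  rw [h1, h2]

lemma map_pastFrom_eq (hη : ∀ n, Measurable (η n)) (hind : iIndepFun η P)
    (hid : ∀ n, IdentDistrib (η n) (η 0) P P) (i j : ℤ) :
    P.map (pastFrom η i) = P.map (pastFrom η j) :=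
  map_reindex_eq hη hind hid (σ := fun k : ℕ => i - k) (τ := fun k : ℕ => j - k)
    (fun a b h => by simpa using h) (fun a b h => by simpa using h)

/-- Stationarity, for functions of the pasts at two times. -/
lemma integral_pastFrom_pastFrom_eq {E : Type*} [NormedAddCommGroup E] [NormedSpace ℝ E]
    (hη : ∀ n, Measurable (η n)) (hind : iIndepFun η P)
    (hid : ∀ n, IdentDistrib (η n) (η 0) P P) {f : (ℕ → S) × (ℕ → S) → E}
    (hf : StronglyMeasurable f) (i j n : ℤ) :
    ∫ ω, f (pastFrom η i ω, pastFrom η (i + n) ω) ∂P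
      = ∫ ω, f (pastFrom η j ω, pastFrom η (j + n) ω) ∂P := by
  set Φ : (ℤ → S) → (ℕ → S) × (ℕ → S) := fun x => (fun k => x (-k), fun k => x (n - k)) with hΦ
  have hΦm : Measurable Φ :=
    (measurable_pi_iff.2 fun k => measurable_pi_apply _).prodMk
      (measurable_pi_iff.2 fun k => measurable_pi_apply _)
  have key : ∀ i : ℤ, ∫ ω, f (pastFrom η i ω, pastFrom η (i + n) ω) ∂P
      = ∫ x, f (Φ x) ∂(P.map fun ω (k : ℤ) => η (i + k) ω) := by
    intro i
    have hm : Measurable fun ω (k : ℤ) => η (i + k) ω := measurable_pi_iff.2 fun k => hη _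
    have hfm : StronglyMeasurable fun x => f (Φ x) := hf.comp_measurable hΦm
    rw [integral_map hm.aemeasurable hfm.aestronglyMeasurable]
    refine integral_congr_ae (ae_of_all _ fun ω => ?_)
    simp only [hΦ]
    congr 2
    funext k
    simp only [pastFrom]
    congr 1
    omega
  rw [key i, key j, map_reindex_eq hη hind hid (σ := fun k => i + k) (τ := fun k => j + k)
    (fun a b h => by simpa using h) (fun a b h => by simpa using h)]

/-- Conditioning on `Y` a function of `Y` and an independent `Z` integrates out `Z`. -/
lemma condExp_comap_eq_integral {α β : Type*} [MeasurableSpace α] [MeasurableSpace β] {Y : Ω → α}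
    {Z : Ω → β} (hY : Measurable Y) (hZ : Measurable Z) (hYZ : IndepFun Y Z P) {f : α × β → H}
    (hf : StronglyMeasurable f) (hint : Integrable (fun ω => f (Y ω, Z ω)) P) :
    P[fun ω => f (Y ω, Z ω) | MeasurableSpace.comap Y inferInstance]
      =ᵐ[P] fun ω => ∫ z, f (Y ω, z) ∂(P.map Z) := by
  have hp := (indepFun_iff_map_prod_eq_prod_map_map hY.aemeasurable hZ.aemeasurable).1 hYZ
  have hPY : IsProbabilityMeasure (P.map Y) := Measure.isProbabilityMeasure_map hY.aemeasurable
  have hPZ : IsProbabilityMeasure (P.map Z) := Measure.isProbabilityMeasure_map hZ.aemeasurable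
  have hYZm : Measurable fun ω => (Y ω, Z ω) := hY.prodMk hZ
  have hintp : Integrable f ((P.map Y).prod (P.map Z)) := by
    rw [← hp]
    exact (integrable_map_measure hf.aestronglyMeasurable hYZm.aemeasurable).2 hint
  have hF : StronglyMeasurable fun y => ∫ z, f (y, z) ∂(P.map Z) := hf.integral_prod_right'
  have hFi : Integrable (fun y => ∫ z, f (y, z) ∂(P.map Z)) (P.map Y) := hintp.integral_prod_left
  have hFint : Integrable (fun ω => ∫ z, f (Y ω, z) ∂(P.map Z)) P :=
    (integrable_map_measure hF.aestronglyMeasurable hY.aemeasurable).1 hFi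
  symm
  refine ae_eq_condExp_of_forall_setIntegral_eq hY.comap_le hint
    (fun s _ _ => hFint.integrableOn) ?_
    (hF.comp_measurable (comap_measurable Y)).aestronglyMeasurable
  rintro _ ⟨C, hC, rfl⟩ _
  have h1 : ∫ ω in Y ⁻¹' C, f (Y ω, Z ω) ∂P
      = ∫ q in C ×ˢ Set.univ, f q ∂((P.map Y).prod (P.map Z)) := by
    rw [← hp, setIntegral_map (hC.prod MeasurableSet.univ) hf.aestronglyMeasurable
      hYZm.aemeasurable]
    congr 2
    ext ω
    simp
  rw [h1, setIntegral_prod _ hintp.integrableOn]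
  simp only [Measure.restrict_univ]
  rw [setIntegral_map hC hF.aestronglyMeasurable hY.aemeasurable]

end Innovations

/-! ### Bernoulli shifts as sums of reversed martingale differences -/

section Coupling

set_option linter.unusedSectionVars false

variable {Ω S : Type*} [MeasurableSpace Ω] [MeasurableSpace S] {P : Measure Ω}
  [IsProbabilityMeasure P] {η : ℤ → Ω → S}
  {H : Type*} [NormedAddCommGroup H] [InnerProductSpace ℝ H] [CompleteSpace H]

/-- `g` with all but the first `m` innovations replaced by independent copies and averaged out. -/
def pastTruncation (P : Measure Ω) (η : ℤ → Ω → S) (g : (ℕ → S) → H) (m : ℕ) (x : ℕ → S) : H :=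
  ∫ ω', g (splice m x (pastFrom η 1 ω')) ∂P

/-- The `L⁴` size of the effect of replacing all but the first `m` innovations by independent
copies. -/
def couplingNorm (P : Measure Ω) (η : ℤ → Ω → S) (g : (ℕ → S) → H) (m : ℕ) : ℝ≥0∞ :=
  eLpNorm (fun z : Ω × Ω => g (pastFrom η 1 z.1)
    - g (splice m (pastFrom η 1 z.1) (pastFrom η 1 z.2))) 4 (P.prod P)

variable {g : (ℕ → S) → H}

lemma stronglyMeasurable_truncation (hη : ∀ n, Measurable (η n)) (hg : StronglyMeasurable g)
    (m : ℕ) : StronglyMeasurable (pastTruncation P η g m) := by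
  have h : StronglyMeasurable fun p : (ℕ → S) × Ω => g (splice m p.1 (pastFrom η 1 p.2)) :=
    hg.comp_measurable ((measurable_splice m).comp
      (measurable_fst.prodMk ((measurable_pastFrom hη 1).comp measurable_snd)))
  exact h.integral_prod_right'

lemma truncation_pastFrom_eq (hη : ∀ n, Measurable (η n)) (hind : iIndepFun η P)
    (hid : ∀ n, IdentDistrib (η n) (η 0) P P) (hg : StronglyMeasurable g) (m : ℕ) (i : ℤ) (ω : Ω) :
    pastTruncation P η g m (pastFrom η i ω)
      = ∫ z, g (glue m (futureFrom η (i + 1 - m) ω) z) ∂(P.map (pastFrom η (i - m))) := by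
  have hf : StronglyMeasurable fun z => g (glue m (futureFrom η (i + 1 - m) ω) z) :=
    hg.comp_measurable (Measurable.of_uncurry_left (f := glue m) (measurable_glue m))
  rw [map_pastFrom_eq hη hind hid (i - m) (1 - m), integral_map
    (measurable_pastFrom hη _).aemeasurable
    hf.aestronglyMeasurable]
  simp only [pastTruncation, splice_eq_glue]

lemma stronglyMeasurable_truncation_pastFrom (hη : ∀ n, Measurable (η n)) (hind : iIndepFun η P)
    (hid : ∀ n, IdentDistrib (η n) (η 0) P P) (hg : StronglyMeasurable g) (m : ℕ) (i : ℤ) :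
    StronglyMeasurable[futureAlgebra η (i + 1 - m)]
      fun ω => pastTruncation P η g m (pastFrom η i ω) := by
  have hP : IsProbabilityMeasure (P.map (pastFrom η (i - m))) :=
    Measure.isProbabilityMeasure_map (measurable_pastFrom hη _).aemeasurable
  simp only [truncation_pastFrom_eq hη hind hid hg]
  have h : StronglyMeasurable fun p : (ℕ → S) × (ℕ → S) => g (glue m p.1 p.2) :=
    hg.comp_measurable (measurable_glue m)
  exact (h.integral_prod_right' (ν := P.map (pastFrom η (i - m)))).comp_measurable
    (comap_measurable (futureFrom η (i + 1 - m)))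

/-- The truncation to `m` innovations is the conditional expectation given the innovations at times
`> i - m`. -/
lemma condExp_pastFrom_eq_truncation (hη : ∀ n, Measurable (η n)) (hind : iIndepFun η P)
    (hid : ∀ n, IdentDistrib (η n) (η 0) P P) (hg : StronglyMeasurable g) (m : ℕ) (i : ℤ)
    (hint : Integrable (fun ω => g (pastFrom η i ω)) P) :
    P[fun ω => g (pastFrom η i ω) | futureAlgebra η (i + 1 - m)]
      =ᵐ[P] fun ω => pastTruncation P η g m (pastFrom η i ω) := by
  have hYZ : IndepFun (futureFrom η (i + 1 - m)) (pastFrom η (i - m)) P := by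
    have := indep_past_future hη hind (i + 1 - m)
    rw [show i + 1 - (m : ℤ) - 1 = i - m by ring] at this
    exact this.symm
  have hf : StronglyMeasurable fun p : (ℕ → S) × (ℕ → S) => g (glue m p.1 p.2) :=
    hg.comp_measurable (measurable_glue m)
  have h := condExp_comap_eq_integral (measurable_futureFrom hη (i + 1 - m))
    (measurable_pastFrom hη (i - m)) hYZ hf
    (by simpa only [pastFrom_eq_glue η i m] using hint)
  simp only [← pastFrom_eq_glue η i m] at h
  refine h.trans (ae_of_all _ fun ω => ?_)
  beta_reduce
  rw [truncation_pastFrom_eq hη hind hid hg]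

lemma eLpNorm_comp_pastFrom_eq (hη : ∀ n, Measurable (η n)) (hind : iIndepFun η P)
    (hid : ∀ n, IdentDistrib (η n) (η 0) P P) {f : (ℕ → S) → H} (hf : StronglyMeasurable f)
    (p : ℝ≥0∞) (i j : ℤ) :
    eLpNorm (fun ω => f (pastFrom η i ω)) p P = eLpNorm (fun ω => f (pastFrom η j ω)) p P := by
  have key : ∀ i, eLpNorm (fun ω => f (pastFrom η i ω)) p P
      = eLpNorm f p (P.map (pastFrom η i)) := fun i =>
    (eLpNorm_map_measure hf.aestronglyMeasurable (measurable_pastFrom hη i).aemeasurable).symm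
  rw [key, key, map_pastFrom_eq hη hind hid i j]

lemma enorm_sub_integral_le_eLpNorm {f : Ω → H} (hf : Integrable f P) (v : H) :
    ‖v - ∫ ω, f ω ∂P‖ₑ ≤ eLpNorm (fun ω => v - f ω) 4 P := by
  have h : v - ∫ ω, f ω ∂P = ∫ ω, (v - f ω) ∂P := by
    rw [integral_sub (integrable_const v) hf]
    simp
  rw [h]
  refine (enorm_integral_le_lintegral_enorm _).trans ?_
  rw [← eLpNorm_one_eq_lintegral_enorm]
  exact eLpNorm_le_eLpNorm_of_exponent_le (by norm_num)
    (aestronglyMeasurable_const.sub hf.aestronglyMeasurable)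

lemma eLpNorm_four_pow {α F : Type*} [MeasurableSpace α] [NormedAddCommGroup F] (f : α → F)
    (μ : Measure α) : eLpNorm f 4 μ ^ 4 = ∫⁻ x, ‖f x‖ₑ ^ 4 ∂μ := by
  have h := eLpNorm_nnreal_pow_eq_lintegral (f := f) (μ := μ) (p := 4) (by norm_num)
  simp only [NNReal.coe_ofNat, ENNReal.coe_ofNat] at h
  have e : ∀ x : ℝ≥0∞, x ^ (4 : ℝ) = x ^ 4 := fun x => by
    rw [← ENNReal.rpow_natCast]; norm_num
  simpa only [e] using h

/-- The coupled copy is integrable, because it has the same law as the original. -/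
lemma integrable_splice (hη : ∀ n, Measurable (η n)) (hind : iIndepFun η P)
    (hg : StronglyMeasurable g) (m : ℕ)
    (hint : Integrable (fun ω => g (pastFrom η 1 ω)) P) :
    Integrable (fun z : Ω × Ω => g (splice m (pastFrom η 1 z.1) (pastFrom η 1 z.2)))
      (P.prod P) := by
  have hYm := measurable_futureFrom hη (1 + 1 - m)
  have hZm := measurable_pastFrom hη (1 - m)
  have hYZ : IndepFun (futureFrom η (1 + 1 - m)) (pastFrom η (1 - m)) P := by
    have := indep_past_future hη hind (1 + 1 - m)
    rw [show (1 : ℤ) + 1 - (m : ℤ) - 1 = 1 - m by ring] at this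
    exact this.symm
  have hp := (indepFun_iff_map_prod_eq_prod_map_map hYm.aemeasurable hZm.aemeasurable).1 hYZ
  have hf : StronglyMeasurable fun p : (ℕ → S) × (ℕ → S) => g (glue m p.1 p.2) :=
    hg.comp_measurable (measurable_glue m)
  simp only [pastFrom_eq_glue η 1 m] at hint
  have h1 := (integrable_map_measure hf.aestronglyMeasurable
    (hYm.prodMk hZm).aemeasurable).2 hint
  rw [hp, Measure.map_prod_map _ _ hYm hZm] at h1
  have hM : Measurable (Prod.map (futureFrom η (1 + 1 - m)) (pastFrom η (1 - m))) :=
    hYm.prodMap hZm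
  have h2 := h1.comp_measurable hM
  simp only [splice_eq_glue]
  exact h2

/-- Jensen's inequality, applied to the average over the independent copies. -/
lemma eLpNorm_sub_truncation_le (hη : ∀ n, Measurable (η n)) (hind : iIndepFun η P)
    (hid : ∀ n, IdentDistrib (η n) (η 0) P P) (hg : StronglyMeasurable g) (m : ℕ) (i : ℤ)
    (hint : Integrable (fun ω => g (pastFrom η 1 ω)) P) :
    eLpNorm (fun ω => g (pastFrom η i ω) - pastTruncation P η g m (pastFrom η i ω)) 4 P
      ≤ couplingNorm P η g m := by
  have hd : StronglyMeasurable fun x => g x - pastTruncation P η g m x :=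
    hg.sub (stronglyMeasurable_truncation hη hg m)
  rw [eLpNorm_comp_pastFrom_eq hη hind hid hd 4 i 1]
  rw [← ENNReal.pow_le_pow_left_iff (n := 4) (by norm_num), eLpNorm_four_pow, couplingNorm,
    eLpNorm_four_pow]
  have hm1 : Measurable fun z : Ω × Ω => pastFrom η 1 z.1 :=
    (measurable_pastFrom hη 1).comp measurable_fst
  have hm2 : Measurable fun z : Ω × Ω => pastFrom η 1 z.2 :=
    (measurable_pastFrom hη 1).comp measurable_snd
  have hsm : StronglyMeasurable fun z : Ω × Ω => g (pastFrom η 1 z.1)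
      - g (splice m (pastFrom η 1 z.1) (pastFrom η 1 z.2)) :=
    (hg.comp_measurable hm1).sub
      (hg.comp_measurable ((measurable_splice m).comp (hm1.prodMk hm2)))
  rw [lintegral_prod _ (hsm.enorm.pow_const 4).aemeasurable]
  refine lintegral_mono_ae ?_
  filter_upwards [(integrable_splice hη hind hg m hint).prod_right_ae] with ω hω
  rw [← eLpNorm_four_pow]
  exact pow_le_pow_left' (enorm_sub_integral_le_eLpNorm hω _) 4

lemma memLp_comp_pastFrom (hη : ∀ n, Measurable (η n)) (hind : iIndepFun η P)
    (hid : ∀ n, IdentDistrib (η n) (η 0) P P) (hg : StronglyMeasurable g)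
    (h4 : MemLp (fun ω => g (pastFrom η 1 ω)) 4 P) (i : ℤ) :
    MemLp (fun ω => g (pastFrom η i ω)) 4 P :=
  ⟨(hg.comp_measurable (measurable_pastFrom hη i)).aestronglyMeasurable, by
    rw [eLpNorm_comp_pastFrom_eq hη hind hid hg 4 i 1]
    exact h4.2⟩

/-- A causal Bernoulli shift with summable coupling coefficients is the sum over `k` of the rows of
a reversed martingale array: the row `k` collects what the innovation of lag `k` adds to the
conditional expectation given the innovations of smaller lag. -/
lemma exists_reversedMartingaleArray {E : Type*} [NormedAddCommGroup E] [InnerProductSpace ℝ E]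
    [CompleteSpace E] (hη : ∀ n, Measurable (η n)) (hind : iIndepFun η P)
    (hid : ∀ n, IdentDistrib (η n) (η 0) P P) (hg : StronglyMeasurable g)
    (h4 : MemLp (fun ω => g (pastFrom η 1 ω)) 4 P) (h0 : ∫ ω, g (pastFrom η 1 ω) ∂P = 0)
    (hsum : ∑' m, couplingNorm P η g (m + 1) ≠ ∞) (B : H →L[ℝ] H →L[ℝ] E)
    {X : ℤ → Lp H 4 P} (hX : ∀ i, X i =ᵐ[P] fun ω => g (pastFrom η i ω)) :
    ∃ (U : ℕ → ℤ → Lp H 4 P) (A : ℕ → ℝ) (D : ℕ → ℕ → E),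
      ReversedMartingaleArray P (futureAlgebra η) (pastAlgebra η) U A ∧
      (∀ i, HasSum (fun k => U k i) (X i)) ∧
      ∀ (k l : ℕ) (i : ℤ),
        expectationL P E (bilinLp P B (U k i) (U l (i + (l - k)))) = D k l := by
  have hint1 : Integrable (fun ω => g (pastFrom η 1 ω)) P := h4.integrable (by norm_num)
  have hgm : ∀ i, MemLp (fun ω => g (pastFrom η i ω)) 4 P :=
    memLp_comp_pastFrom hη hind hid hg h4
  have hint : ∀ i, Integrable (fun ω => g (pastFrom η i ω)) P := fun i =>
    (hgm i).integrable (by norm_num)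
  have hGm : ∀ m, StronglyMeasurable (pastTruncation P η g m) :=
    stronglyMeasurable_truncation hη hg
  have hnorm := eLpNorm_sub_truncation_le hη hind hid hg
  -- without any innovation kept, the truncation is the mean
  have hG0 : ∀ x, pastTruncation P η g 0 x = 0 := fun x => by
    have h : ∀ y : ℕ → S, splice 0 x y = y := fun y => by funext k; simp [splice]
    simpa [pastTruncation, h] using h0
  have hc : ∀ m, couplingNorm P η g (m + 1) ≠ ∞ := ENNReal.ne_top_of_tsum_ne_top hsum
  set a : ℕ → ℝ≥0∞ := fun m => if m = 0 then eLpNorm (fun ω => g (pastFrom η 1 ω)) 4 P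
    else couplingNorm P η g m with ha
  have hatop : ∀ m, a m ≠ ∞ := by
    intro m
    rcases m with _ | m
    · simpa [ha] using h4.2.ne
    · simpa [ha] using hc m
  have hR : ∀ m i, eLpNorm (fun ω => g (pastFrom η i ω)
      - pastTruncation P η g m (pastFrom η i ω)) 4 P ≤ a m := by
    intro m i
    rcases m with _ | m
    · simp only [hG0, sub_zero, ha, if_true]
      exact (eLpNorm_comp_pastFrom_eq hη hind hid hg 4 i 1).le
    · simpa [ha] using hnorm (m + 1) i hint1
  have hRm : ∀ m i, MemLp (fun ω => g (pastFrom η i ω)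
      - pastTruncation P η g m (pastFrom η i ω)) 4 P := fun m i =>
    ⟨((hg.sub (hGm m)).comp_measurable (measurable_pastFrom hη i)).aestronglyMeasurable,
      (hR m i).trans_lt (hatop m).lt_top⟩
  have hTm : ∀ m i, MemLp (fun ω => pastTruncation P η g m (pastFrom η i ω)) 4 P := fun m i => by
    refine ((hgm i).sub (hRm m i)).ae_eq (ae_of_all _ fun ω => ?_)
    simp
  obtain ⟨T, hTc⟩ : ∃ T : ℕ → ℤ → Lp H 4 P,
      ∀ m i, T m i =ᵐ[P] fun ω => pastTruncation P η g m (pastFrom η i ω) :=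
    ⟨fun m i => (hTm m i).toLp, fun m i => (hTm m i).coeFn_toLp⟩
  have hXT : ∀ m i, ‖X i - T m i‖ ≤ (a m).toReal := by
    intro m i
    rw [Lp.norm_def]
    refine ENNReal.toReal_mono (hatop m) ((eLpNorm_congr_ae ?_).trans_le (hR m i))
    filter_upwards [Lp.coeFn_sub (X i) (T m i), hX i, hTc m i] with ω h1 h2 h3
    rw [h1, Pi.sub_apply, h2, h3]
  have has : Summable fun m => (a m).toReal := by
    refine (summable_nat_add_iff (f := fun m => (a m).toReal) 1).1 ?_
    have : (fun m => (a (m + 1)).toReal) = fun m => (couplingNorm P η g (m + 1)).toReal := by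
      funext m; simp [ha]
    rw [this]
    exact ENNReal.summable_toReal hsum
  obtain ⟨U, hU⟩ : ∃ U : ℕ → ℤ → Lp H 4 P, ∀ k i, U k i = T (k + 1) i - T k i :=
    ⟨_, fun _ _ => rfl⟩
  set A : ℕ → ℝ := fun k => (a k).toReal + (a (k + 1)).toReal with hA
  have hUA : ∀ k i, ‖U k i‖ ≤ A k := by
    intro k i
    have : U k i = (X i - T k i) - (X i - T (k + 1) i) := by simp only [hU]; abel
    rw [this]
    exact (norm_sub_le _ _).trans (add_le_add (hXT k i) (hXT (k + 1) i))
  have hAs : Summable A := has.add ((summable_nat_add_iff (f := fun m => (a m).toReal) 1).2 has)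
  have hTfut : ∀ (m : ℕ) (i : ℤ), T m i ∈ lpMeas H ℝ (futureAlgebra η (i + 1 - m)) 4 P := by
    intro m i
    rw [mem_lpMeas_iff_aestronglyMeasurable]
    exact (stronglyMeasurable_truncation_pastFrom hη hind hid hg m i).aestronglyMeasurable.congr
      (hTc m i).symm
  have hTpast : ∀ m i, T m i ∈ lpMeas H ℝ (pastAlgebra η i) 4 P := by
    intro m i
    rw [mem_lpMeas_iff_aestronglyMeasurable]
    exact ((hGm m).comp_measurable (comap_measurable (pastFrom η i))).aestronglyMeasurable.congr
      (hTc m i).symm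
  have hfle : ∀ n, futureAlgebra η n ≤ ‹MeasurableSpace Ω› := fun n =>
    (measurable_futureFrom hη n).comap_le
  have hTce : ∀ (m : ℕ) (i : ℤ), P[fun ω => g (pastFrom η i ω) | futureAlgebra η (i + 1 - m)]
      =ᵐ[P] T m i := fun m i =>
    (condExp_pastFrom_eq_truncation hη hind hid hg m i (hint i)).trans (hTc m i).symm
  have hTi : ∀ m i, Integrable (T m i) P := fun m i => (Lp.memLp _).integrable (by norm_num)
  have hce : ∀ (k : ℕ) (i : ℤ), P[U k i | futureAlgebra η (i + 1 - k)] =ᵐ[P] 0 := by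
    intro k i
    have h1 : P[T (k + 1) i | futureAlgebra η (i + 1 - k)] =ᵐ[P] T k i := by
      refine (condExp_congr_ae (hTce (k + 1) i).symm).trans ?_
      refine (condExp_condExp_of_le (antitone_futureAlgebra η ?_) (hfle _)).trans (hTce k i)
      push_cast
      omega
    have h2 : P[T k i | futureAlgebra η (i + 1 - k)] =ᵐ[P] T k i :=
      condExp_of_aestronglyMeasurable' (hfle _)
        (mem_lpMeas_iff_aestronglyMeasurable.1 (hTfut k i)) (hTi k i)
    rw [hU]
    refine (condExp_congr_ae (Lp.coeFn_sub _ _)).trans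
      ((condExp_sub (hTi _ _) (hTi _ _) _).trans ?_)
    filter_upwards [h1, h2] with ω h1 h2
    rw [Pi.sub_apply, h1, h2, sub_self, Pi.zero_apply]
  refine ⟨U, A, fun k l => expectationL P E (bilinLp P B (U k 0) (U l (0 + (l - k)))), ?_, ?_, ?_⟩
  · exact
      { anti := antitone_futureAlgebra η
        future_le := hfle
        mono := monotone_pastAlgebra η
        past_le := fun n => (measurable_pastFrom hη n).comap_le
        indep := indep_past_future hη hind
        mem_future := fun k i => hU k i ▸ Submodule.sub_mem _
          (lpMeas_mono (antitone_futureAlgebra η (a := i - k) (by push_cast; omega))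
            (hTfut (k + 1) i))
          (lpMeas_mono (antitone_futureAlgebra η (a := i - k) (by omega)) (hTfut k i))
        mem_past := fun k i => hU k i ▸ Submodule.sub_mem _ (hTpast (k + 1) i) (hTpast k i)
        condExp_eq_zero := hce
        norm_le := hUA
        summable := hAs }
  · intro i
    have hs : Summable fun k => U k i := Summable.of_norm_bounded hAs fun k => hUA k i
    have hpart : ∀ n, ∑ k ∈ Finset.range n, U k i = T n i := by
      intro n
      have hT0 : T 0 i = 0 := by
        refine Lp.ext ?_
        filter_upwards [hTc 0 i, Lp.coeFn_zero H 4 P] with ω h1 h2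
        rw [h1, h2, hG0, Pi.zero_apply]
      simp only [hU]
      rw [Finset.sum_range_sub (fun k => T k i), hT0, sub_zero]
    have hlim : Tendsto (fun n => ∑ k ∈ Finset.range n, U k i) atTop (𝓝 (X i)) := by
      simp only [hpart]
      rw [tendsto_iff_norm_sub_tendsto_zero]
      refine squeeze_zero (fun _ => norm_nonneg _) (fun n => ?_) has.tendsto_atTop_zero
      rw [norm_sub_rev]
      exact hXT n i
    rw [tendsto_nhds_unique hlim hs.hasSum.tendsto_sum_nat]
    exact hs.hasSum
  · intro k l i
    set f : (ℕ → S) × (ℕ → S) → E := fun x =>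
      B (pastTruncation P η g (k + 1) x.1 - pastTruncation P η g k x.1)
        (pastTruncation P η g (l + 1) x.2 - pastTruncation P η g l x.2) with hf
    have hfm : StronglyMeasurable f :=
      B.continuous₂.comp_stronglyMeasurable
        ((((hGm _).sub (hGm _)).comp_measurable measurable_fst).prodMk
          (((hGm _).sub (hGm _)).comp_measurable measurable_snd))
    have hUc : ∀ k i, U k i =ᵐ[P] fun ω => pastTruncation P η g (k + 1) (pastFrom η i ω)
        - pastTruncation P η g k (pastFrom η i ω) := by
      intro k i
      rw [hU]
      filter_upwards [Lp.coeFn_sub (T (k + 1) i) (T k i), hTc (k + 1) i, hTc k i] with ω h1 h2 h3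
      rw [h1, Pi.sub_apply, h2, h3]
    have key : ∀ i : ℤ, expectationL P E (bilinLp P B (U k i) (U l (i + (l - k))))
        = ∫ ω, f (pastFrom η i ω, pastFrom η (i + (l - k)) ω) ∂P := by
      intro i
      rw [expectationL_apply]
      refine integral_congr_ae ?_
      filter_upwards [coeFn_bilinLp B (U k i) (U l (i + (l - k))), hUc k i,
        hUc l (i + (l - k))] with ω h1 h2 h3
      rw [h1, h2, h3]
    exact (key i).trans
      ((integral_pastFrom_pastFrom_eq hη hind hid hfm i 0 _).trans (key 0).symm)

end Coupling

/-! ### Tensor products and integral operators -/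

section Kernels

set_option linter.unusedSectionVars false

variable {α : Type*} [MeasurableSpace α] {μ : Measure α} [IsFiniteMeasure μ] {r : ℕ}

/-- The space `ℝ^{r × r}` of matrices, with the Frobenius norm. -/
abbrev MatVec (r : ℕ) : Type := EuclideanSpace ℝ (Fin r × Fin r)

/-- The outer product `x yᵀ`. -/
def outer (r : ℕ) : Vec r →L[ℝ] Vec r →L[ℝ] MatVec r :=
  LinearMap.mkContinuous₂
    (LinearMap.mk₂ ℝ (fun x y => WithLp.toLp 2 fun p => x p.1 * y p.2)
      (fun x x' y => by ext p; simp [add_mul])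
      (fun c x y => by ext p; simp [mul_assoc])
      (fun x y y' => by ext p; simp [mul_add])
      (fun c x y => by ext p; simp [mul_left_comm])) 1 fun x y => by
    rw [one_mul]
    refine le_of_sq_le_sq (le_of_eq ?_) (by positivity)
    rw [mul_pow, EuclideanSpace.norm_sq_eq, EuclideanSpace.norm_sq_eq, EuclideanSpace.norm_sq_eq,
      Finset.sum_mul_sum, ← Finset.univ_product_univ, Finset.sum_product]
    simp [mul_pow]

lemma outer_apply (x y : Vec r) (p : Fin r × Fin r) : outer r x y p = x p.1 * y p.2 := rfl

lemma inner_outer (k : MatVec r) (x y : Vec r) :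
    inner ℝ k (outer r x y) = ∑ a, x a * ∑ b, k (a, b) * y b := by
  rw [PiLp.inner_apply, ← Finset.univ_product_univ, Finset.sum_product]
  refine Finset.sum_congr rfl fun a _ => ?_
  rw [Finset.mul_sum]
  refine Finset.sum_congr rfl fun b _ => ?_
  simp only [outer_apply, RCLike.inner_apply, conj_trivial]
  ring

lemma norm_outer (x y : Vec r) : ‖outer r x y‖ = ‖x‖ * ‖y‖ := by
  refine (sq_eq_sq₀ (norm_nonneg _) (by positivity)).1 ?_
  rw [mul_pow, EuclideanSpace.norm_sq_eq, EuclideanSpace.norm_sq_eq, EuclideanSpace.norm_sq_eq,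
    Finset.sum_mul_sum, ← Finset.univ_product_univ, Finset.sum_product]
  simp [mul_pow, outer_apply]

lemma inner_outer_outer (x y x' y' : Vec r) :
    inner ℝ (outer r x y) (outer r x' y') = inner ℝ x x' * inner ℝ y y' := by
  rw [inner_outer, PiLp.inner_apply, PiLp.inner_apply, Finset.sum_mul_sum]
  refine Finset.sum_congr rfl fun a _ => ?_
  rw [Finset.mul_sum]
  refine Finset.sum_congr rfl fun b _ => ?_
  simp only [outer_apply, RCLike.inner_apply, conj_trivial]
  ring

lemma eLpNorm_two_sq {β F : Type*} [MeasurableSpace β] [NormedAddCommGroup F] (f : β → F)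
    (ν : Measure β) : eLpNorm f 2 ν ^ 2 = ∫⁻ x, ‖f x‖ₑ ^ 2 ∂ν := by
  have h := eLpNorm_nnreal_pow_eq_lintegral (f := f) (μ := ν) (p := 2) (by norm_num)
  simpa using h

lemma eLpNorm_outer {x y : α → Vec r} (hx : AEStronglyMeasurable x μ)
    (hy : AEStronglyMeasurable y μ) :
    eLpNorm (fun q : α × α => outer r (x q.1) (y q.2)) 2 (μ.prod μ)
      = eLpNorm x 2 μ * eLpNorm y 2 μ := by
  refine (ENNReal.pow_right_strictMono two_ne_zero).injective ?_
  beta_reduce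
  rw [mul_pow, eLpNorm_two_sq, eLpNorm_two_sq, eLpNorm_two_sq,
    ← lintegral_prod_mul (hx.enorm.pow_const 2) (hy.enorm.pow_const 2)]
  refine lintegral_congr fun q => ?_
  rw [← mul_pow, ← ofReal_norm, norm_outer, ENNReal.ofReal_mul (norm_nonneg _), ofReal_norm,
    ofReal_norm]

lemma memLp_outer {x y : α → Vec r} (hx : MemLp x 2 μ) (hy : MemLp y 2 μ) :
    MemLp (fun q : α × α => outer r (x q.1) (y q.2)) 2 (μ.prod μ) := by
  refine ⟨(outer r).continuous₂.comp_aestronglyMeasurable (hx.1.comp_fst.prodMk hy.1.comp_snd), ?_⟩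
  rw [eLpNorm_outer hx.1 hy.1]
  exact ENNReal.mul_lt_top hx.2 hy.2

lemma ae_prod_and {p q : α → Prop} (hp : ∀ᵐ t ∂μ, p t) (hq : ∀ᵐ t ∂μ, q t) :
    ∀ᵐ z ∂(μ.prod μ), p z.1 ∧ q z.2 :=
  (Measure.quasiMeasurePreserving_fst.ae hp).and (Measure.quasiMeasurePreserving_snd.ae hq)

/-- The tensor product `(t, s) ↦ x(t) y(s)ᵀ` of two square integrable functions. -/
def tensor (μ : Measure α) [IsFiniteMeasure μ] (r : ℕ) :
    Lp (Vec r) 2 μ →L[ℝ] Lp (Vec r) 2 μ →L[ℝ] Lp (MatVec r) 2 (μ.prod μ) :=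
  LinearMap.mkContinuous₂
    (LinearMap.mk₂ ℝ (fun x y => (memLp_outer (Lp.memLp x) (Lp.memLp y)).toLp)
      (fun x x' y => by
        rw [← MemLp.toLp_add]
        refine MemLp.toLp_congr _ _ ?_
        filter_upwards [ae_prod_and (Lp.coeFn_add x x') (ae_of_all _ fun _ => trivial)] with q hq
        rw [hq.1, Pi.add_apply, Pi.add_apply, map_add, add_apply])
      (fun c x y => by
        rw [← MemLp.toLp_const_smul]
        refine MemLp.toLp_congr _ _ ?_
        filter_upwards [ae_prod_and (Lp.coeFn_smul c x) (ae_of_all _ fun _ => trivial)] with q hq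
        rw [hq.1, Pi.smul_apply, Pi.smul_apply, map_smul, smul_apply])
      (fun x y y' => by
        rw [← MemLp.toLp_add]
        refine MemLp.toLp_congr _ _ ?_
        filter_upwards [ae_prod_and (ae_of_all _ fun _ => trivial) (Lp.coeFn_add y y')] with q hq
        rw [hq.2, Pi.add_apply, Pi.add_apply, map_add])
      (fun c x y => by
        rw [← MemLp.toLp_const_smul]
        refine MemLp.toLp_congr _ _ ?_
        filter_upwards [ae_prod_and (ae_of_all _ fun _ => trivial) (Lp.coeFn_smul c y)] with q hq
        rw [hq.2, Pi.smul_apply, Pi.smul_apply, map_smul])) 1 fun x y => by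
    rw [one_mul, LinearMap.mk₂_apply, Lp.norm_toLp,
      eLpNorm_outer (Lp.aestronglyMeasurable x) (Lp.aestronglyMeasurable y), ENNReal.toReal_mul,
      Lp.norm_def, Lp.norm_def]

lemma coeFn_tensor (x y : Lp (Vec r) 2 μ) :
    tensor μ r x y =ᵐ[μ.prod μ] fun q => outer r (x q.1) (y q.2) :=
  (memLp_outer (Lp.memLp x) (Lp.memLp y)).coeFn_toLp

lemma norm_tensor_le : ‖tensor μ r‖ ≤ 1 := LinearMap.mkContinuous₂_norm_le _ zero_le_one _

lemma norm_tensor_apply_le (x y : Lp (Vec r) 2 μ) : ‖tensor μ r x y‖ ≤ ‖x‖ * ‖y‖ := by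
  refine ((tensor μ r).le_opNorm₂ x y).trans ?_
  rw [mul_assoc]
  exact mul_le_of_le_one_left (by positivity) norm_tensor_le

lemma inner_tensor_tensor (x y x' y' : Lp (Vec r) 2 μ) :
    inner ℝ (tensor μ r x y) (tensor μ r x' y') = inner ℝ x x' * inner ℝ y y' := by
  rw [L2.inner_def, L2.inner_def, L2.inner_def, ← integral_prod_mul]
  refine integral_congr_ae ?_
  filter_upwards [coeFn_tensor x y, coeFn_tensor x' y'] with q h1 h2
  rw [h1, h2, inner_outer_outer]

/-- The integral operator on `L²` with the kernel `k`. It is defined through its quadratic form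
`⟪kernelOp k x, y⟫ = ⟪k, y ⊗ x⟫`. -/
def kernelOp (k : Lp (MatVec r) 2 (μ.prod μ)) : Lp (Vec r) 2 μ →L[ℝ] Lp (Vec r) 2 μ :=
  InnerProductSpace.continuousLinearMapOfBilin (𝕜 := ℝ)
    ((ContinuousLinearMap.compL ℝ _ _ ℝ (innerSL ℝ k)).comp (tensor μ r).flip :
      Lp (Vec r) 2 μ →L[ℝ] Lp (Vec r) 2 μ →L[ℝ] ℝ)

lemma inner_kernelOp (k : Lp (MatVec r) 2 (μ.prod μ)) (x y : Lp (Vec r) 2 μ) :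
    inner ℝ (kernelOp k x) y = inner ℝ k (tensor μ r y x) :=
  InnerProductSpace.continuousLinearMapOfBilin_apply (𝕜 := ℝ) _ _ _

lemma kernelOp_sub (k k' : Lp (MatVec r) 2 (μ.prod μ)) :
    kernelOp k - kernelOp k' = kernelOp (k - k') := by
  refine ContinuousLinearMap.ext fun x => ext_inner_right ℝ fun y => ?_
  rw [sub_apply, inner_sub_left, inner_kernelOp, inner_kernelOp, inner_kernelOp, inner_sub_left]

lemma kernelOp_add (k k' : Lp (MatVec r) 2 (μ.prod μ)) :
    kernelOp (k + k') = kernelOp k + kernelOp k' := by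
  refine ContinuousLinearMap.ext fun x => ext_inner_right ℝ fun y => ?_
  rw [add_apply, inner_add_left, inner_kernelOp, inner_kernelOp, inner_kernelOp, inner_add_left]

lemma kernelOp_smul (c : ℝ) (k : Lp (MatVec r) 2 (μ.prod μ)) :
    kernelOp (c • k) = c • kernelOp k := by
  refine ContinuousLinearMap.ext fun x => ext_inner_right ℝ fun y => ?_
  rw [smul_apply, inner_smul_left, inner_kernelOp, inner_kernelOp, inner_smul_left]

lemma kernelOp_tensor (a b : Lp (Vec r) 2 μ) :
    kernelOp (tensor μ r a b) = (innerSL ℝ b).smulRight a := by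
  refine ContinuousLinearMap.ext fun x => ext_inner_right ℝ fun y => ?_
  rw [inner_kernelOp, inner_tensor_tensor, ContinuousLinearMap.smulRight_apply, inner_smul_left,
    innerSL_apply_apply, conj_trivial, mul_comm]

lemma norm_kernelOp_le (k : Lp (MatVec r) 2 (μ.prod μ)) : ‖kernelOp k‖ ≤ ‖k‖ := by
  refine ContinuousLinearMap.opNorm_le_bound _ (norm_nonneg _) fun x => ?_
  have h1 : ‖kernelOp k x‖ * ‖kernelOp k x‖ ≤ ‖k‖ * ‖x‖ * ‖kernelOp k x‖ := by
    rw [← real_inner_self_eq_norm_mul_norm, inner_kernelOp]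
    refine (real_inner_le_norm _ _).trans ?_
    calc ‖k‖ * ‖tensor μ r (kernelOp k x) x‖ ≤ ‖k‖ * (‖kernelOp k x‖ * ‖x‖) :=
          mul_le_mul_of_nonneg_left (norm_tensor_apply_le _ _) (norm_nonneg _)
      _ = _ := by ring
  rcases (norm_nonneg (kernelOp k x)).eq_or_lt with h | h
  · rw [← h]; positivity
  · exact le_of_mul_le_mul_right h1 h

/-- The kernels that define a compact self-adjoint operator. -/
def IsCompactSymmKernel (k : Lp (MatVec r) 2 (μ.prod μ)) : Prop :=
  IsCompactOperator (kernelOp k) ∧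
    ((kernelOp k : Lp (Vec r) 2 μ →L[ℝ] Lp (Vec r) 2 μ) :
      Lp (Vec r) 2 μ →ₗ[ℝ] Lp (Vec r) 2 μ).IsSymmetric

lemma isCompactOperator_kernelOp_tensor (a b : Lp (Vec r) 2 μ) :
    IsCompactOperator (kernelOp (tensor μ r a b)) := by
  have h : IsCompactOperator (ContinuousLinearMap.toSpanSingleton ℝ a) :=
    isCompactOperator_of_locallyCompactSpace_rng _
  have h2 := h.comp_clm (innerSL ℝ b)
  rw [kernelOp_tensor]
  exact h2

/-- The kernel operator acts by integration against the kernel. -/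
lemma kernelOp_ae_eq (k : Lp (MatVec r) 2 (μ.prod μ)) (x : Lp (Vec r) 2 μ) :
    ∀ᵐ t ∂μ, ∀ a, kernelOp k x t a = ∫ s, ∑ b, k (t, s) (a, b) * x s b ∂μ := by
  rw [ae_all_iff]
  intro a
  have hk : ∀ b, MemLp (fun q => k q (a, b)) 2 (μ.prod μ) := fun b =>
    (EuclideanSpace.proj (𝕜 := ℝ) (a, b)).comp_memLp' (Lp.memLp k)
  have hx : ∀ b, MemLp (fun q : α × α => x q.2 b) 2 (μ.prod μ) := fun b =>
    ((EuclideanSpace.proj (𝕜 := ℝ) b).comp_memLp' (Lp.memLp x)).comp_snd μ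
  have hc : Integrable (fun q : α × α => ∑ b, k q (a, b) * x q.2 b) (μ.prod μ) :=
    integrable_finsetSum _ fun b _ => (hk b).integrable_mul (hx b)
  have hy : Integrable (fun t => kernelOp k x t a) μ :=
    ((EuclideanSpace.proj (𝕜 := ℝ) a).comp_memLp' (Lp.memLp (kernelOp k x))).integrable
      (by norm_num)
  refine hy.ae_eq_of_forall_setIntegral_eq _ _ hc.integral_prod_left fun C hC hμC => ?_
  -- test against the indicator of `C` in the coordinate `a`
  set e : Lp (Vec r) 2 μ := indicatorConstLp 2 hC hμC.ne (EuclideanSpace.single a 1) with he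
  have h1 : inner ℝ (kernelOp k x) e = ∫ t in C, kernelOp k x t a ∂μ := by
    rw [real_inner_comm, he, L2.inner_indicatorConstLp_eq_setIntegral_inner]
    refine integral_congr_ae (ae_of_all _ fun t => ?_)
    simp [EuclideanSpace.inner_single_left]
  have h2 : inner ℝ k (tensor μ r e x) = ∫ t in C, ∫ s, ∑ b, k (t, s) (a, b) * x s b ∂μ ∂μ := by
    have h3 : inner ℝ k (tensor μ r e x)
        = ∫ q in C ×ˢ Set.univ, ∑ b, k q (a, b) * x q.2 b ∂(μ.prod μ) := by
      rw [L2.inner_def, ← integral_indicator (hC.prod MeasurableSet.univ)]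
      refine integral_congr_ae ?_
      filter_upwards [coeFn_tensor e x, ae_prod_and
        (indicatorConstLp_coeFn (p := 2) (hs := hC) (hμs := hμC.ne)
          (c := (EuclideanSpace.single a 1 : Vec r)))
        (ae_of_all _ fun _ => trivial)] with q h4 h5
      rw [h4, inner_outer, he, h5.1]
      by_cases hq : q.1 ∈ C
      · rw [Set.indicator_of_mem hq, Set.indicator_of_mem (by simpa using hq)]
        rw [Finset.sum_eq_single a]
        · simp
        · intro b _ hb
          simp [hb]
        · simp
      · rw [Set.indicator_of_notMem hq, Set.indicator_of_notMem (by simpa using hq)]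
        simp
    rw [h3, setIntegral_prod _ hc.integrableOn]
    simp only [Measure.restrict_univ]
  rw [← h1, inner_kernelOp, h2]

end Kernels

section IntegralOfLp

variable {Ω α F : Type*} [MeasurableSpace Ω] [MeasurableSpace α] {P : Measure Ω}
  [IsProbabilityMeasure P] {μ : Measure α} [IsFiniteMeasure μ] [NormedAddCommGroup F]
  [NormedSpace ℝ F] [CompleteSpace F]

/-- The Bochner integral of an `L²`-valued function is the pointwise integral of any jointly
measurable version. -/
lemma integral_Lp_ae_eq {f : Ω → Lp F 2 μ} (hf : Integrable f P) {Φ : Ω × α → F}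
    (hΦ : AEStronglyMeasurable Φ (P.prod μ)) (hfΦ : ∀ᵐ ω ∂P, f ω =ᵐ[μ] fun t => Φ (ω, t)) :
    (∀ᵐ t ∂μ, Integrable (fun ω => Φ (ω, t)) P) ∧
      (∫ ω, f ω ∂P : Lp F 2 μ) =ᵐ[μ] fun t => ∫ ω, Φ (ω, t) ∂P := by
  have hΦi : Integrable Φ (P.prod μ) := by
    refine ⟨hΦ, ?_⟩
    rw [hasFiniteIntegral_iff_enorm, lintegral_prod _ hΦ.enorm]
    have h1 : ∀ᵐ ω ∂P, ∫⁻ t, ‖Φ (ω, t)‖ₑ ∂μ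
        ≤ ‖f ω‖ₑ * μ Set.univ ^ (1 / (1 : ℝ≥0∞).toReal - 1 / (2 : ℝ≥0∞).toReal) := by
      filter_upwards [hfΦ] with ω hω
      rw [Lp.enorm_def, ← eLpNorm_one_eq_lintegral_enorm,
        ← eLpNorm_congr_ae hω]
      exact eLpNorm_le_eLpNorm_mul_rpow_measure_univ (by norm_num) (Lp.aestronglyMeasurable _)
    refine (lintegral_mono_ae h1).trans_lt ?_
    rw [lintegral_mul_const'' _ hf.1.enorm]
    refine ENNReal.mul_lt_top hf.2 (ENNReal.rpow_lt_top_of_nonneg (by norm_num)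
      (measure_ne_top _ _))
  refine ⟨hΦi.prod_left_ae, ?_⟩
  refine ((Lp.memLp _).integrable (by norm_num)).ae_eq_of_forall_setIntegral_eq _ _
    hΦi.integral_prod_right fun C hC hμC => ?_
  set L : Lp F 2 μ →L[ℝ] F := (ContinuousLinearMap.lsmul ℝ ℝ).lpPairing μ 2 2
    (indicatorConstLp 2 hC hμC.ne (1 : ℝ)) with hL
  have hLx : ∀ x : Lp F 2 μ, L x = ∫ t in C, x t ∂μ := by
    intro x
    rw [hL, ContinuousLinearMap.lpPairing_eq_integral, ← integral_indicator hC]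
    refine integral_congr_ae ?_
    filter_upwards [indicatorConstLp_coeFn (p := 2) (hs := hC) (hμs := hμC.ne) (c := (1 : ℝ))]
      with t ht
    rw [ht]
    by_cases h : t ∈ C <;> simp [h]
  have h2 : ∫ ω, L (f ω) ∂P = ∫ ω, ∫ t in C, Φ (ω, t) ∂μ ∂P := by
    refine integral_congr_ae ?_
    filter_upwards [hfΦ] with ω hω
    rw [hLx]
    exact integral_congr_ae (ae_restrict_of_ae hω)
  rw [← hLx, ← L.integral_comp_comm hf, h2]
  have h3 : Integrable (Function.uncurry fun ω t => Φ (ω, t)) (P.prod (μ.restrict C)) := by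
    refine hΦi.mono_measure ?_
    exact Measure.prod_mono le_rfl Measure.restrict_le_self
  rw [integral_integral_swap h3]

end IntegralOfLp

/-! ### The estimator as a weighted quadratic form -/

section Weights

/-- The weight that the estimator gives to the product of two observations at distance `x`. It is
`0` for `|x| ≥ N`. -/
def lagWeight (K : ℝ → ℝ) (h : ℝ) (N : ℕ) (x : ℤ) : ℝ :=
  if |(x : ℝ)| < N then K (|(x : ℝ)| / h) / (N - |(x : ℝ)|) else 0

lemma lagWeight_neg (K : ℝ → ℝ) (h : ℝ) (N : ℕ) (x : ℤ) :
    lagWeight K h N (-x) = lagWeight K h N x := by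
  simp [lagWeight]

lemma exists_bandWeights {K : ℝ → ℝ} (hK : KernelAssumption K) {h : ℕ → ℝ}
    (hh : BandwidthAssumption h) :
    ∃ C R, BandWeights (fun N x => lagWeight K (h N) N x) C R := by
  obtain ⟨c, hc, hsupp, ⟨L, hL⟩, -⟩ := hK.support_lipschitz
  have h0 : (0 : ℝ) ∈ Set.Icc (-c) c := ⟨by linarith, hc.le⟩
  have hM : ∀ u, K u ≤ 1 + L * c := by
    intro u
    rcases lt_or_ge c |u| with hu | hu
    · rw [hsupp u hu]; positivity
    · have h1 := hL.dist_le_mul u (abs_le.1 hu) 0 h0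
      rw [Real.dist_eq, Real.dist_eq, hK.zero, sub_zero] at h1
      have h2 := (le_abs_self _).trans (h1.trans (mul_le_mul_of_nonneg_left hu L.2))
      linarith
  have hcont : ContinuousAt K 0 :=
    hL.continuousOn.continuousAt (Icc_mem_nhds (by linarith) hc)
  have hpos : ∀ᶠ N in atTop, 0 < h N := hh.tendsto_infty.eventually_gt_atTop 0
  have hband : ∀ N, 0 < h N → ∀ x : ℤ, (⌊c * h N⌋₊ : ℤ) < |x| → K (|(x : ℝ)| / h N) = 0 := by
    intro N hN x hx
    refine hsupp _ ?_
    rw [abs_div, abs_abs, abs_of_pos hN, lt_div_iff₀ hN]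
    have h1 : c * h N < ⌊c * h N⌋₊ + 1 := Nat.lt_floor_add_one _
    have h2 : ((⌊c * h N⌋₊ : ℤ) : ℝ) + 1 ≤ |(x : ℝ)| := by
      have : (⌊c * h N⌋₊ : ℤ) + 1 ≤ |x| := hx
      exact_mod_cast this
    push_cast at h2
    linarith
  -- within the band `|x| ≤ c h N ≤ N / 2`, the denominator `N - |x|` is at least `N / 2`
  refine ⟨2 * (1 + L * c), fun N => ⌊c * h N⌋₊, ?_, ?_, ?_, ?_⟩
  · have hsmall : ∀ᶠ N in atTop, h N / (N : ℝ) < 1 / (2 * c) :=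
      hh.ratio.eventually_lt_const (by positivity)
    filter_upwards [hpos, hsmall, eventually_gt_atTop 0] with N h1 h2 h3 x
    have hN : (0 : ℝ) < N := by exact_mod_cast h3
    have hMN : 0 ≤ 2 * (1 + L * c) / (N : ℝ) := by positivity
    simp only [lagWeight]
    split_ifs with hx
    · rcases lt_or_ge (⌊c * h N⌋₊ : ℤ) |x| with hxR | hxR
      · rw [hband N h1 x hxR]
        simpa using hMN
      · have hx2 : |(x : ℝ)| ≤ N / 2 := by
          have e1 : |(x : ℝ)| ≤ ⌊c * h N⌋₊ := by exact_mod_cast hxR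
          have e2 : (⌊c * h N⌋₊ : ℝ) ≤ c * h N := Nat.floor_le (by positivity)
          rw [div_lt_iff₀ hN] at h2
          have e3 : c * h N ≤ c * (1 / (2 * c) * N) := mul_le_mul_of_nonneg_left h2.le hc.le
          have e4 : c * (1 / (2 * c) * N) = N / 2 := by field_simp
          linarith
        rw [abs_of_nonneg (div_nonneg (hK.nonneg _) (by linarith))]
        rw [div_le_div_iff₀ (by linarith) hN]
        have := mul_le_mul (hM (|(x : ℝ)| / h N)) (le_refl (N : ℝ)) hN.le (by positivity)
        have e5 : (1 + L * c) * (N : ℝ) ≤ 2 * (1 + L * c) * (N - |(x : ℝ)|) := by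
          have : 0 ≤ 1 + L * c := by positivity
          nlinarith
        linarith
    · simpa using hMN
  · filter_upwards [hpos] with N h1 x hx
    simp only [lagWeight, hband N h1 x hx, zero_div, ite_self]
  · have h1 := hh.ratio.const_mul c
    rw [mul_zero] at h1
    refine squeeze_zero' (Eventually.of_forall fun N => by positivity) ?_ h1
    filter_upwards [hpos] with N hN
    rw [← mul_div_assoc]
    exact div_le_div_of_nonneg_right (Nat.floor_le (by positivity)) (by positivity)
  · intro x
    have h1 : Tendsto (fun N => K (|(x : ℝ)| / h N)) atTop (𝓝 1) := by
      rw [← hK.zero]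
      exact hcont.tendsto.comp (tendsto_const_nhds.div_atTop hh.tendsto_infty)
    refine h1.congr' ?_
    filter_upwards [tendsto_natCast_atTop_atTop.eventually_gt_atTop |(x : ℝ)|] with N hN
    rw [lagWeight, if_pos hN, div_mul_cancel₀ _ (by linarith)]

lemma sum_Icc_int_eq {M : Type*} [AddCommMonoid M] (f : ℤ → M) (N : ℕ) :
    ∑ i ∈ Finset.Icc (1 : ℤ) N, f i = ∑ i ∈ Finset.Icc 1 N, f (i : ℤ) := by
  have h : Finset.Icc (1 : ℤ) N = (Finset.Icc 1 N).map Nat.castEmbedding := by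
    ext i
    simp only [Finset.mem_Icc, Finset.mem_map, Nat.castEmbedding_apply]
    constructor
    · intro h
      exact ⟨i.toNat, by omega, by omega⟩
    · rintro ⟨j, hj, rfl⟩
      omega
  rw [h, Finset.sum_map]
  rfl

/-- Sorting the pairs `i < j` by their lag `l = j - i`. -/
lemma sum_Icc_lt_eq_sum_lag (F : ℕ → ℕ → ℝ) (N : ℕ) :
    ∑ i ∈ Finset.Icc 1 N, ∑ j ∈ Finset.Icc 1 N with i < j, F i j
      = ∑ l ∈ Finset.Ico 1 N, ∑ j ∈ Finset.Icc 1 (N - l), F j (j + l) := by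
  rw [Finset.sum_sigma', Finset.sum_sigma']
  refine Finset.sum_bij' (fun p _ => ⟨p.2 - p.1, p.1⟩) (fun p _ => ⟨p.2, p.2 + p.1⟩) ?_ ?_ ?_ ?_ ?_
  · rintro ⟨i, j⟩ h
    simp only [Finset.mem_sigma, Finset.mem_filter, Finset.mem_Icc, Finset.mem_Ico] at h ⊢
    omega
  · rintro ⟨l, j⟩ h
    simp only [Finset.mem_sigma, Finset.mem_filter, Finset.mem_Icc, Finset.mem_Ico] at h ⊢
    omega
  · rintro ⟨i, j⟩ h
    simp only [Finset.mem_sigma, Finset.mem_filter, Finset.mem_Icc] at h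
    simp only [Sigma.mk.injEq, heq_eq_eq, true_and]
    omega
  · rintro ⟨l, j⟩ h
    simp
  · rintro ⟨i, j⟩ h
    simp only [Finset.mem_sigma, Finset.mem_filter, Finset.mem_Icc] at h
    simp only
    congr 1
    omega

/-- The estimator, written as one double sum over all pairs of observations. -/
lemma longRunCovEst_apply {d r : ℕ} {K : ℝ → ℝ} (hK0 : K 0 = 1) (h : ℝ) {N : ℕ} (hN : 0 < N)
    (X : ℕ → Vec d → Vec r) (t s : Vec d) (a b : Fin r) :
    longRunCovEst K h N X t s a b
      = ∑ i ∈ Finset.Icc 1 N, ∑ j ∈ Finset.Icc 1 N, lagWeight K h N ((i : ℤ) - j) *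
          (demeaned N X i t a * demeaned N X j s b) := by
  set u : ℕ → ℝ := fun i => demeaned N X i t a with hu
  set v : ℕ → ℝ := fun i => demeaned N X i s b with hv
  set F : ℕ → ℕ → ℝ := fun i j => lagWeight K h N ((i : ℤ) - j) * (u i * v j) with hF
  have hsplit : ∑ i ∈ Finset.Icc 1 N, ∑ j ∈ Finset.Icc 1 N, F i j
      = (∑ i ∈ Finset.Icc 1 N, F i i)
        + ∑ i ∈ Finset.Icc 1 N, ∑ j ∈ Finset.Icc 1 N with i < j, F i j
        + ∑ i ∈ Finset.Icc 1 N, ∑ j ∈ Finset.Icc 1 N with i < j, F j i := by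
    have h3 : ∑ i ∈ Finset.Icc 1 N, ∑ j ∈ Finset.Icc 1 N with i < j, F j i
        = ∑ i ∈ Finset.Icc 1 N, ∑ j ∈ Finset.Icc 1 N with j < i, F i j := by
      simp only [Finset.sum_filter]
      rw [Finset.sum_comm]
    rw [h3, ← Finset.sum_add_distrib, ← Finset.sum_add_distrib]
    refine Finset.sum_congr rfl fun i hi => ?_
    simp only [Finset.sum_filter]
    have h1 : F i i = ∑ j ∈ Finset.Icc 1 N, if i = j then F i j else 0 := by
      rw [Finset.sum_ite_eq, if_pos hi]
    rw [h1, ← Finset.sum_add_distrib, ← Finset.sum_add_distrib]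
    refine Finset.sum_congr rfl fun j _ => ?_
    rcases lt_trichotomy i j with h | h | h
    · simp [h, h.not_gt, h.ne]
    · simp [h]
    · simp [h, h.not_gt, h.ne']
  have hw : ∀ l < N, lagWeight K h N (l : ℤ) = K (l / h) * ((N : ℝ) - l)⁻¹ := by
    intro l hl
    have : |(((l : ℤ)) : ℝ)| = l := by simp
    rw [lagWeight, this, if_pos (by exact_mod_cast hl), div_eq_mul_inv]
  have hw' : ∀ (j l : ℕ), lagWeight K h N ((j : ℤ) - (j + l : ℕ)) = lagWeight K h N (l : ℤ) := by
    intro j l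
    rw [← lagWeight_neg]
    congr 1
    push_cast
    ring
  have hw2 : ∀ (j l : ℕ), lagWeight K h N (((j + l : ℕ) : ℤ) - j) = lagWeight K h N (l : ℤ) := by
    intro j l
    congr 1
    push_cast
    ring
  have hmain : longRunCovEst K h N X t s a b
      = (N : ℝ)⁻¹ * ∑ j ∈ Finset.Icc 1 N, u j * v j
        + ∑ l ∈ Finset.Ico 1 N, K (l / h) * (((N : ℝ) - l)⁻¹ *
            ∑ j ∈ Finset.Icc 1 (N - l), u j * v (j + l)
          + ((N : ℝ) - l)⁻¹ * ∑ j ∈ Finset.Icc 1 (N - l), v j * u (j + l)) := by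
    simp only [longRunCovEst, Matrix.add_apply, Matrix.sum_apply, Matrix.smul_apply,
      Matrix.transpose_apply, smul_eq_mul]
    congr 1
    · simp [sampleAutocov, hN, hu, hv]
    · refine Finset.sum_congr rfl fun l hl => ?_
      have hlN : l < N := (Finset.mem_Ico.1 hl).2
      simp [sampleAutocov, hlN, hu, hv]
  rw [hmain, hsplit, sum_Icc_lt_eq_sum_lag, sum_Icc_lt_eq_sum_lag (fun i j => F j i), add_assoc,
    ← Finset.sum_add_distrib]
  congr 1
  · have := hw 0 hN
    simp only [Nat.cast_zero, zero_div, hK0, one_mul, sub_zero] at this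
    simp only [hF, sub_self, this, Finset.mul_sum]
  · refine Finset.sum_congr rfl fun l hl => ?_
    have hlN : l < N := (Finset.mem_Ico.1 hl).2
    simp only [hF, hw', hw2, hw l hlN, mul_add, Finset.mul_sum]
    congr 1 <;> refine Finset.sum_congr rfl fun j _ => ?_ <;> ring

end Weights

section FiniteRank

set_option linter.unusedSectionVars false

variable {α : Type*} [MeasurableSpace α] {μ : Measure α} [IsFiniteMeasure μ] {r : ℕ}

/-- A symmetrically weighted sum of tensor products has finite rank and is symmetric. -/
lemma isCompactSymmKernel_sum_tensor {ι : Type*} (I : Finset ι) (W : ι → ι → ℝ)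
    (hW : ∀ i j, W j i = W i j) (x : ι → Lp (Vec r) 2 μ) :
    IsCompactSymmKernel (∑ i ∈ I, ∑ j ∈ I, W i j • tensor μ r (x i) (x j)) := by
  constructor
  · have hcl : ∀ k ∈ {k : Lp (MatVec r) 2 (μ.prod μ) | IsCompactOperator (kernelOp k)},
        ∀ k' ∈ {k : Lp (MatVec r) 2 (μ.prod μ) | IsCompactOperator (kernelOp k)},
        IsCompactOperator (kernelOp (k + k')) := by
      intro k hk k' hk'
      rw [kernelOp_add]
      exact hk.add hk'
    have h0 : IsCompactOperator (kernelOp (0 : Lp (MatVec r) 2 (μ.prod μ))) := by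
      have : kernelOp (0 : Lp (MatVec r) 2 (μ.prod μ)) = 0 := by
        have := kernelOp_smul (0 : ℝ) (0 : Lp (MatVec r) 2 (μ.prod μ))
        simpa using this
      rw [this]
      exact isCompactOperator_zero
    refine Finset.sum_induction _ (fun k => IsCompactOperator (kernelOp k))
      (fun k k' hk hk' => hcl k hk k' hk') h0 fun i _ => ?_
    refine Finset.sum_induction _ (fun k => IsCompactOperator (kernelOp k))
      (fun k k' hk hk' => hcl k hk k' hk') h0 fun j _ => ?_
    rw [kernelOp_smul]
    exact (isCompactOperator_kernelOp_tensor _ _).smul (W i j)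
  · intro y z
    change inner ℝ (kernelOp _ y) z = inner ℝ y (kernelOp _ z)
    rw [real_inner_comm _ y, inner_kernelOp, inner_kernelOp]
    simp only [sum_inner, inner_smul_left, inner_tensor_tensor, conj_trivial]
    rw [Finset.sum_comm]
    refine Finset.sum_congr rfl fun i _ => Finset.sum_congr rfl fun j _ => ?_
    rw [hW]
    ring

/-- A limit of kernels of compact self-adjoint operators is again one. -/
lemma IsCompactSymmKernel.of_approx {k : Lp (MatVec r) 2 (μ.prod μ)}
    (hk : ∀ ε > 0, ∃ k', IsCompactSymmKernel k' ∧ ‖k' - k‖ < ε) : IsCompactSymmKernel k := by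
  have h1 : ∀ n : ℕ, ∃ k', IsCompactSymmKernel k' ∧ ‖k' - k‖ < 1 / ((n : ℝ) + 1) := fun n =>
    hk _ Nat.one_div_pos_of_nat
  choose f hf hfk using h1
  have hlim : Tendsto (fun n => kernelOp (f n)) atTop (𝓝 (kernelOp k)) := by
    rw [tendsto_iff_norm_sub_tendsto_zero]
    refine squeeze_zero (fun _ => norm_nonneg _) (fun n => ?_)
      (tendsto_one_div_add_atTop_nhds_zero_nat (𝕜 := ℝ))
    rw [kernelOp_sub]
    exact (norm_kernelOp_le _).trans (hfk n).le
  refine ⟨isCompactOperator_of_tendsto hlim (Eventually.of_forall fun n => (hf n).1), ?_⟩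
  intro y z
  have hy : Tendsto (fun n => inner ℝ (kernelOp (f n) y) z) atTop
      (𝓝 (inner ℝ (kernelOp k y) z)) :=
    (((ContinuousLinearMap.apply ℝ _ y).continuous.tendsto _).comp hlim).inner tendsto_const_nhds
  have hz : Tendsto (fun n => inner ℝ y (kernelOp (f n) z)) atTop
      (𝓝 (inner ℝ y (kernelOp k z))) :=
    Tendsto.inner tendsto_const_nhds
      (((ContinuousLinearMap.apply ℝ _ z).continuous.tendsto _).comp hlim)
  exact tendsto_nhds_unique (hy.congr fun n => (hf n).2 y z) hz

end FiniteRank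

section Frozen

variable {d r : ℕ} {T : Set (Vec d)}

/-- The square integrable kernel `k` represents the matrix valued function `A` on `T × T`. -/
def Represents (T : Set (Vec d)) [IsFiniteMeasure ((volume : Measure (Vec d)).restrict T)]
    (k : Lp (MatVec r) 2 (((volume : Measure (Vec d)).restrict T).prod (volume.restrict T)))
    (A : Vec d → Vec d → Matrix (Fin r) (Fin r) ℝ) : Prop :=
  ∀ᵐ q ∂(((volume : Measure (Vec d)).restrict T).prod (volume.restrict T)),
    ∀ a b, A q.1 q.2 a b = k q (a, b)

variable [IsFiniteMeasure ((volume : Measure (Vec d)).restrict T)]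
  {k k' : Lp (MatVec r) 2 (((volume : Measure (Vec d)).restrict T).prod (volume.restrict T))}
  {A A' : Vec d → Vec d → Matrix (Fin r) (Fin r) ℝ}

lemma Represents.eigenEq_iff (hA : Represents T k A) (ν : ℝ) (φ : L2Fun T r) :
    EigenEq T A ν φ ↔ kernelOp k φ = ν • φ := by
  have h1 : ∀ᵐ t ∂(volume.restrict T), ∀ a,
      kernelOp k φ t a = ∫ s in T, ∑ b, A t s a b * φ s b := by
    filter_upwards [kernelOp_ae_eq k φ, Measure.ae_ae_of_ae_prod hA] with t h1 h2 a
    rw [h1 a]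
    refine integral_congr_ae ?_
    filter_upwards [h2] with s h3
    simp only [h3]
  constructor
  · intro h
    refine Lp.ext ?_
    filter_upwards [h, h1, Lp.coeFn_smul ν φ] with t h2 h3 h4
    rw [h4]
    ext a
    rw [h3 a, ← h2 a]
    simp
  · intro h
    filter_upwards [h1, Lp.coeFn_smul ν φ] with t h3 h4 a
    rw [← h3 a, h, h4]
    simp

lemma Represents.orderedEigenvalue_eq (hA : Represents T k A) (ℓ : ℕ) :
    orderedEigenvalue T A ℓ = sSup (eigenvalueLowerBounds (kernelOp k) ℓ) := by
  simp only [orderedEigenvalue, eigenvalueLowerBounds, hA.eigenEq_iff]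

lemma Represents.intSqDist_eq (hA : Represents T k A) (hA' : Represents T k' A') :
    intSqDist T A A' = ENNReal.ofReal (‖k - k'‖ ^ 2) := by
  have h1 : (fun q : Vec d × Vec d => ENNReal.ofReal (frobSq (A q.1 q.2 - A' q.1 q.2)))
      =ᵐ[(((volume : Measure (Vec d)).restrict T).prod (volume.restrict T))]
      fun q => ‖(k - k') q‖ₑ ^ 2 := by
    filter_upwards [hA, hA', Lp.coeFn_sub k k'] with q h1 h2 h3
    rw [← ofReal_norm, ← ENNReal.ofReal_pow (norm_nonneg _), EuclideanSpace.norm_sq_eq, h3, frobSq,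
      ← Finset.univ_product_univ, Finset.sum_product]
    simp only [Matrix.sub_apply, h1, h2, Pi.sub_apply, PiLp.sub_apply, Real.norm_eq_abs, sq_abs]
  have h2 : AEMeasurable (fun q : Vec d × Vec d =>
      ENNReal.ofReal (frobSq (A q.1 q.2 - A' q.1 q.2)))
      (((volume : Measure (Vec d)).restrict T).prod (volume.restrict T)) :=
    ((Lp.aestronglyMeasurable (k - k')).enorm.pow_const 2).congr h1.symm
  rw [intSqDist, ← lintegral_prod _ h2, lintegral_congr_ae h1, ← eLpNorm_two_sq, ← Lp.enorm_def,
    ENNReal.ofReal_pow (norm_nonneg _), ofReal_norm]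

lemma Represents.abs_orderedEigenvalue_sub_le (hA : Represents T k A) (hA' : Represents T k' A')
    (hk : IsCompactSymmKernel k) (hk' : IsCompactSymmKernel k') {ℓ : ℕ} (hℓ : 1 ≤ ℓ) :
    |orderedEigenvalue T A ℓ - orderedEigenvalue T A' ℓ| ≤ ‖k - k'‖ := by
  rw [hA.orderedEigenvalue_eq, hA'.orderedEigenvalue_eq]
  refine (abs_sSup_eigenvalueLowerBounds_sub_le hk.1 hk.2 hk'.1 hk'.2 hℓ).trans ?_
  rw [kernelOp_sub]
  exact norm_kernelOp_le _

end Frozen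

/-! ### The errors and the realized estimator -/

section Moments

/-- Summability of `c m ^ (1 / κ)` improves to the larger exponent `1 / p`. -/
lemma tsum_rpow_one_div_ne_top {c : ℕ → ℝ≥0∞} {p κ : ℝ} (hp : 0 < p) (hpκ : p ≤ κ)
    (h : ∑' m, c m ^ (1 / κ) ≠ ∞) : ∑' m, c m ^ (1 / p) ≠ ∞ := by
  have hκ : 0 < κ := hp.trans_le hpκ
  set s : ℝ≥0∞ := ∑' m, c m ^ (1 / κ) with hs
  have hθ : 0 ≤ κ / p - 1 := by
    rw [sub_nonneg, le_div_iff₀ hp, one_mul]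
    exact hpκ
  have hle : ∀ m, c m ^ (1 / p) ≤ c m ^ (1 / κ) * s ^ (κ / p - 1) := by
    intro m
    have h1 : c m ^ (1 / p) = c m ^ (1 / κ) * (c m ^ (1 / κ)) ^ (κ / p - 1) := by
      rw [← ENNReal.rpow_mul, ← ENNReal.rpow_add_of_nonneg _ _ (by positivity) (by positivity)]
      congr 1
      field_simp
      ring
    rw [h1]
    gcongr
    exact ENNReal.le_tsum m
  refine ne_top_of_le_ne_top ?_ (ENNReal.tsum_le_tsum hle)
  rw [ENNReal.tsum_mul_right]
  exact ENNReal.mul_ne_top h (ENNReal.rpow_ne_top_of_nonneg hθ h)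

end Moments

section Errors

set_option linter.unusedSectionVars false

variable {Ω S : Type*} [MeasurableSpace Ω] [MeasurableSpace S] {P : Measure Ω}
  [IsProbabilityMeasure P] {d r : ℕ} {T : Set (Vec d)}
  {g : (ℕ → S) → L2Fun T r} {η : ℤ → Ω → S} {ε : ℤ → Ω → Vec d → Vec r}

lemma WeaklyDependent.stronglyMeasurable_g (hdep : WeaklyDependent P T g η ε) :
    StronglyMeasurable g := by
  let : MeasurableSpace (L2Fun T r) := borel _
  have : BorelSpace (L2Fun T r) := ⟨rfl⟩
  have : Fact ((2 : ℝ≥0∞) ≠ ∞) := ⟨by norm_num⟩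
  have : SecondCountableTopology (L2Fun T r) := inferInstance
  exact Measurable.stronglyMeasurable hdep.measurable_g

lemma couplingNorm_le_couplingMoment (hg : StronglyMeasurable g) (hη : ∀ n, Measurable (η n))
    {p : ℝ} (hp : 4 ≤ p) (m : ℕ) :
    couplingNorm P η g m ≤ couplingMoment P g η p m ^ (1 / p) := by
  have h1 := measurable_pastFrom hη 1
  have hm : StronglyMeasurable fun z : Ω × Ω =>
      g (pastFrom η 1 z.1) - g (splice m (pastFrom η 1 z.1) (pastFrom η 1 z.2)) :=
    (hg.comp_measurable (h1.comp measurable_fst)).sub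
      (hg.comp_measurable ((measurable_splice m).comp
        ((h1.comp measurable_fst).prodMk (h1.comp measurable_snd))))
  have hle : (4 : ℝ≥0∞) ≤ ENNReal.ofReal p := by
    rw [← ENNReal.ofReal_ofNat]
    exact ENNReal.ofReal_le_ofReal hp
  refine (eLpNorm_le_eLpNorm_of_exponent_le hle hm.aestronglyMeasurable).trans (le_of_eq ?_)
  rw [eLpNorm_eq_lintegral_rpow_enorm_toReal (by simp; linarith) ENNReal.ofReal_ne_top,
    ENNReal.toReal_ofReal (by linarith), couplingMoment]

lemma WeaklyDependent.tsum_couplingNorm_ne_top (hdep : WeaklyDependent P T g η ε) :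
    ∑' m, couplingNorm P η g (m + 1) ≠ ∞ := by
  obtain ⟨δ, hδ, -, κ, hκ, hsum⟩ := hdep.moments
  refine ne_top_of_le_ne_top (tsum_rpow_one_div_ne_top (p := 4 + δ) (by linarith) hκ.le hsum.ne)
    (ENNReal.tsum_le_tsum fun m => ?_)
  exact couplingNorm_le_couplingMoment hdep.stronglyMeasurable_g hdep.measurable_innov
    (by linarith) _

lemma WeaklyDependent.memLp_four (hdep : WeaklyDependent P T g η ε) :
    MemLp (fun ω => g (pastFrom η 1 ω)) 4 P := by
  obtain ⟨δ, hδ, hmom, -⟩ := hdep.moments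
  have hle : (4 : ℝ≥0∞) ≤ ENNReal.ofReal (4 + δ) := by
    rw [← ENNReal.ofReal_ofNat]
    exact ENNReal.ofReal_le_ofReal (by linarith)
  have hm : AEStronglyMeasurable (fun ω => g (pastFrom η 1 ω)) P :=
    (hdep.stronglyMeasurable_g.comp_measurable
      (measurable_pastFrom hdep.measurable_innov 1)).aestronglyMeasurable
  refine MemLp.mono_exponent (p := 4) (q := ENNReal.ofReal (4 + δ)) ⟨hm, ?_⟩ hle
  rw [eLpNorm_eq_lintegral_rpow_enorm_toReal (by simp; linarith) ENNReal.ofReal_ne_top,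
    ENNReal.toReal_ofReal (by linarith)]
  refine ENNReal.rpow_lt_top_of_nonneg (by positivity) (ne_top_of_le_ne_top hmom.ne (le_of_eq ?_))
  refine lintegral_congr_ae ?_
  filter_upwards [hdep.shift 1] with ω hω
  rw [Lp.enorm_def, eLpNorm_congr_ae hω]

variable [IsFiniteMeasure ((volume : Measure (Vec d)).restrict T)]

lemma WeaklyDependent.integral_eq_zero (hdep : WeaklyDependent P T g η ε) :
    ∫ ω, g (pastFrom η 1 ω) ∂P = 0 := by
  have h := (integral_Lp_ae_eq (hdep.memLp_four.integrable (by norm_num))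
    (Φ := fun q => ε 1 q.1 q.2) (hdep.measurable_err 1).aestronglyMeasurable
    (by filter_upwards [hdep.shift 1] with ω hω
        filter_upwards [hω] with t ht using ht.symm)).2
  refine Lp.ext ?_
  filter_upwards [h, hdep.centred, Lp.coeFn_zero (Vec r) 2 (volume.restrict T)] with t h1 h2 h3
  rw [h1, h2, h3, Pi.zero_apply]

/-- The expectation of `ε_0 ⊗ ε_n` in `L²(T × T)` is the pointwise autocovariance of lag `n`. -/
lemma WeaklyDependent.expectation_tensor_ae_eq (hdep : WeaklyDependent P T g η ε)
    {Z : ℤ → Lp (L2Fun T r) 4 P} (hZ : ∀ i, Z i =ᵐ[P] fun ω => g (pastFrom η i ω)) (n : ℤ) :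
    ∀ᵐ q ∂(((volume : Measure (Vec d)).restrict T).prod (volume.restrict T)), ∀ a b,
      Integrable (fun ω => ε 0 ω q.1 a * ε n ω q.2 b) P ∧
      expectationL P _ (bilinLp P (tensor (volume.restrict T) r) (Z 0) (Z n)) q (a, b)
        = ∫ ω, ε 0 ω q.1 a * ε n ω q.2 b ∂P := by
  have hm : Measurable fun z : Ω × (Vec d × Vec d) => outer r (ε 0 z.1 z.2.1) (ε n z.1 z.2.2) :=
    (outer r).continuous₂.measurable.comp
      (((hdep.measurable_err 0).comp (measurable_fst.prodMk measurable_snd.fst)).prodMk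
        ((hdep.measurable_err n).comp (measurable_fst.prodMk measurable_snd.snd)))
  have h := integral_Lp_ae_eq (P := P)
    (f := bilinLp P (tensor (volume.restrict T) r) (Z 0) (Z n))
    ((Lp.memLp _).integrable (by norm_num)) hm.aestronglyMeasurable (by
      filter_upwards [coeFn_bilinLp (tensor (volume.restrict T) r) (Z 0) (Z n), hZ 0, hZ n,
        hdep.shift 0, hdep.shift n] with ω h1 h2 h3 h4 h5
      rw [h1, h2, h3]
      filter_upwards [coeFn_tensor (g (pastFrom η 0 ω)) (g (pastFrom η n ω)),
        ae_prod_and h4 h5] with q h6 h7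
      rw [h6, h7.1, h7.2])
  filter_upwards [h.1, h.2] with q h1 h2 a b
  have h3 := (EuclideanSpace.proj (𝕜 := ℝ) (a, b) : MatVec r →L[ℝ] ℝ).integrable_comp h1
  refine ⟨h3, ?_⟩
  rw [expectationL_apply, h2]
  exact ((EuclideanSpace.proj (𝕜 := ℝ) (a, b) : MatVec r →L[ℝ] ℝ).integral_comp_comm h1).symm

/-- A series that converges absolutely in `L²(T × T)` converges almost everywhere. -/
lemma hasSum_autocovariance_ae
    {Γ : ℤ → Lp (MatVec r) 2 (((volume : Measure (Vec d)).restrict T).prod (volume.restrict T))}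
    {k : Lp (MatVec r) 2 (((volume : Measure (Vec d)).restrict T).prod (volume.restrict T))}
    (hΓ : ∀ n, ∀ᵐ q ∂(((volume : Measure (Vec d)).restrict T).prod (volume.restrict T)), ∀ a b,
      Integrable (fun ω => ε 0 ω q.1 a * ε n ω q.2 b) P ∧
      Γ n q (a, b) = ∫ ω, ε 0 ω q.1 a * ε n ω q.2 b ∂P)
    (hs : Summable fun n => ‖Γ n‖) (hk : HasSum Γ k) :
    ∀ᵐ q ∂(((volume : Measure (Vec d)).restrict T).prod (volume.restrict T)), ∀ a b,
      (∀ n : ℤ, Integrable (fun ω => ε 0 ω q.1 a * ε n ω q.2 b) P) ∧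
      HasSum (fun n : ℤ => ∫ ω, ε 0 ω q.1 a * ε n ω q.2 b ∂P) (k q (a, b)) := by
  have h1 : ∑' n, ‖Γ n‖ₑ ≠ ∞ := by
    simp only [← ofReal_norm]
    exact hs.tsum_ofReal_ne_top
  filter_upwards [Lp.hasSum_coeFn_tsum h1, ae_all_iff.2 hΓ] with q h2 h3 a b
  refine ⟨fun n => (h3 n a b).1, ?_⟩
  rw [hk.tsum_eq] at h2
  have h4 := (EuclideanSpace.proj (𝕜 := ℝ) (a, b) : MatVec r →L[ℝ] ℝ).hasSum h2
  have h5 : (fun n : ℤ => ∫ ω, ε 0 ω q.1 a * ε n ω q.2 b ∂P) = fun n => Γ n q (a, b) :=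
    funext fun n => (h3 n a b).2.symm
  rw [h5]
  exact h4

end Errors

section Estimator

set_option linter.unusedSectionVars false

variable {Ω H E : Type*} [MeasurableSpace Ω] {P : Measure Ω}
  [IsProbabilityMeasure P] [NormedAddCommGroup H] [InnerProductSpace ℝ H] [CompleteSpace H]
  [NormedAddCommGroup E] [InnerProductSpace ℝ E] [CompleteSpace E]

lemma coeFn_quadraticForm (B : H →L[ℝ] H →L[ℝ] E) {Z : ℤ → Lp H 4 P} {z : ℤ → Ω → H}
    (hZ : ∀ i, Z i =ᵐ[P] z i) (W : ℤ → ℝ) (c : ℝ) (I : Finset ℤ) :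
    (∑ i ∈ I, ∑ j ∈ I, W (i - j) •
        bilinLp P B (Z i - c • ∑ l ∈ I, Z l) (Z j - c • ∑ l ∈ I, Z l) : Lp E 2 P)
      =ᵐ[P] fun ω => ∑ i ∈ I, ∑ j ∈ I, W (i - j) •
        B (z i ω - c • ∑ l ∈ I, z l ω) (z j ω - c • ∑ l ∈ I, z l ω) := by
  have hd : ∀ i, (Z i - c • ∑ l ∈ I, Z l : Lp H 4 P) =ᵐ[P]
      fun ω => z i ω - c • ∑ l ∈ I, z l ω := by
    intro i
    filter_upwards [Lp.coeFn_sub (Z i) (c • ∑ l ∈ I, Z l), Lp.coeFn_smul c (∑ l ∈ I, Z l),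
      Lp.coeFn_fun_finsetSum I Z, ae_all_iff.2 hZ] with ω h1 h2 h3 h4
    rw [h1, Pi.sub_apply, h2, Pi.smul_apply, h3, h4]
    simp only [h4]
  have ht : ∀ i j, (W (i - j) •
      bilinLp P B (Z i - c • ∑ l ∈ I, Z l) (Z j - c • ∑ l ∈ I, Z l) : Lp E 2 P) =ᵐ[P]
      fun ω => W (i - j) • B (z i ω - c • ∑ l ∈ I, z l ω) (z j ω - c • ∑ l ∈ I, z l ω) := by
    intro i j
    filter_upwards [Lp.coeFn_smul (W (i - j))
      (bilinLp P B (Z i - c • ∑ l ∈ I, Z l) (Z j - c • ∑ l ∈ I, Z l)),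
      coeFn_bilinLp B (Z i - c • ∑ l ∈ I, Z l) (Z j - c • ∑ l ∈ I, Z l), hd i, hd j]
      with ω h1 h2 h3 h4
    rw [h1, Pi.smul_apply, h2, h3, h4]
  have hr : ∀ i, (∑ j ∈ I, W (i - j) •
      bilinLp P B (Z i - c • ∑ l ∈ I, Z l) (Z j - c • ∑ l ∈ I, Z l) : Lp E 2 P) =ᵐ[P]
      fun ω => ∑ j ∈ I, W (i - j) •
        B (z i ω - c • ∑ l ∈ I, z l ω) (z j ω - c • ∑ l ∈ I, z l ω) := by
    intro i
    filter_upwards [Lp.coeFn_fun_finsetSum I fun j => W (i - j) •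
      bilinLp P B (Z i - c • ∑ l ∈ I, Z l) (Z j - c • ∑ l ∈ I, Z l), ae_all_iff.2 (ht i)]
      with ω h1 h2
    rw [h1]
    exact Finset.sum_congr rfl fun j _ => h2 j
  filter_upwards [Lp.coeFn_fun_finsetSum I fun i => ∑ j ∈ I, W (i - j) •
    bilinLp P B (Z i - c • ∑ l ∈ I, Z l) (Z j - c • ∑ l ∈ I, Z l), ae_all_iff.2 hr] with ω h1 h2
  rw [h1]
  exact Finset.sum_congr rfl fun i _ => h2 i

end Estimator

section Realisation

set_option linter.unusedSectionVars false

variable {d r : ℕ} {T : Set (Vec d)} [IsFiniteMeasure ((volume : Measure (Vec d)).restrict T)]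

/-- The estimator is the kernel of the quadratic form in the demeaned errors: the common mean `m` is
removed by the demeaning. -/
lemma represents_longRunCovEst {K : ℝ → ℝ} (hK0 : K 0 = 1) (h : ℝ) {N : ℕ} (hN : 0 < N)
    {z : ℤ → L2Fun T r} {X : ℕ → Vec d → Vec r} {m : Vec d → Vec r}
    (hX : ∀ i : ℕ, 1 ≤ i → ∀ᵐ t ∂(volume.restrict T), X i t = m t + z i t) :
    Represents T (∑ i ∈ Finset.Icc (1 : ℤ) N, ∑ j ∈ Finset.Icc (1 : ℤ) N,
      lagWeight K h N (i - j) • tensor (volume.restrict T) r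
        (z i - (N : ℝ)⁻¹ • ∑ l ∈ Finset.Icc (1 : ℤ) N, z l)
        (z j - (N : ℝ)⁻¹ • ∑ l ∈ Finset.Icc (1 : ℤ) N, z l)) (longRunCovEst K h N X) := by
  set y : L2Fun T r := (N : ℝ)⁻¹ • ∑ l ∈ Finset.Icc (1 : ℤ) N, z l with hy
  have hN' : (N : ℝ) ≠ 0 := by exact_mod_cast hN.ne'
  have hdm : ∀ᵐ t ∂(volume.restrict T), ∀ i : ℕ, 1 ≤ i → (z i - y) t = demeaned N X i t := by
    have e1 : ∀ᵐ t ∂(volume.restrict T), ∀ i : ℕ, (z i - y) t = z i t - y t :=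
      ae_all_iff.2 fun i => Lp.coeFn_sub (z i) y
    have e2 : ∀ᵐ t ∂(volume.restrict T), ∀ i : ℕ, 1 ≤ i → X i t = m t + z i t :=
      ae_all_iff.2 fun i => by
        by_cases hi : 1 ≤ i
        · filter_upwards [hX i hi] with t ht _ using ht
        · exact ae_of_all _ fun t h => absurd h hi
    filter_upwards [e1, e2, Lp.coeFn_smul (N : ℝ)⁻¹ (∑ l ∈ Finset.Icc (1 : ℤ) N, z l),
      Lp.coeFn_fun_finsetSum (Finset.Icc (1 : ℤ) N) z] with t h1 h2 h3 h4 i hi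
    have hmean : sampleMean N X t = m t + y t := by
      rw [hy, h3, Pi.smul_apply, h4, sum_Icc_int_eq (fun l => z l t), sampleMean,
        Finset.sum_congr rfl fun j hj => h2 j (Finset.mem_Icc.1 hj).1, Finset.sum_add_distrib,
        Finset.sum_const, Nat.card_Icc, Nat.add_sub_cancel, smul_add, ← Nat.cast_smul_eq_nsmul ℝ,
        smul_smul, inv_mul_cancel₀ hN', one_smul]
    rw [h1, demeaned, hmean, h2 i hi]
    abel
  have hc : ∀ i j : ℕ, ∀ᵐ q ∂(((volume : Measure (Vec d)).restrict T).prod (volume.restrict T)),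
      (lagWeight K h N ((i : ℤ) - j) • tensor (volume.restrict T) r (z i - y) (z j - y)) q
        = lagWeight K h N ((i : ℤ) - j) • outer r ((z i - y) q.1) ((z j - y) q.2) := by
    intro i j
    filter_upwards [Lp.coeFn_smul (lagWeight K h N ((i : ℤ) - j))
      (tensor (volume.restrict T) r (z i - y) (z j - y)), coeFn_tensor (z i - y) (z j - y)]
      with q h1 h2
    rw [h1, Pi.smul_apply, h2]
  have hr : ∀ i : ℕ, ∀ᵐ q ∂(((volume : Measure (Vec d)).restrict T).prod (volume.restrict T)),
      (∑ j ∈ Finset.Icc 1 N,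
        lagWeight K h N ((i : ℤ) - (j : ℕ)) • tensor (volume.restrict T) r (z i - y) (z j - y) :
          Lp (MatVec r) 2 (((volume : Measure (Vec d)).restrict T).prod (volume.restrict T))) q
        = ∑ j ∈ Finset.Icc 1 N,
          lagWeight K h N ((i : ℤ) - (j : ℕ)) • outer r ((z i - y) q.1) ((z j - y) q.2) := by
    intro i
    filter_upwards [Lp.coeFn_fun_finsetSum (Finset.Icc 1 N) fun j : ℕ =>
      lagWeight K h N ((i : ℤ) - j) • tensor (volume.restrict T) r (z i - y) (z j - y),
      ae_all_iff.2 (hc i)]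
      with q h1 h2
    rw [h1]
    exact Finset.sum_congr rfl fun j _ => h2 j
  simp only [sum_Icc_int_eq]
  filter_upwards [Lp.coeFn_fun_finsetSum (Finset.Icc 1 N) fun i : ℕ => ∑ j ∈ Finset.Icc 1 N,
      lagWeight K h N ((i : ℤ) - j) • tensor (volume.restrict T) r (z i - y) (z j - y),
      ae_all_iff.2 hr, ae_prod_and hdm hdm] with q h1 h2 h3 a b
  rw [longRunCovEst_apply hK0 h hN, h1, Finset.sum_congr rfl fun i _ => h2 i]
  simp only [WithLp.ofLp_sum, Finset.sum_apply, PiLp.smul_apply, outer_apply, smul_eq_mul]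
  refine Finset.sum_congr rfl fun i hi => Finset.sum_congr rfl fun j hj => ?_
  rw [h3.1 i (Finset.mem_Icc.1 hi).1, h3.2 j (Finset.mem_Icc.1 hj).1]

end Realisation

section Probability

variable {Ω F : Type*} [MeasurableSpace Ω] {P : Measure Ω} [IsProbabilityMeasure P]
  [NormedAddCommGroup F]

lemma tendsto_measure_norm_sub_const {f : ℕ → Lp F 2 P} {c : F}
    (hf : Tendsto f atTop (𝓝 (Lp.const 2 P c))) {x : ℝ} (hx : 0 < x) :
    Tendsto (fun N => P {ω | x ≤ ‖f N ω - c‖}) atTop (𝓝 0) := by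
  have h := tendstoInMeasure_of_tendsto_Lp hf (ENNReal.ofReal x) (by simpa using hx)
  refine h.congr fun N => measure_congr ?_
  filter_upwards [Lp.coeFn_const (p := 2) (μ := P) c] with ω hω
  have : (ENNReal.ofReal x ≤ edist (f N ω) (Lp.const 2 P c ω)) = (x ≤ ‖f N ω - c‖) := by
    rw [hω, edist_dist, dist_eq_norm, ENNReal.ofReal_le_ofReal_iff (norm_nonneg _)]
    rfl
  exact this

end Probability

/-! ### Consistency -/

section Limit

variable {Ω S : Type*} [MeasurableSpace Ω] [MeasurableSpace S] {P : Measure Ω}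
  [IsProbabilityMeasure P] {η : ℤ → Ω → S}
  {H : Type*} [NormedAddCommGroup H] [InnerProductSpace ℝ H] [CompleteSpace H]
  {E : Type*} [NormedAddCommGroup E] [InnerProductSpace ℝ E] [CompleteSpace E]

/-- Consistency of the weighted quadratic forms of a centred function of the past with summable
coupling coefficients. The limit `k` is the absolutely convergent sum of the autocovariances. -/
lemma exists_longRunCovariance (hη : ∀ n, Measurable (η n)) (hind : iIndepFun η P)
    (hid : ∀ n, IdentDistrib (η n) (η 0) P P) {g : (ℕ → S) → H} (hg : StronglyMeasurable g)
    (h4 : MemLp (fun ω => g (pastFrom η 1 ω)) 4 P) (h0 : ∫ ω, g (pastFrom η 1 ω) ∂P = 0)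
    (hsum : ∑' m, couplingNorm P η g (m + 1) ≠ ∞) {B : H →L[ℝ] H →L[ℝ] E} (hB : ‖B‖ ≤ 1)
    {Z : ℤ → Lp H 4 P} (hZ : ∀ i, Z i =ᵐ[P] fun ω => g (pastFrom η i ω)) :
    ∃ k : E, (Summable fun n : ℤ => ‖expectationL P E (bilinLp P B (Z 0) (Z n))‖) ∧
      HasSum (fun n : ℤ => expectationL P E (bilinLp P B (Z 0) (Z n))) k ∧
      ∀ {W : ℕ → ℤ → ℝ} {C : ℝ} {R : ℕ → ℕ}, BandWeights W C R →
        ∀ x > 0, Tendsto (fun N : ℕ => P {ω | x ≤ ‖∑ i ∈ Finset.Icc (1 : ℤ) N,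
          ∑ j ∈ Finset.Icc (1 : ℤ) N, W N (i - j) •
            B (g (pastFrom η i ω) - (N : ℝ)⁻¹ • ∑ l ∈ Finset.Icc (1 : ℤ) N, g (pastFrom η l ω))
              (g (pastFrom η j ω) - (N : ℝ)⁻¹ • ∑ l ∈ Finset.Icc (1 : ℤ) N, g (pastFrom η l ω))
          - k‖}) atTop (𝓝 0) := by
  obtain ⟨U, A, D, hU, hUZ, hD⟩ := exists_reversedMartingaleArray hη hind hid hg h4 h0 hsum B hZ
  have hcov := hU.hasSum_autocovariance hB hUZ hD
  refine ⟨∑' p : ℕ × ℕ, D p.1 p.2, hcov.1, hcov.2, fun {W C R} hW x hx => ?_⟩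
  have hlim := hU.tendsto_quadraticForm_demeaned hB hUZ hD hW
    (Y := fun N => (N : ℝ)⁻¹ • ∑ l ∈ Finset.Icc (1 : ℤ) N, Z l) fun _ => rfl
  refine (tendsto_measure_norm_sub_const hlim hx).congr fun N => measure_congr ?_
  filter_upwards [coeFn_quadraticForm B hZ (W N) (N : ℝ)⁻¹ (Finset.Icc (1 : ℤ) N)] with ω hω
  refine congrArg (fun v : E => x ≤ ‖v - _‖) ?_
  exact hω

end Limit

end

theorem lemma1 {Ω S : Type*} [MeasurableSpace Ω] [MeasurableSpace S]
    (P : Measure Ω) [IsProbabilityMeasure P]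
    {d r : ℕ} (hd : 1 ≤ d) (hr : 1 ≤ r)
    (T : Set (Vec d)) (hT : IsCompact T)
    (g : (ℕ → S) → L2Fun T r) (η : ℤ → Ω → S) (ε : ℤ → Ω → Vec d → Vec r)
    (hdep : WeaklyDependent P T g η ε)
    (m : Vec d → Vec r) (hm : MemLp m 2 (volume.restrict T))
    (X : ℕ → Ω → Vec d → Vec r)
    (hX : ∀ i : ℕ, 1 ≤ i → ∀ ω, ∀ t ∈ T, X i ω t = m t + ε (i : ℤ) ω t)
    (K : ℝ → ℝ) (hK : KernelAssumption K)
    (h : ℕ → ℝ) (hh : BandwidthAssumption h) :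
    -- the series that defines the long-run covariance kernel makes sense almost everywhere,
    (∀ᵐ q ∂((volume.restrict T).prod (volume.restrict T)), ∀ a b : Fin r,
      (∀ ℓ : ℤ, Integrable (fun ω => ε 0 ω q.1 a * ε ℓ ω q.2 b) P) ∧
      Summable (fun ℓ : ℤ => ∫ ω, ε 0 ω q.1 a * ε ℓ ω q.2 b ∂P)) ∧
    -- and the kernel is square integrable;
    (∀ a b : Fin r, MemLp (fun q : Vec d × Vec d => longRunCov P ε q.1 q.2 a b) 2
      ((volume.restrict T).prod (volume.restrict T))) ∧
    -- the estimator is consistent in integrated squared Frobenius norm,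
    (∀ x : ℝ, 0 < x → Tendsto (fun N : ℕ => P {ω | ENNReal.ofReal x ≤
        intSqDist T (longRunCovEst K (h N) N (fun i => X i ω)) (longRunCov P ε)})
      atTop (𝓝 0)) ∧
    -- and so is every ordered eigenvalue.
    (∀ ℓ : ℕ, 1 ≤ ℓ → ∀ x : ℝ, 0 < x → Tendsto (fun N : ℕ => P {ω | x ≤
        |orderedEigenvalue T (longRunCovEst K (h N) N (fun i => X i ω)) ℓ
          - orderedEigenvalue T (longRunCov P ε) ℓ|})
      atTop (𝓝 0)) := by
  have : IsFiniteMeasure ((volume : Measure (Vec d)).restrict T) :=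
    ⟨by rw [Measure.restrict_apply_univ]; exact hT.measure_lt_top⟩
  have hg := hdep.stronglyMeasurable_g
  have h4 := hdep.memLp_four
  obtain ⟨Z, hZ⟩ : ∃ Z : ℤ → Lp (L2Fun T r) 4 P,
      ∀ i, Z i =ᵐ[P] fun ω => g (pastFrom η i ω) :=
    ⟨fun i => (memLp_comp_pastFrom hdep.measurable_innov hdep.indep_innov hdep.ident_innov hg h4
      i).toLp, fun i => MemLp.coeFn_toLp _⟩
  obtain ⟨k, hs, hk, hlim⟩ := exists_longRunCovariance hdep.measurable_innov
    hdep.indep_innov hdep.ident_innov hg h4 hdep.integral_eq_zero hdep.tsum_couplingNorm_ne_top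
    (norm_tensor_le (μ := (volume : Measure (Vec d)).restrict T) (r := r)) hZ
  have hae := hasSum_autocovariance_ae (hdep.expectation_tensor_ae_eq hZ) hs hk
  have hrep : Represents T k (longRunCov P ε) := by
    filter_upwards [hae] with q hq a b
    exact (hq a b).2.tsum_eq
  obtain ⟨C, R, hW⟩ := exists_bandWeights hK hh
  replace hlim := hlim hW
  obtain ⟨Q, hQ⟩ : ∃ Q : ℕ → Ω → Lp (MatVec r) 2
      (((volume : Measure (Vec d)).restrict T).prod (volume.restrict T)),
      Q = fun (N : ℕ) ω => ∑ i ∈ Finset.Icc (1 : ℤ) N, ∑ j ∈ Finset.Icc (1 : ℤ) N,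
        lagWeight K (h N) N (i - j) • tensor (volume.restrict T) r
          (g (pastFrom η i ω) - (N : ℝ)⁻¹ • ∑ l ∈ Finset.Icc (1 : ℤ) N, g (pastFrom η l ω))
          (g (pastFrom η j ω) - (N : ℝ)⁻¹ • ∑ l ∈ Finset.Icc (1 : ℤ) N, g (pastFrom η l ω)) :=
    ⟨_, rfl⟩
  have hprob : ∀ x : ℝ, 0 < x → Tendsto (fun N => P {ω | x ≤ ‖Q N ω - k‖}) atTop (𝓝 0) := by
    rw [hQ]
    exact hlim
  -- `Q N` is the kernel of the estimator, almost surely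
  have hQrep : ∀ N : ℕ, 0 < N → ∀ᵐ ω ∂P, IsCompactSymmKernel (Q N ω) ∧
      Represents T (Q N ω) (longRunCovEst K (h N) N fun i => X i ω) := by
    intro N hN
    filter_upwards [ae_all_iff.2 hdep.shift] with ω h2
    rw [hQ]
    refine ⟨isCompactSymmKernel_sum_tensor _ (fun i j => lagWeight K (h N) N (i - j))
      (fun i j => by rw [← lagWeight_neg, neg_sub]) _, ?_⟩
    refine represents_longRunCovEst hK.zero (h N) hN (m := m) fun i hi => ?_
    filter_upwards [h2 i, ae_restrict_mem hT.measurableSet] with t h3 h5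
    rw [hX i hi ω t h5, h3]
  -- `k` is a limit of the kernels `Q N ω`: the events on which these are close to `k` are
  -- eventually not null
  have hksymm : IsCompactSymmKernel k := by
    refine IsCompactSymmKernel.of_approx fun x hx => ?_
    obtain ⟨N, hN1, hN2⟩ := (((hprob x hx).eventually_lt_const zero_lt_one).and
      (eventually_gt_atTop 0)).exists
    by_contra! hcon
    refine hN1.ne ?_
    rw [← measure_univ (μ := P)]
    refine measure_congr ?_
    filter_upwards [hQrep N hN2] with ω hω
    exact eq_true (hcon _ hω.1)
  refine ⟨?_, ?_, ?_, ?_⟩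
  · filter_upwards [hae] with q hq a b
    exact ⟨(hq a b).1, (hq a b).2.summable⟩
  · intro a b
    refine ((EuclideanSpace.proj (𝕜 := ℝ) (a, b) : MatVec r →L[ℝ] ℝ).comp_memLp'
      (Lp.memLp k)).ae_eq ?_
    filter_upwards [hrep] with q hq
    exact (hq a b).symm
  · intro x hx
    refine tendsto_of_tendsto_of_tendsto_of_le_of_le' tendsto_const_nhds
      (hprob _ (Real.sqrt_pos.2 hx)) (Eventually.of_forall fun _ => zero_le) ?_
    filter_upwards [eventually_gt_atTop 0] with N hN
    refine measure_mono_ae ?_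
    filter_upwards [hQrep N hN] with ω hω hxω
    change ENNReal.ofReal x ≤ _ at hxω
    rw [hω.2.intSqDist_eq hrep, ENNReal.ofReal_le_ofReal_iff (by positivity)] at hxω
    exact Real.sqrt_le_iff.2 ⟨norm_nonneg _, hxω⟩
  · intro ℓ hℓ x hx
    refine tendsto_of_tendsto_of_tendsto_of_le_of_le' tendsto_const_nhds
      (hprob x hx) (Eventually.of_forall fun _ => zero_le) ?_
    filter_upwards [eventually_gt_atTop 0] with N hN
    refine measure_mono_ae ?_
    filter_upwards [hQrep N hN] with ω hω hxω
    exact le_trans hxω (hω.2.abs_orderedEigenvalue_sub_le hrep hω.1 hksymm hℓ)
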